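/- For a positive integer $k$, the $k$-path power with layout $\langle x_1,\dots,x_n\rangle$ is the graph on $\{x_1,\dots,x_n\}$ in which $x_i$ and $x_j$, $i\neq j$, are adjacent if and only if $|i-j|\le k$. The linear clique-width $\mathrm{lcwd}(G)$ of a finite graph $G$ is the least number of labels with which $G$ can be built, starting from the empty graph, by the following operations: adding a single new vertex with a label, as a disjoint union; adding all edges between the vertices of label $i$ and the vertices of label $j$, where $i\neq j$; changing every label $i$ into $j$. The gem is the path on four vertices together with one further vertex adjacent to all four. Let $M^-_2$ be the disjoint union of two gems, and let $M^+_2$ be obtained from $M^-_2$ by adding one edge that joins a vertex of degree $2$ of one gem to a vertex of degree $2$ of the other gem. For integers $k\ge 3$ and $l\ge 0$, let $M_{k,1,l}$ be obtained from the disjoint union of two $k$-path powers, each on $n=k^2$ vertices, with layouts $\langle v_1,\dots,v_n\rangle$ and $\langle v'_1,\dots,v'_n\rangle$, and of $l$ new vertices $w_1,\dots,w_l$, by adding the edges of the path $v_n,w_1,\dots,w_l,v'_n$ (of length $l+1$). Then the following hold. 1. Every proper induced subgraph of $M^+_2$ and every proper induced subgraph of $M^-_2$ has linear clique-width at most $3$.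 2. For all $k\ge 3$ and $l\ge 0$, every proper induced subgraph of $M_{k,1,l}$ has linear clique-width at most $k+1$. 3. These graphs are minimal forbidden induced subgraphs: $\mathrm{lcwd}(M^+_2)>3$ and $\mathrm{lcwd}(M^-_2)>3$, so that $M^+_2$ and $M^-_2$ are minimal forbidden induced subgraphs for the graphs of linear clique-width at most $3$; and $\mathrm{lcwd}(M_{k,1,l})>k+1$ for all $k\ge 3$ and $l\ge 0$, so that $M_{k,1,l}$ is a minimal forbidden induced subgraph for the graphs of linear clique-width at most $k+1$. -/

import Mathlib

namespace LinCW

/-- The labelled graphs that are values of linear `k`-expressions, with vertices taken from `V`.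
`LinearExpr k S H lab` says that some linear `k`-expression has as its value the labelled graph
with vertex set `S`, with edges those of `H` (none of which leaves `S`), and with the label `lab v`
at every vertex `v` of `S`; the values of `lab` outside `S` are irrelevant.
The operations are: the empty graph; the disjoint union with a single new labelled vertex; the
addition of all edges between the vertices of label `i` and those of label `j`, where `i ≠ j`;
the change of every label `i` into the label `j`. -/
inductive LinearExpr {V : Type*} (k : ℕ) : Set V → SimpleGraph V → (V → Fin k) → Prop
  | empty (lab : V → Fin k) : LinearExpr k ∅ ⊥ lab
  | addVertex {S : Set V} {H : SimpleGraph V} {lab : V → Fin k} (v : V) (lab' : V → Fin k) :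
      LinearExpr k S H lab → v ∉ S → (∀ u ∈ S, lab' u = lab u) →
      LinearExpr k (insert v S) H lab'
  | join {S : Set V} {H : SimpleGraph V} {lab : V → Fin k} (i j : Fin k) :
      LinearExpr k S H lab → i ≠ j →
      LinearExpr k S
        (H ⊔ SimpleGraph.fromRel fun u w => u ∈ S ∧ w ∈ S ∧ lab u = i ∧ lab w = j) lab
  | relabel {S : Set V} {H : SimpleGraph V} {lab : V → Fin k} (i j : Fin k) :
      LinearExpr k S H lab →
      LinearExpr k S H (fun u => if lab u = i then j else lab u)

/-- `G` has a linear `k`-expression. -/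
def HasLinearExpr {V : Type*} (k : ℕ) (G : SimpleGraph V) : Prop :=
  ∃ lab : V → Fin k, LinearExpr k Set.univ G lab

/-- The linear clique-width of `G`: the least `k` such that `G` has a linear `k`-expression. -/
noncomputable def lcwd {V : Type*} (G : SimpleGraph V) : ℕ∞ :=
  sInf {m : ℕ∞ | ∃ k : ℕ, m = (k : ℕ∞) ∧ HasLinearExpr k G}

/-- The `k`-path power on `n` vertices: distinct vertices are adjacent if and only if their
positions in the layout differ by at most `k`. -/
def pathPower (k n : ℕ) : SimpleGraph (Fin n) where
  Adj i j := i ≠ j ∧ i.val ≤ j.val + k ∧ j.val ≤ i.val + k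
  symm := ⟨fun _ _ h => ⟨h.1.symm, h.2.2, h.2.1⟩⟩
  loopless := ⟨fun _ h => h.1 rfl⟩

/-- The gem: the induced path `0, 1, 2, 3` together with the vertex `4`, which is adjacent to all
vertices of the path. -/
def gem : SimpleGraph (Fin 5) :=
  SimpleGraph.fromRel fun i j => (i.val + 1 = j.val ∧ j.val < 4) ∨ j.val = 4

/-- The disjoint union of two gems. -/
def MMinusTwo : SimpleGraph (Fin 5 ⊕ Fin 5) := SimpleGraph.sum gem gem

/-- Two disjoint gems together with one edge, which joins an end of the path of one gem and an end
of the path of the other gem. -/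
def MPlusTwo : SimpleGraph (Fin 5 ⊕ Fin 5) :=
  MMinusTwo ⊔ SimpleGraph.edge (Sum.inl 3) (Sum.inr 3)

/-- The edges by which the path `w_1, ..., w_l` is put between the last vertices `v_n` and `v'_n`
of two layouts with `n` vertices each: the edge `v_n v'_n` if `l = 0`, and the edges `v_n w_1` and
`w_l v'_n` if `l ≥ 1`. -/
def linkRel (n l : ℕ) : Fin n ⊕ (Fin n ⊕ Fin l) → Fin n ⊕ (Fin n ⊕ Fin l) → Prop
  | Sum.inl i, Sum.inr (Sum.inl j) => l = 0 ∧ i.val + 1 = n ∧ j.val + 1 = n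
  | Sum.inl i, Sum.inr (Sum.inr t) => i.val + 1 = n ∧ t.val = 0
  | Sum.inr (Sum.inl j), Sum.inr (Sum.inr t) => j.val + 1 = n ∧ t.val + 1 = l
  | _, _ => False

/-- `M_{k,1,l}`: two disjoint `k`-path powers on `k ^ 2` vertices each, whose last vertices are
joined by an induced path of length `l + 1` with `l` new inner vertices. -/
def MGraph (k l : ℕ) : SimpleGraph (Fin (k ^ 2) ⊕ (Fin (k ^ 2) ⊕ Fin l)) :=
  SimpleGraph.sum (pathPower k (k ^ 2)) (SimpleGraph.sum (pathPower k (k ^ 2)) (pathPower 1 l)) ⊔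
    SimpleGraph.fromRel (linkRel (k ^ 2) l)

end LinCW

namespace LinCW

/-! ### Linear expressions and neighbourhood types -/

section General

variable {V W : Type*} {k : ℕ}

/-! Call the set of neighbours of an added vertex among the vertices not yet added its trace.
Vertices with equal traces can be merged into one label. Hence an order of the vertices with at most
`k` traces before every addition gives an expression with `k + 1` labels, the additional one being
for the new vertex (`Reach.add`). Conversely, an expression gives an order in which, whenever the
new vertex cannot enter with the label of an earlier one (`Shares`), the traces and the new vertex
need pairwise different labels (`HasLinearExpr.exists_order`).

Upper bound for `MGraph`. It is enough to delete one vertex `d`. A path power is cut into rows of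
length `k`, and the cells are filled so that the traces essentially depend on the row: the triangle
below the diagonal, column 0 below `d`, the diagonal, column 0 above `d`, and then the columns from
right to left. Cutting so that `d` lies in column 0 makes this work with `k` traces: at `d` column 0
can be split into two pieces (`Reach.addPunctured`). An intact path power is filled in the same way,
except that its last vertex waits until a colour becomes free; this colour then serves the current
end of the attached path (`Reach.addWithTail`). An intact power with its part of the path comes
first. A punctured power, or the other intact power if `d` is on the path, comes afterwards.

Lower bound for `MGraph`. In each power consider the first vertex of the residue class modulo `k`
that is reached last. Just before it, `T` meets all other classes and misses this one, which forces
`k - 1` traces inside the power (`exists_spread`). Take the power where this happens later. Two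
further traces come from the other power and the path, or one comes from there and one from the last
vertex of the present power; in one situation the count is made at a later addition
(`exists_spread_of_last`). The result is `k + 1` traces and a new vertex that needs its own label,
too many for `k + 1` labels.

The gems obey the same scheme. In the gem whose critical addition comes later there are two nonempty
traces, and the other gem supplies an empty one. The statements about single gems, and the orders
for the upper bound, are finite checks. -/

theorem LinearExpr.mem_of_adj {S : Set V} {H : SimpleGraph V} {lab : V → Fin k}
    (h : LinearExpr k S H lab) {u w : V} (huw : H.Adj u w) : u ∈ S ∧ w ∈ S := by
  induction h with
  | empty lab => simp at huw
  | addVertex v lab' _ _ _ ih => exact ⟨Or.inr (ih huw).1, Or.inr (ih huw).2⟩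
  | join i j _ _ ih =>
    rcases huw with huw | huw
    · exact ih huw
    · rw [SimpleGraph.fromRel_adj] at huw
      rcases huw.2 with h | h
      · exact ⟨h.1, h.2.1⟩
      · exact ⟨h.2.1, h.1⟩
  | relabel i j _ ih => exact ih huw

/-- Skipping the additions of vertices outside the range of `f` turns an expression for a graph into
one for an induced subgraph. -/
theorem LinearExpr.comap (f : W ↪ V) {S : Set V} {H : SimpleGraph V} {lab : V → Fin k}
    (h : LinearExpr k S H lab) :
    ∃ lab' : W → Fin k, LinearExpr k (f ⁻¹' S) (H.comap f) lab' ∧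
      ∀ w, f w ∈ S → lab' w = lab (f w) := by
  induction h with
  | empty lab =>
    refine ⟨lab ∘ f, ?_, fun _ h => h.elim⟩
    have : (⊥ : SimpleGraph V).comap f = ⊥ := by ext; simp
    rw [this]
    exact LinearExpr.empty _
  | @addVertex S H lab v lab' _ hv hlab ih =>
    obtain ⟨l, hl, hl'⟩ := ih
    by_cases hw : ∃ w, f w = v
    · obtain ⟨w, rfl⟩ := hw
      refine ⟨lab' ∘ f, ?_, fun _ _ => rfl⟩
      have : f ⁻¹' (insert (f w) S) = insert w (f ⁻¹' S) := by
        ext x; simp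
      rw [this]
      exact LinearExpr.addVertex w _ hl hv fun u hu => by
        rw [hl' u hu]; exact hlab _ hu
    · refine ⟨l, ?_, ?_⟩
      · have : f ⁻¹' (insert v S) = f ⁻¹' S := by
          ext x
          simp only [Set.mem_preimage, Set.mem_insert_iff, or_iff_right_iff_imp]
          exact fun h => (hw ⟨x, h⟩).elim
        rw [this]
        exact hl
      · rintro w (h | h)
        · exact (hw ⟨w, h⟩).elim
        · rw [hl' w h, hlab _ h]
  | @join S H lab i j _ hij ih =>
    obtain ⟨l, hl, hl'⟩ := ih
    refine ⟨l, ?_, hl'⟩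
    convert LinearExpr.join i j hl hij using 1
    ext u w
    simp only [SimpleGraph.comap_adj, SimpleGraph.sup_adj, SimpleGraph.fromRel_adj,
      Set.mem_preimage, ne_eq, f.injective.eq_iff]
    constructor <;> rintro (h | ⟨h1, ⟨h2, h3, h4⟩ | ⟨h2, h3, h4⟩⟩)
    · exact Or.inl h
    · exact Or.inr ⟨h1, Or.inl ⟨h2, h3, by rwa [hl' _ h2, hl' _ h3]⟩⟩
    · exact Or.inr ⟨h1, Or.inr ⟨h2, h3, by rwa [hl' _ h2, hl' _ h3]⟩⟩
    · exact Or.inl h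
    · exact Or.inr ⟨h1, Or.inl ⟨h2, h3, by rwa [← hl' _ h2, ← hl' _ h3]⟩⟩
    · exact Or.inr ⟨h1, Or.inr ⟨h2, h3, by rwa [← hl' _ h2, ← hl' _ h3]⟩⟩
  | relabel i j _ ih =>
    obtain ⟨l, hl, hl'⟩ := ih
    refine ⟨_, LinearExpr.relabel i j hl, fun w hw => ?_⟩
    simp only [hl' w hw]

theorem LinearExpr.joinAll {S : Set V} {H : SimpleGraph V} {lab : V → Fin k}
    (h : LinearExpr k S H lab) (f : Fin k) (s : Finset (Fin k)) (hf : f ∉ s) :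
    LinearExpr k S
      (H ⊔ SimpleGraph.fromRel fun u w => u ∈ S ∧ w ∈ S ∧ lab u ∈ s ∧ lab w = f) lab := by
  induction s using Finset.induction_on with
  | empty =>
    convert h using 1
    ext u w
    simp
  | @insert a s _ ih =>
    have hs : f ∉ s := fun h => hf (Finset.mem_insert_of_mem h)
    have ha : a ≠ f := fun h => hf (h ▸ Finset.mem_insert_self _ _)
    convert LinearExpr.join a f (ih hs) ha using 1
    ext u w
    simp only [SimpleGraph.sup_adj, SimpleGraph.fromRel_adj, Finset.mem_insert]
    tauto

/-- The labels are changed one at a time. Idempotence makes the order irrelevant: a label that is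
already a value of `φ` is fixed by `φ`, so a later change does not move it again. -/
theorem LinearExpr.mapLabels {S : Set V} {H : SimpleGraph V} {lab : V → Fin k}
    (h : LinearExpr k S H lab) (φ : Fin k → Fin k) (hφ : ∀ a, φ (φ a) = φ a) :
    LinearExpr k S H fun v => φ (lab v) := by
  have key : ∀ s : Finset (Fin k),
      LinearExpr k S H fun v => if lab v ∈ s then φ (lab v) else lab v := by
    intro s
    induction s using Finset.induction_on with
    | empty => simpa using h
    | @insert a s ha ih =>
      convert LinearExpr.relabel a (φ a) ih using 1
      funext v
      by_cases h1 : lab v ∈ s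
      · simp only [h1, Finset.mem_insert, or_true, if_true]
        split_ifs with h2
        · rw [← h2, hφ]
        · rfl
      · by_cases h2 : lab v = a
        · simp [h2, ha]
        · simp [h1, h2]
  simpa using key Finset.univ

/-- Labels may be merged along an equivalence relation that they refine. -/
theorem LinearExpr.merge {S : Set V} {H : SimpleGraph V} {lab : V → Fin k}
    (h : LinearExpr k S H lab) (r : Setoid V)
    (hr : ∀ y ∈ S, ∀ z ∈ S, lab y = lab z → r y z) :
    ∃ lab' : V → Fin k, LinearExpr k S H lab' ∧
      ∀ y ∈ S, ∀ z ∈ S, (lab' y = lab' z ↔ r y z) := by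
  classical
  let r' : Setoid S := r.comap Subtype.val
  let ρ : S → S := fun y => (Quotient.mk r' y).out
  have hρ : ∀ y, r (ρ y) y := fun y => Quotient.mk_out (s := r') y
  have hρ' : ∀ y z : S, r y z → ρ y = ρ z := fun y z hyz => by
    have : Quotient.mk r' y = Quotient.mk r' z := Quotient.sound hyz
    simp only [ρ, this]
  -- Each label goes to the label of the chosen representative of its class. Unused labels stay
  -- fixed, which keeps `φ` idempotent.
  let φ : Fin k → Fin k := fun a =>
    if ha : ∃ y : S, lab y = a then lab (ρ ha.choose) else a
  have hφ : ∀ y : S, φ (lab y) = lab (ρ y) := fun y => by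
    have ha : ∃ y' : S, lab y' = lab y := ⟨y, rfl⟩
    simp only [φ, dif_pos ha]
    rw [hρ' _ _ (hr _ ha.choose.2 _ y.2 ha.choose_spec)]
  have hidem : ∀ a, φ (φ a) = φ a := by
    intro a
    by_cases ha : ∃ y : S, lab y = a
    · obtain ⟨y, rfl⟩ := ha
      rw [hφ, hφ, hρ' _ _ (hρ y)]
    · have : φ a = a := dif_neg ha
      rw [this, this]
  refine ⟨_, h.mapLabels φ hidem, fun y hy z hz => ?_⟩
  rw [hφ ⟨y, hy⟩, hφ ⟨z, hz⟩]
  constructor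
  · intro hyz
    have := hr _ (ρ ⟨y, hy⟩).2 _ (ρ ⟨z, hz⟩).2 hyz
    exact r.trans (r.symm (hρ ⟨y, hy⟩)) (r.trans this (hρ ⟨z, hz⟩))
  · intro hyz
    rw [hρ' ⟨y, hy⟩ ⟨z, hz⟩ hyz]

/-- The edges of `G` between vertices of `T`. -/
def restrict (G : SimpleGraph V) (T : Set V) : SimpleGraph V where
  Adj u w := G.Adj u w ∧ u ∈ T ∧ w ∈ T
  symm := ⟨fun _ _ h => ⟨h.1.symm, h.2.2, h.2.1⟩⟩
  loopless := ⟨fun _ h => h.1.ne rfl⟩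

/-- `y` and `z` have the same neighbours in `U`. -/
def sameTrace (G : SimpleGraph V) (U : Set V) : Setoid V where
  r y z := ∀ u ∈ U, G.Adj y u ↔ G.Adj z u
  iseqv := ⟨fun _ _ _ => Iff.rfl, fun h u hu => (h u hu).symm,
    fun h h' u hu => (h u hu).trans (h' u hu)⟩

/-- `G` restricted to `T` has a linear expression whose labels are the neighbourhood types of the
vertices of `T` outside `T`, within `G` restricted to `W`. -/
def Reach (k : ℕ) (G : SimpleGraph V) (W T : Set V) : Prop :=
  T ⊆ W ∧ ∃ lab : V → Fin k, LinearExpr k T (restrict G T) lab ∧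
    ∀ y ∈ T, ∀ z ∈ T, (lab y = lab z ↔ sameTrace G (W \ T) y z)

/-- The vertices of `T` have at most `k` neighbourhood types outside `T`. -/
def Colorable (k : ℕ) (G : SimpleGraph V) (W T : Set V) : Prop :=
  ∃ c : V → ℕ, (∀ y ∈ T, c y < k) ∧
    ∀ y ∈ T, ∀ z ∈ T, c y = c z → ∀ u ∈ W, u ∉ T → G.Adj y u → G.Adj z u

theorem Reach.empty (G : SimpleGraph V) (W : Set V) : Reach (k + 1) G W ∅ := by
  refine ⟨Set.empty_subset _, fun _ => 0, ?_, fun _ h => h.elim⟩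
  convert LinearExpr.empty (V := V) (k := k + 1) (fun _ => 0) using 1
  ext u w
  simp [restrict]

/-- With `k` traces and one label per trace, one of the `k + 1` labels is unused. The new vertex
takes it and is joined to the labels of its neighbours; then the labels whose traces have become
equal are merged. -/
theorem Reach.add {G : SimpleGraph V} {W T : Set V} (h : Reach (k + 1) G W T)
    (hc : Colorable k G W T) {x : V} (hx : x ∈ W) : Reach (k + 1) G W (insert x T) := by
  classical
  by_cases hxT : x ∈ T
  · rwa [Set.insert_eq_of_mem hxT]
  obtain ⟨hTW, lab, hlab, hiff⟩ := h
  obtain ⟨c, hck, hc⟩ := hc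
  -- If every label occurred, two representatives of different labels would have the same colour,
  -- hence the same trace, hence the same label.
  have hfree : ∃ f : Fin (k + 1), ∀ y ∈ T, lab y ≠ f := by
    by_contra! hcon
    choose g hgT hg using hcon
    obtain ⟨a, b, hab, heq⟩ := Fintype.exists_ne_map_eq_of_card_lt
      (fun a => (⟨c (g a), hck _ (hgT a)⟩ : Fin k)) (by simp)
    have heq' : c (g a) = c (g b) := by simpa using heq
    apply hab
    rw [← hg a, ← hg b, hiff _ (hgT a) _ (hgT b)]
    exact fun u hu => ⟨hc _ (hgT a) _ (hgT b) heq' u hu.1 hu.2,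
      hc _ (hgT b) _ (hgT a) heq'.symm u hu.1 hu.2⟩
  obtain ⟨f, hf⟩ := hfree
  let lab1 := Function.update lab x f
  have hl1 : ∀ y ∈ T, lab1 y = lab y := fun y hy =>
    Function.update_of_ne (fun h => hxT (by rwa [← h])) _ _
  have hlx : lab1 x = f := Function.update_self _ _ _
  let s : Finset (Fin (k + 1)) := Finset.univ.filter fun a => ∃ y ∈ T, lab y = a ∧ G.Adj y x
  have hfs : f ∉ s := by
    simp only [s, Finset.mem_filter, Finset.mem_univ, true_and, not_exists, not_and]
    exact fun y hy h => (hf y hy h).elim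
  have h2 := (LinearExpr.addVertex x lab1 hlab hxT hl1).joinAll f s hfs
  have hmem : ∀ y ∈ T, (lab1 y ∈ s ↔ G.Adj y x) := by
    intro y hy
    rw [hl1 y hy]
    simp only [s, Finset.mem_filter, Finset.mem_univ, true_and]
    constructor
    · rintro ⟨z, hz, hzy, hadj⟩
      exact ((hiff z hz y hy).1 hzy x ⟨hx, hxT⟩).1 hadj
    · exact fun hadj => ⟨y, hy, rfl, hadj⟩
  have hG : (restrict G T ⊔ SimpleGraph.fromRel fun u w =>
      u ∈ insert x T ∧ w ∈ insert x T ∧ lab1 u ∈ s ∧ lab1 w = f) =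
      restrict G (insert x T) := by
    have hxs : lab1 x ∉ s := hlx ▸ hfs
    have hfT : ∀ y ∈ T, lab1 y ≠ f := fun y hy => (hl1 y hy).symm ▸ hf y hy
    ext u w
    simp only [SimpleGraph.sup_adj, SimpleGraph.fromRel_adj, restrict, Set.mem_insert_iff]
    have hu : u ∈ T → u ≠ x := fun h h' => hxT (h' ▸ h)
    have hw : w ∈ T → w ≠ x := fun h h' => hxT (h' ▸ h)
    constructor
    · rintro (⟨h, h1, h2⟩ | ⟨hne, ⟨h1, h2, h3, h4⟩ | ⟨h1, h2, h3, h4⟩⟩)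
      · exact ⟨h, Or.inr h1, Or.inr h2⟩
      · have hw' : w = x := h2.resolve_right fun h => hfT _ h h4
        have hu' : u ∈ T := h1.resolve_left fun h => hne (h.trans hw'.symm)
        exact ⟨hw' ▸ (hmem u hu').1 h3, h1, h2⟩
      · have hu' : u = x := h2.resolve_right fun h => hfT _ h h4
        have hw' : w ∈ T := h1.resolve_left fun h => hne (hu'.trans h.symm)
        exact ⟨hu' ▸ ((hmem w hw').1 h3).symm, h2, h1⟩
    · rintro ⟨h, h1 | h1, h3 | h3⟩
      · exact (h.ne (h1.trans h3.symm)).elim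
      · subst h1
        exact Or.inr ⟨h.ne, Or.inr ⟨Or.inr h3, Or.inl rfl, (hmem w h3).2 h.symm, hlx⟩⟩
      · subst h3
        exact Or.inr ⟨h.ne, Or.inl ⟨Or.inr h1, Or.inl rfl, (hmem u h1).2 h, hlx⟩⟩
      · exact Or.inl ⟨h, h1, h3⟩
  rw [hG] at h2
  -- With `x` no longer outside, the traces can only coincide more often, so the present labels
  -- refine the new trace classes.
  obtain ⟨lab', hlab', hiff'⟩ := h2.merge (sameTrace G (W \ insert x T)) (by
    rintro y (rfl | hy) z (rfl | hz) hyz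
    · exact (sameTrace _ _).refl _
    · exact ((hf z hz) (by rw [← hl1 z hz, ← hyz, hlx])).elim
    · exact ((hf y hy) (by rw [← hl1 y hy, hyz, hlx])).elim
    · rw [hl1 y hy, hl1 z hz] at hyz
      exact fun u hu => (hiff y hy z hz).1 hyz u ⟨hu.1, fun h => hu.2 (Or.inr h)⟩)
  exact ⟨Set.insert_subset hx hTW, lab', hlab', hiff'⟩

theorem Reach.hasLinearExpr {G : SimpleGraph V} {W s : Set V} (h : Reach k G W W) (hs : s ⊆ W) :
    HasLinearExpr k (G.induce s) := by
  obtain ⟨-, lab, hlab, -⟩ := h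
  obtain ⟨lab', hlab', -⟩ := hlab.comap (Function.Embedding.subtype (· ∈ s))
  refine ⟨lab', ?_⟩
  convert hlab' using 1
  · ext v
    simpa using hs v.2
  · ext u w
    simp [restrict, hs u.2, hs w.2]

theorem lcwd_le {G : SimpleGraph V} (h : HasLinearExpr k G) : lcwd G ≤ k :=
  sInf_le ⟨k, rfl, h⟩

/-- Every `m ≤ k` is excluded separately, so no monotonicity in the number of labels is needed. -/
theorem lt_lcwd {G : SimpleGraph V} (h : ∀ m ≤ k, ¬ HasLinearExpr m G) : (k : ℕ∞) < lcwd G := by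
  refine lt_of_lt_of_le (b := ((k + 1 : ℕ) : ℕ∞)) (by exact_mod_cast Nat.lt_succ_self k)
    (le_sInf ?_)
  rintro _ ⟨m, rfl, hm⟩
  by_contra hlt
  exact h m (by rw [not_le] at hlt; exact Nat.lt_succ_iff.1 (by exact_mod_cast hlt)) hm

/-! ### The vertex order of an expression -/

/-- The new vertex `x` may be added with the label of a vertex `y` added before. -/
def Shares (G : SimpleGraph V) (τ : V → ℕ) (x y : V) : Prop :=
  τ y < τ x ∧ ¬ G.Adj x y ∧ (∀ z, G.Adj x z → G.Adj y z) ∧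
    ∀ z, τ x < τ z → G.Adj y z → G.Adj x z

/-- The map `c` is the labelling at the moment when `x` has just been added. Equal labels stay
equal, and all edges that end at `x` or at a later vertex are inserted after this moment, so they do
not distinguish vertices with equal labels. The clauses about the final labelling `lab` keep the
induction going. -/
theorem LinearExpr.exists_order {S : Set V} {H : SimpleGraph V} {lab : V → Fin k}
    (h : LinearExpr k S H lab) : ∃ τ : V → ℕ, S.InjOn τ ∧ (∃ N, ∀ v ∈ S, τ v < N) ∧
      ∀ x ∈ S, ∃ c : V → Fin k,
        (∀ y ∈ S, ∀ z ∈ S, τ y < τ x → τ z < τ x → c y = c z → lab y = lab z ∧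
          ∀ u ∈ S, τ x ≤ τ u → (H.Adj y u ↔ H.Adj z u)) ∧
        (∀ y ∈ S, τ y < τ x → c y = c x → lab y = lab x ∧ ¬ H.Adj x y ∧
          (∀ z, H.Adj x z → H.Adj y z) ∧ ∀ z, τ x < τ z → H.Adj y z → H.Adj x z) := by
  classical
  induction h with
  | empty lab => exact ⟨fun _ => 0, by simp, ⟨0, by simp⟩, fun _ h => h.elim⟩
  | @addVertex S H lab v lab' hS hv hlab ih =>
    obtain ⟨τ, hinj, ⟨N, hN⟩, hc⟩ := ih
    let τ' := Function.update τ v N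
    have hτv : τ' v = N := Function.update_self _ _ _
    have hτ : ∀ u ∈ S, τ' u = τ u := fun u hu =>
      Function.update_of_ne (fun h => hv (by rwa [← h])) _ _
    have hout : ∀ y, ¬ H.Adj y v := fun y h => hv (hS.mem_of_adj h).2
    have hout' : ∀ y, ¬ H.Adj v y := fun y h => hv (hS.mem_of_adj h).1
    refine ⟨τ', ?_, ⟨N + 1, ?_⟩, ?_⟩
    · rintro y (rfl | hy) z (rfl | hz) hyz
      · rfl
      · rw [hτv, hτ z hz] at hyz; exact absurd (hN z hz) (by omega)
      · rw [hτv, hτ y hy] at hyz; exact absurd (hN y hy) (by omega)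
      · rw [hτ z hz, hτ y hy] at hyz; exact hinj hy hz hyz
    · rintro y (rfl | hy)
      · omega
      · rw [hτ y hy]; exact (hN y hy).trans (Nat.lt_succ_self _)
    · rintro x (rfl | hx)
      · refine ⟨lab', ?_, ?_⟩
        · rintro y (rfl | hy) z (rfl | hz) hy' hz' hyz
          · exact absurd hy' (lt_irrefl _)
          · exact absurd hy' (lt_irrefl _)
          · exact absurd hz' (lt_irrefl _)
          · refine ⟨hyz, ?_⟩
            rintro u (rfl | hu) hxu
            · simp [hout]
            · rw [hτv, hτ u hu] at hxu; exact absurd (hN u hu) (by omega)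
        · rintro y (rfl | hy) hy' hyx
          · exact absurd hy' (lt_irrefl _)
          · refine ⟨hyx, hout' y, fun z hz => (hout' z hz).elim, fun z hz hadj => ?_⟩
            have hzS := (hS.mem_of_adj hadj).2
            rw [hτv, hτ z hzS] at hz
            exact absurd (hN z hzS) (by omega)
      · obtain ⟨c, hc1, hc2⟩ := hc x hx
        have hlt : ∀ y ∈ insert v S, τ' y < τ' x → y ∈ S ∧ τ y < τ x := by
          rintro y (rfl | hy) hlt
          · rw [hτv, hτ x hx] at hlt; exact absurd (hN x hx) (by omega)
          · rw [hτ y hy, hτ x hx] at hlt; exact ⟨hy, hlt⟩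
        refine ⟨c, ?_, ?_⟩
        · intro y hy z hz hy' hz' hyz
          obtain ⟨hy, hy'⟩ := hlt y hy hy'
          obtain ⟨hz, hz'⟩ := hlt z hz hz'
          obtain ⟨h1, h2⟩ := hc1 y hy z hz hy' hz' hyz
          refine ⟨by rw [hlab y hy, hlab z hz, h1], ?_⟩
          rintro u (rfl | hu) hxu
          · simp [hout]
          · rw [hτ x hx, hτ u hu] at hxu; exact h2 u hu hxu
        · intro y hy hy' hyx
          obtain ⟨hy, hy'⟩ := hlt y hy hy'
          obtain ⟨h1, h2, h3, h4⟩ := hc2 y hy hy' hyx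
          refine ⟨by rw [hlab y hy, hlab x hx, h1], h2, h3, fun z hz hadj => ?_⟩
          have hzS := (hS.mem_of_adj hadj).2
          rw [hτ x hx, hτ z hzS] at hz
          exact h4 z hz hadj
  | @join S H lab i j hS hij ih =>
    obtain ⟨τ, hinj, hN, hc⟩ := ih
    refine ⟨τ, hinj, hN, fun x hx => ?_⟩
    obtain ⟨c, hc1, hc2⟩ := hc x hx
    have new : ∀ y ∈ S, ∀ z ∈ S, lab y = lab z → ∀ u, u ≠ z → (H.Adj y u → H.Adj z u) →
        (H ⊔ SimpleGraph.fromRel fun u w => u ∈ S ∧ w ∈ S ∧ lab u = i ∧ lab w = j).Adj y u →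
        (H ⊔ SimpleGraph.fromRel fun u w => u ∈ S ∧ w ∈ S ∧ lab u = i ∧ lab w = j).Adj z u := by
      intro y hy z hz hyz u huz himp
      simp only [SimpleGraph.sup_adj, SimpleGraph.fromRel_adj]
      rintro (h | ⟨-, ⟨h1, h2, h3, h4⟩ | ⟨h1, h2, h3, h4⟩⟩)
      · exact Or.inl (himp h)
      · exact Or.inr ⟨huz.symm, Or.inl ⟨hz, h2, hyz ▸ h3, h4⟩⟩
      · exact Or.inr ⟨huz.symm, Or.inr ⟨h1, hz, h3, hyz ▸ h4⟩⟩
    have hsame : ∀ y z, lab y = lab z → ¬ H.Adj y z →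
        ¬ (H ⊔ SimpleGraph.fromRel fun u w => u ∈ S ∧ w ∈ S ∧ lab u = i ∧ lab w = j).Adj y z := by
      intro y z hyz hn
      simp only [SimpleGraph.sup_adj, SimpleGraph.fromRel_adj]
      rintro (h | ⟨-, ⟨h1, h2, h3, h4⟩ | ⟨h1, h2, h3, h4⟩⟩)
      · exact hn h
      · exact hij (by rw [← h3, ← h4, hyz])
      · exact hij (by rw [← h3, ← h4, hyz])
    refine ⟨c, ?_, ?_⟩
    · intro y hy z hz hy' hz' hyz
      obtain ⟨h1, h2⟩ := hc1 y hy z hz hy' hz' hyz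
      refine ⟨h1, fun u hu hxu => ⟨new y hy z hz h1 u ?_ (h2 u hu hxu).1,
        new z hz y hy h1.symm u ?_ (h2 u hu hxu).2⟩⟩
      · rintro rfl; omega
      · rintro rfl; omega
    · intro y hy hy' hyx
      obtain ⟨h1, h2, h3, h4⟩ := hc2 y hy hy' hyx
      have hxy := hsame x y h1.symm h2
      refine ⟨h1, hxy, fun z hz => new x hx y hy h1.symm z ?_ (h3 z) hz, fun z hz =>
        new y hy x hx h1 z ?_ (h4 z hz)⟩
      · rintro rfl; exact hxy hz
      · rintro rfl; omega
  | @relabel S H lab i j hS ih =>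
    obtain ⟨τ, hinj, hN, hc⟩ := ih
    refine ⟨τ, hinj, hN, fun x hx => ?_⟩
    obtain ⟨c, hc1, hc2⟩ := hc x hx
    refine ⟨c, ?_, ?_⟩
    · intro y hy z hz hy' hz' hyz
      obtain ⟨h1, h2⟩ := hc1 y hy z hz hy' hz' hyz
      exact ⟨by simp only [h1], h2⟩
    · intro y hy hy' hyx
      obtain ⟨h1, h2⟩ := hc2 y hy hy' hyx
      exact ⟨by simp only [h1], h2⟩

/-- The order in which the vertices are added, and the bound for the number of the neighbourhood
types of the vertices added before `x`, if `x` needs a label of its own. -/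
theorem HasLinearExpr.exists_order {G : SimpleGraph V} (h : HasLinearExpr k G) :
    ∃ τ : V → ℕ, Function.Injective τ ∧ ∀ x, (∀ y, ¬ Shares G τ x y) → ∀ A : Finset V,
      (∀ a ∈ A, τ a < τ x) →
      (∀ a ∈ A, ∀ b ∈ A, a ≠ b → ∃ u, τ x ≤ τ u ∧ ¬ (G.Adj a u ↔ G.Adj b u)) →
      A.card + 1 ≤ k := by
  classical
  obtain ⟨lab, h⟩ := h
  obtain ⟨τ, hinj, -, hc⟩ := h.exists_order
  refine ⟨τ, fun a b hab => hinj trivial trivial hab, fun x hx A hA hdist => ?_⟩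
  obtain ⟨c, hc1, hc2⟩ := hc x trivial
  have hxA : x ∉ A := fun h => lt_irrefl _ (hA x h)
  have hcx : ∀ y, τ y < τ x → c y ≠ c x := by
    intro y hy hyx
    obtain ⟨-, h2, h3, h4⟩ := hc2 y trivial hy hyx
    exact hx y ⟨hy, h2, h3, h4⟩
  have hcinj : Set.InjOn c (insert x A : Finset V) := by
    intro a ha b hb hab
    simp only [Finset.coe_insert, Set.mem_insert_iff, Finset.mem_coe] at ha hb
    rcases ha with rfl | ha <;> rcases hb with rfl | hb
    · rfl
    · exact (hcx b (hA b hb) hab.symm).elim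
    · exact (hcx a (hA a ha) hab).elim
    · by_contra hne
      obtain ⟨u, hu, hn⟩ := hdist a ha b hb hne
      exact hn ((hc1 a trivial b trivial (hA a ha) (hA b hb) hab).2 u trivial hu)
  have := Finset.card_le_card_of_injOn (t := Finset.univ) c (fun _ _ => Finset.mem_univ _) hcinj
  rwa [Finset.card_insert_of_notMem hxA, Finset.card_univ, Fintype.card_fin] at this

end General

/-! ### The cells of a path power and colourings of their traces -/

section Cells

/-- The cells of a path power on `k ^ 2` vertices, cut into rows of length `k` with an offset. -/
def Valid (k q a j : ℕ) : Prop := a ≤ k ∧ j < k ∧ (a = 0 → k ≤ j + q) ∧ (a = k → j + q < k)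

/-- The adjacency of distinct cells of a path power. -/
def Near (a j a' j' : ℕ) : Prop := a = a' ∨ a' = a + 1 ∧ j' ≤ j ∨ a = a' + 1 ∧ j ≤ j'

/-- A cell outside the set `X` that counts for the neighbourhood types: the cell `(a₀, 0)` is
missing, unless it is the last one. -/
def Open (k q a₀ : ℕ) (X : ℕ → ℕ → Prop) (x y : ℕ) : Prop :=
  Valid k q x y ∧ ¬ X x y ∧ (x = a₀ → y = 0 → a₀ = k ∧ q + 1 = k)

/-- The triangle strictly below the diagonal, without column 0. It is entered row by row from the
bottom, each row from right to left; `h` is the current row and `m` the column reached in it. -/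
def stairs (h m a j : ℕ) : Prop := (1 ≤ j ∧ j + 1 ≤ a) ∧ (h < a ∨ a = h ∧ m ≤ j)

/-- Rows from `h + 2` on have one trace each, with the colours above `h`. Row `h + 1` still
distinguishes the open cells of row `h` and uses colours up to `max m 1`; row `h` uses the colours
between. If `h` is the lowest row that meets the triangle, the shift by one is dropped. Colour 0
stays free for vertices without open neighbours, and `k - 1` stays free too if `q + 1 = k`. -/
def stairsColor (k q h m a j : ℕ) : ℕ :=
  if h + 2 ≤ a then a - 1 else if a = h + 1 then min j (max m 1)
    else if h = k ∨ h + 1 = k ∧ q + 1 = k then j else j + 1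

theorem stairsColor_mem {k q h m a j : ℕ} (hv : Valid k q a j) (hx : stairs h m a j) :
    1 ≤ stairsColor k q h m a j ∧ stairsColor k q h m a j < k ∧
      (q + 1 = k → stairsColor k q h m a j + 1 ≠ k) := by
  unfold Valid stairs stairsColor at *
  split_ifs <;> omega

set_option maxHeartbeats 2000000 in
theorem stairsColor_near {k q h m a₀ a j a' j' x y : ℕ} (hv : Valid k q a j)
    (hv' : Valid k q a' j') (hX : stairs h m a j) (hX' : stairs h m a' j')
    (hU : Open k q a₀ (stairs h m) x y)
    (hc : stairsColor k q h m a j = stairsColor k q h m a' j') (hn : Near a j x y) :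
    Near a' j' x y := by
  obtain ⟨hu, hU, -⟩ := hU
  unfold Valid stairs stairsColor Near at *
  obtain ⟨hX, hXh⟩ := hX
  obtain ⟨hX', hXh'⟩ := hX'
  rcases hXh with hXh | hXh <;> rcases hXh' with hXh' | hXh' <;>
    rcases hn with hn | hn | hn <;> split_ifs at hc <;> omega

/-- Column 0 is entered below the missing cell, from top to bottom. -/
def leftUpper (a₀ t a j : ℕ) : Prop := (1 ≤ j ∧ j + 1 ≤ a) ∨ (j = 0 ∧ a₀ < a ∧ a < t)

theorem rowColor_mem {k q a₀ t a j : ℕ} (h₀ : 1 ≤ a₀) (hv : Valid k q a j)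
    (hx : leftUpper a₀ t a j) : 1 ≤ a - 1 ∧ a - 1 < k := by
  unfold Valid leftUpper at *
  omega

/-- Cells of row `a` see the same open cells of rows `a` and `a - 1` and, below, only `(a + 1, 0)`.
The exception would be `(a - 1, 0)`, which only the cell of column 0 sees. It is never open: it was
entered before, or it is the missing cell. -/
theorem rowColor_near {k q a₀ t a j a' j' x y : ℕ} (h₀ : 1 ≤ a₀) (hv : Valid k q a j)
    (hv' : Valid k q a' j') (hX : leftUpper a₀ t a j) (hX' : leftUpper a₀ t a' j')
    (hU : Open k q a₀ (leftUpper a₀ t) x y)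
    (hc : a - 1 = a' - 1) (hn : Near a j x y) :
    Near a' j' x y := by
  unfold Open Valid leftUpper Near at *
  omega

/-- The diagonal is entered from bottom to top, down to row number `h`. -/
def diagonal (a₀ h a j : ℕ) : Prop :=
  (1 ≤ j ∧ j + 1 ≤ a) ∨ (j = 0 ∧ a₀ < a) ∨ (j = a ∧ 1 ≤ j ∧ h ≤ a)

/-- A row has colour `a - 1` while it sees the open diagonal cell `(a - 1, a - 1)`. When that cell
has been entered, the row has the trace of its own diagonal cell and takes colour `a`. The bottom
row then sees nothing open and gets colour 0. -/
def diagonalColor (k h a j : ℕ) : ℕ :=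
  if a = k then (if h < k then 0 else k - 1) else if j = a ∨ h < a then a else a - 1

theorem diagonalColor_mem {k q h a j : ℕ} (hv : Valid k q a j) : diagonalColor k h a j < k := by
  unfold Valid diagonalColor at *
  split_ifs <;> omega

theorem diagonalColor_dead {k q a₀ h a j x y : ℕ} (h₀ : 1 ≤ a₀) (h₁ : a₀ ≤ k)
    (hv : Valid k q a j) (hX : diagonal a₀ h a j) (hU : Open k q a₀ (diagonal a₀ h) x y)
    (hc : diagonalColor k h a j = 0) : ¬ Near a j x y := by
  unfold Open Valid diagonal diagonalColor Near at *
  split_ifs at hc <;> omega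

def diagonalTrace (h c x y : ℕ) : Prop :=
  c ≠ 0 ∧ if c < h then y = 0 ∧ (x = c + 1 ∨ x = c + 2) ∨ 1 ≤ y ∧ (x = c + 1 ∨ x = c)
    else y = 0 ∧ (x = c ∨ x = c + 1) ∨ 1 ≤ y ∧ (x = c ∨ x + 1 = c ∧ c ≤ y)

theorem near_iff_diagonalTrace {k q a₀ h a j x y : ℕ} (h₀ : 1 ≤ a₀) (h₁ : a₀ ≤ k)
    (hv : Valid k q a j) (hX : diagonal a₀ h a j) (hU : Open k q a₀ (diagonal a₀ h) x y) :
    Near a j x y ↔ diagonalTrace h (diagonalColor k h a j) x y := by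
  obtain ⟨hu, hU, hU₀⟩ := hU
  unfold Valid diagonal diagonalTrace diagonalColor Near at *
  rcases hX with hX | hX | hX <;> split_ifs <;> omega

/-- Column 0 is now entered above the missing cell, again from top to bottom. -/
def leftLower (a₀ t a j : ℕ) : Prop :=
  (1 ≤ j ∧ j ≤ a) ∨ (j = 0 ∧ a₀ < a) ∨ (j = 0 ∧ a < a₀ ∧ a < t)

/-- What remains lies above the diagonal. The columns are entered from right to left, each from top
to bottom, and `t` is the height reached in column `m`. -/
def columns (a₀ m t a j : ℕ) : Prop :=
  (j ≤ a ∧ ¬ (a = a₀ ∧ j = 0)) ∨ (m < j ∧ a + 1 ≤ j) ∨ (j = m ∧ a + 1 ≤ m ∧ a < t)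

/-- The colour names the upper one of the two consecutive rows whose open cells are seen. On or
below the diagonal these are `a - 1` and `a`, above it `a` and `a + 1`. -/
def stripColor (a j : ℕ) : ℕ := if j ≤ a then a - 1 else a

theorem stripColor_mem {k q a j : ℕ} (hv : Valid k q a j) : stripColor a j < k := by
  unfold Valid stripColor at *
  split_ifs <;> omega

theorem near_iff_leftLower {k q a₀ t a j x y : ℕ} (hq : q < k) (h₁ : a₀ ≤ k)
    (hv : Valid k q a j) (hX : leftLower a₀ t a j) (hU : Open k q a₀ (leftLower a₀ t) x y) :
    Near a j x y ↔ x = stripColor a j + 1 ∨ x = stripColor a j ∧ 1 ≤ y ∨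
      x = stripColor a j + 2 ∧ y = 0 := by
  obtain ⟨hu, hU, hU₀⟩ := hU
  unfold Valid leftLower stripColor Near at *
  rcases hX with hX | hX | hX <;> split_ifs <;> omega

theorem leftLower_dead {k q a₀ t a j x y : ℕ} (hk : 3 ≤ k) (h₁ : a₀ ≤ k)
    (hv : Valid k q a j) (hX : leftLower a₀ t a j) (hU : Open k q a₀ (leftLower a₀ t) x y)
    (hc : stripColor a j = k - 1) : ¬ Near a j x y := by
  unfold Open Valid leftLower stripColor Near at *
  split_ifs at hc <;> omega

/-- In the columns phase the missing cell does not count, even if it is the last one. -/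
theorem near_iff_columns {k q a₀ m t a j x y : ℕ} (hq : q < k) (h₀ : 1 ≤ a₀)
    (hv : Valid k q a j) (hX : columns a₀ m t a j) (hU : Open k q a₀ (columns a₀ m t) x y)
    (hx : ¬ (x = a₀ ∧ y = 0)) :
    Near a j x y ↔ x = stripColor a j ∨ x = stripColor a j + 1 := by
  obtain ⟨hu, hU, hU₀⟩ := hU
  unfold Valid columns stripColor Near at *
  rcases hX with hX | hX | hX <;> split_ifs <;> omega

theorem columns_dead {k q a₀ m t a j x y : ℕ} (hk : 3 ≤ k) (h₁ : a₀ ≤ k)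
    (hv : Valid k q a j) (hU : Open k q a₀ (columns a₀ m t) x y)
    (hx : ¬ (x = a₀ ∧ y = 0)) (hc : stripColor a j = k - 1) : ¬ Near a j x y := by
  unfold Open Valid columns stripColor Near at *
  split_ifs at hc <;> omega

/-- With `(k, 0)` still open, row `k - 1` is told apart by seeing it. The cell `(k - 2, k - 1)`
would share its strip colour, but sees nothing open once it has been entered, so it takes the dead
colour. -/
def lastColor (k a j : ℕ) : ℕ := if a + 2 = k ∧ j + 1 = k then k - 1 else stripColor a j

theorem near_iff_lastColor {k t a j x y : ℕ} (hk : 3 ≤ k)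
    (hv : Valid k (k - 1) a j) (hX : columns k (k - 1) t a j)
    (hU : Open k (k - 1) k (columns k (k - 1) t) x y) :
    Near a j x y ↔ lastColor k a j + 1 ≠ k ∧ (x < k ∧ (x = lastColor k a j ∨
      x = lastColor k a j + 1) ∨ x = k ∧ lastColor k a j + 2 = k) := by
  obtain ⟨hu, hU, hU₀⟩ := hU
  unfold Valid columns lastColor stripColor Near at *
  rcases hX with hX | hX | hX <;> split_ifs <;> omega

/-- After the last cell has been added, the last row needs no colour of its own. -/
def spareColor (k a j : ℕ) : ℕ :=
  if k ≤ a + 1 ∨ a + 2 = k ∧ j + 1 = k then k - 1 else stripColor a j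

theorem spareColor_mem {k q a j : ℕ} (hk : 3 ≤ k) (hv : Valid k q a j) :
    spareColor k a j < k ∧ spareColor k a j ≠ k - 2 := by
  unfold Valid spareColor stripColor at *
  split_ifs <;> omega

theorem near_iff_spareColor {k m t a j x y : ℕ} (hk : 3 ≤ k) (hm : m + 2 ≤ k)
    (hv : Valid k (k - 1) a j) (hX : columns k m t a j)
    (hU : Open k (k - 1) k (columns k m t) x y) (hx : ¬ (x = k ∧ y = 0)) :
    Near a j x y ↔ spareColor k a j + 1 ≠ k ∧
      (x = spareColor k a j ∨ x = spareColor k a j + 1) := by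
  obtain ⟨hu, hU, hU₀⟩ := hU
  unfold Valid columns spareColor stripColor Near at *
  rcases hX with hX | hX | hX <;> split_ifs <;> omega

end Cells

/-! ### From cells to vertices of a path power -/

section Phases

/-- The shift by `k` makes the subtraction exact for `q < k`; new rows begin at the positions
congruent to `q`. -/
def row (k q p : ℕ) : ℕ := (p + k - q) / k

def col (k q p : ℕ) : ℕ := (p + k - q) % k

theorem row_col {k q p : ℕ} (hq : q < k) : k * row k q p + col k q p + q = p + k := by
  have := Nat.div_add_mod (p + k - q) k
  unfold row col
  omega

theorem col_lt {k q p : ℕ} (hq : q < k) : col k q p < k := Nat.mod_lt _ (by omega)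

theorem row_col_unique {k q p a j : ℕ} (hq : q < k) (hj : j < k) (h : k * a + j + q = p + k) :
    row k q p = a ∧ col k q p = j := by
  have : p + k - q = j + k * a := by omega
  unfold row col
  rw [this, Nat.add_mul_div_left _ _ (by omega), Nat.add_mul_mod_self_left,
    Nat.div_eq_of_lt hj, Nat.mod_eq_of_lt hj]
  simp

theorem valid_cell {k q p : ℕ} (hq : q < k) (hp : p < k ^ 2) :
    Valid k q (row k q p) (col k q p) := by
  have h := row_col (p := p) hq
  have hj := col_lt (p := p) hq
  have hk : row k q p ≤ k := by
    by_contra! hlt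
    have : k * (k + 1) ≤ k * row k q p := Nat.mul_le_mul_left _ hlt
    nlinarith
  refine ⟨hk, hj, fun h0 => ?_, fun h0 => ?_⟩
  · rw [h0] at h; omega
  · rw [h0] at h; nlinarith

theorem near_cell_iff {k q p p' : ℕ} (hq : q < k) :
    p ≤ p' + k ∧ p' ≤ p + k ↔
      Near (row k q p) (col k q p) (row k q p') (col k q p') := by
  have h := row_col (p := p) hq
  have hj := col_lt (p := p) hq
  have h' := row_col (p := p') hq
  have hj' := col_lt (p := p') hq
  unfold Near
  generalize row k q p = a at *
  generalize row k q p' = a' at *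
  rcases lt_trichotomy a a' with hlt | rfl | hlt
  · rcases Nat.eq_or_lt_of_le (Nat.succ_le_of_lt hlt) with rfl | hlt'
    · rw [Nat.succ_eq_add_one, mul_add, mul_one] at *
      omega
    · have := Nat.mul_le_mul_left k (Nat.succ_le_of_lt hlt')
      simp only [Nat.succ_eq_add_one, mul_add, mul_one] at this
      omega
  · omega
  · rcases Nat.eq_or_lt_of_le (Nat.succ_le_of_lt hlt) with rfl | hlt'
    · rw [Nat.succ_eq_add_one, mul_add, mul_one] at *
      omega
    · have := Nat.mul_le_mul_left k (Nat.succ_le_of_lt hlt')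
      simp only [Nat.succ_eq_add_one, mul_add, mul_one] at this
      omega

theorem cell_injective {k q p p' : ℕ} (hq : q < k) (h1 : row k q p = row k q p')
    (h2 : col k q p = col k q p') : p = p' := by
  have h := row_col (p := p) hq
  have h' := row_col (p := p') hq
  rw [h1, h2] at h
  omega

variable {V : Type*} {k : ℕ} {G : SimpleGraph V}

/-- The vertices at the cells in `X`. -/
def cells (e : pathPower k (k ^ 2) ↪g G) (q : ℕ) (X : ℕ → ℕ → Prop) : Set V :=
  e '' {p | X (row k q p) (col k q p)}

theorem mem_cells {e : pathPower k (k ^ 2) ↪g G} {q : ℕ} {X : ℕ → ℕ → Prop} {p : Fin (k ^ 2)} :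
    e p ∈ cells e q X ↔ X (row k q p) (col k q p) :=
  e.injective.mem_set_image

theorem cells_congr {e : pathPower k (k ^ 2) ↪g G} {q : ℕ} (hq : q < k) {X Y : ℕ → ℕ → Prop}
    (h : ∀ a j, Valid k q a j → (X a j ↔ Y a j)) : cells e q X = cells e q Y := by
  unfold cells
  congr 1
  ext p
  exact h _ _ (valid_cell hq p.2)

theorem adj_iff_near {e : pathPower k (k ^ 2) ↪g G} {q : ℕ} (hq : q < k) {p p' : Fin (k ^ 2)} :
    G.Adj (e p) (e p') ↔
      p ≠ p' ∧ Near (row k q p) (col k q p) (row k q p') (col k q p') := by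
  rw [e.map_adj_iff, ← near_cell_iff hq]
  rfl

/-- A step may also add nothing. This lets the later chains run through cells that do not exist in
the incomplete first and last rows. -/
theorem Reach.chain {W : Set V} (S : ℕ → Set V) (N : ℕ) (h : Reach (k + 1) G W (S 0))
    (hc : ∀ t < N, Colorable k G W (S t))
    (hS : ∀ t < N, ∃ x, S t ⊆ S (t + 1) ∧ S (t + 1) ⊆ insert x (S t) ∧ S (t + 1) ⊆ W) :
    Reach (k + 1) G W (S N) := by
  induction N with
  | zero => exact h
  | succ N ih =>
    have ih := ih (fun t ht => hc t (by omega)) fun t ht => hS t (by omega)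
    obtain ⟨x, h1, h2, h3⟩ := hS N (by omega)
    by_cases hx : x ∈ S (N + 1)
    · rw [h2.antisymm (Set.insert_subset hx h1)]
      exact ih.add (hc N (by omega)) (h3 hx)
    · have : S (N + 1) = S N := by
        refine Set.Subset.antisymm (fun v hv => ?_) h1
        rcases h2 hv with rfl | h
        · exact (hx hv).elim
        · exact h
      rwa [this]

theorem Reach.cellChain {W Out : Set V} {e : pathPower k (k ^ 2) ↪g G} {q : ℕ} (hq : q < k)
    (X : ℕ → ℕ → ℕ → Prop) (N : ℕ) (h : Reach (k + 1) G W (cells e q (X 0) ∪ Out))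
    (hc : ∀ t < N, Colorable k G W (cells e q (X t) ∪ Out))
    (α β : ℕ → ℕ) (hX : ∀ t < N, ∀ a j, Valid k q a j → (X t a j → X (t + 1) a j) ∧
      (X (t + 1) a j → X t a j ∨ a = α t ∧ j = β t))
    (hW : ∀ t < N, cells e q (X (t + 1)) ⊆ W) :
    Reach (k + 1) G W (cells e q (X N) ∪ Out) := by
  refine Reach.chain (fun t => cells e q (X t) ∪ Out) N h hc fun t ht => ?_
  have hmono : cells e q (X t) ⊆ cells e q (X (t + 1)) := by
    rintro _ ⟨p, hp, rfl⟩
    exact ⟨p, (hX t ht _ _ (valid_cell hq p.2)).1 hp, rfl⟩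
  have hOut : Out ⊆ W := Set.subset_union_right.trans h.1
  have hsub : cells e q (X (t + 1)) ∪ Out ⊆ W := Set.union_subset (hW t ht) hOut
  by_cases hx : ∃ p : Fin (k ^ 2), row k q p = α t ∧ col k q p = β t
  · obtain ⟨p, hp1, hp2⟩ := hx
    refine ⟨e p, Set.union_subset_union_left _ hmono, ?_, hsub⟩
    rintro _ (⟨p', hp', rfl⟩ | hv)
    · rcases (hX t ht _ _ (valid_cell hq p'.2)).2 hp' with h | ⟨h1, h2⟩
      · exact Or.inr (Or.inl ⟨p', h, rfl⟩)
      · exact Or.inl (congrArg e (Fin.ext (cell_injective hq (h1.trans hp1.symm)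
          (h2.trans hp2.symm))))
    · exact Or.inr (Or.inr hv)
  -- There is no vertex at the cell `(α t, β t)`, so the set does not grow, but `Reach.chain` still
  -- asks for some vertex.
  · by_cases hV : Nonempty V
    · obtain ⟨v⟩ := hV
      refine ⟨v, Set.union_subset_union_left _ hmono, ?_, hsub⟩
      rintro _ (⟨p', hp', rfl⟩ | hv)
      · rcases (hX t ht _ _ (valid_cell hq p'.2)).2 hp' with h | h
        · exact Or.inr (Or.inl ⟨p', h, rfl⟩)
        · exact (hx ⟨p', h⟩).elim
      · exact Or.inr (Or.inr hv)
    · exact (hV ⟨e ⟨0, by have : 0 < k := by omega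
                          positivity⟩⟩).elim

/-- A colouring of the cells in `X` gives a colouring of the vertices, if the other vertices, with
at most one exception, have no neighbours that have not been added. -/
theorem colorable_of_cells {W Out : Set V} {e : pathPower k (k ^ 2) ↪g G} {q a₀ : ℕ} (hq : q < k)
    {X : ℕ → ℕ → Prop} (c : ℕ → ℕ → ℕ) (δ γ : ℕ) (star : V)
    (hOut : ∀ p, e p ∈ Out → ¬ X (row k q p) (col k q p))
    (hd : ∀ p : Fin (k ^ 2), e p ∈ W → e p ∉ Out → row k q p = a₀ → col k q p = 0 →
      a₀ = k ∧ q + 1 = k)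
    (hE : ∀ p : Fin (k ^ 2), X (row k q p) (col k q p) → ∀ u ∈ W, u ∉ Out → G.Adj (e p) u →
      u ∈ Set.range e)
    (hlt : ∀ a j, Valid k q a j → X a j → c a j < k)
    (hnear : ∀ a j a' j', Valid k q a j → Valid k q a' j' → X a j → X a' j' →
      c a j = c a' j' → ∀ p : Fin (k ^ 2), e p ∈ W → e p ∉ Out →
      Open k q a₀ X (row k q p) (col k q p) →
      Near a j (row k q p) (col k q p) → Near a' j' (row k q p) (col k q p))
    (hδ : δ < k) (hdead : ∀ a j, Valid k q a j → X a j → c a j = δ → ∀ p : Fin (k ^ 2), e p ∈ W → e p ∉ Out →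
      Open k q a₀ X (row k q p) (col k q p) → ¬ Near a j (row k q p) (col k q p))
    (hs : ∀ o ∈ Out, o ≠ star → ∀ u ∈ W, u ∉ cells e q X → u ∉ Out → ¬ G.Adj o u)
    (hstar : (star ∈ Out → ∀ u ∈ W, u ∉ cells e q X → u ∉ Out → ¬ G.Adj star u) ∨
      (γ < k ∧ γ ≠ δ ∧ ∀ a j, Valid k q a j → X a j → c a j ≠ γ)) :
    Colorable k G W (cells e q X ∪ Out) := by
  classical
  have hopen : ∀ p : Fin (k ^ 2), e p ∈ W → e p ∉ cells e q X ∪ Out →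
      Open k q a₀ X (row k q p) (col k q p) := fun p hp hpT =>
    ⟨valid_cell hq p.2, fun h => hpT (Or.inl (mem_cells.2 h)),
      hd p hp fun h => hpT (Or.inr h)⟩
  -- `D` says that `star` needs no colour of its own. Otherwise it takes `γ`; all other vertices of
  -- `Out` take the dead colour `δ`.
  let D : Prop := star ∈ Out → ∀ u ∈ W, u ∉ cells e q X → u ∉ Out → ¬ G.Adj star u
  let f : V → ℕ := fun v =>
    if h : v ∈ cells e q X then c (row k q h.choose) (col k q h.choose)
    else if v = star ∧ ¬ D then γ else δ
  have hf : ∀ p : Fin (k ^ 2), X (row k q p) (col k q p) → f (e p) = c (row k q p) (col k q p) := by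
    intro p hp
    have h : e p ∈ cells e q X := mem_cells.2 hp
    have : h.choose = p := e.injective h.choose_spec.2
    simp only [f, dif_pos h, this]
  have hfo : ∀ o ∈ Out, f o = if o = star ∧ ¬ D then γ else δ := by
    intro o ho
    refine dif_neg ?_
    rintro ⟨p, hp, rfl⟩
    exact hOut p ho hp
  have hfo' : ∀ o ∈ Out, (f o = γ ∧ o = star ∧ ¬ D) ∨
      (f o = δ ∧ ∀ u ∈ W, u ∉ cells e q X → u ∉ Out → ¬ G.Adj o u) := by
    intro o ho
    rw [hfo o ho]
    split_ifs with h
    · exact Or.inl ⟨rfl, h⟩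
    · refine Or.inr ⟨rfl, ?_⟩
      by_cases ho' : o = star
      · subst ho'
        have : D := by tauto
        exact this ho
      · exact hs o ho ho'
  have hγ : ¬ D → γ < k ∧ γ ≠ δ ∧ ∀ a j, Valid k q a j → X a j → c a j ≠ γ :=
    fun hD => hstar.resolve_left hD
  refine ⟨f, ?_, ?_⟩
  · rintro _ (⟨p, hp, rfl⟩ | hv)
    · rw [hf p hp]; exact hlt _ _ (valid_cell hq p.2) hp
    · rcases hfo' _ hv with ⟨h, -, hD⟩ | ⟨h, -⟩
      · rw [h]; exact (hγ hD).1
      · rwa [h]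
  · rintro _ (⟨p, hp, rfl⟩ | hy) _ (⟨p', hp', rfl⟩ | hz) hyz u huW huT hadj
    · rw [hf p hp, hf p' hp'] at hyz
      obtain ⟨r, rfl⟩ := hE p hp u huW (fun h => huT (Or.inr h)) hadj
      rw [adj_iff_near hq] at hadj ⊢
      refine ⟨fun h => huT (Or.inl (h ▸ mem_cells.2 hp')), ?_⟩
      exact hnear _ _ _ _ (valid_cell hq p.2) (valid_cell hq p'.2) hp hp' hyz _
        huW (fun h => huT (Or.inr h)) (hopen r huW huT) hadj.2
    · exfalso
      rw [hf p hp] at hyz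
      rcases hfo' _ hz with ⟨h, -, hD⟩ | ⟨h, hd⟩
      · exact (hγ hD).2.2 _ _ (valid_cell hq p.2) hp (hyz.trans h)
      · obtain ⟨r, rfl⟩ := hE p hp u huW (fun h => huT (Or.inr h)) hadj
        exact hdead _ _ (valid_cell hq p.2) hp (hyz.trans h) _ huW (fun h => huT (Or.inr h))
          (hopen r huW huT) ((adj_iff_near hq).1 hadj).2
    · rcases hfo' _ hy with ⟨h, -, hD⟩ | ⟨h, hd⟩
      · exfalso
        rw [hf p' hp'] at hyz
        exact (hγ hD).2.2 _ _ (valid_cell hq p'.2) hp' (hyz.symm.trans h)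
      · exact (hd u huW (fun h => huT (Or.inl h)) (fun h => huT (Or.inr h)) hadj).elim
    · rcases hfo' _ hy with ⟨h, rfl, hD⟩ | ⟨h, hd⟩
      · rcases hfo' _ hz with ⟨h', rfl, -⟩ | ⟨h', hd⟩
        · exact hadj
        · exact ((hγ hD).2.1 (by rw [← h, hyz, h'])).elim
      · exact (hd u huW (fun h => huT (Or.inl h)) (fun h => huT (Or.inr h)) hadj).elim

end Phases

/-! ### Filling a path power with one vertex deleted -/

section Punctured

variable {V : Type*} {k : ℕ} {G : SimpleGraph V}

theorem last_cell {q p : ℕ} (hq : q < k) (hp : p + 1 = k ^ 2) :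
    row k q p = k ∧ col k q p = k - 1 - q :=
  row_col_unique hq (by omega) (by rw [pow_two] at hp; omega)

theorem Reach.stairs {W Out : Set V} {e : pathPower k (k ^ 2) ↪g G} {q a₀ : ℕ} (hq : q < k)
    (hR : Reach (k + 1) G W Out)
    (hW : ∀ p : Fin (k ^ 2), ¬ (row k q p = a₀ ∧ col k q p = 0) → e p ∈ W)
    (hc : ∀ h m, Colorable k G W (cells e q (stairs h m) ∪ Out)) :
    Reach (k + 1) G W (cells e q (LinCW.stairs 0 0) ∪ Out) := by
  have hrow : ∀ h, Reach (k + 1) G W (cells e q (LinCW.stairs h k) ∪ Out) →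
      Reach (k + 1) G W (cells e q (LinCW.stairs h 0) ∪ Out) := by
    intro h hh
    have := Reach.cellChain (W := W) (Out := Out) (e := e) hq (fun t => LinCW.stairs h (k - t)) k
      (by simpa using hh) (fun t _ => hc _ _) (fun _ => h) (fun t => k - (t + 1))
      (fun t _ a j hv => by unfold LinCW.stairs; omega) ?_
    · simpa using this
    · rintro t - _ ⟨p, hp, rfl⟩
      refine hW p fun h => ?_
      simp only [Set.mem_ofPred_eq, LinCW.stairs, h.2] at hp
      omega
  have hall : ∀ i, i ≤ k → Reach (k + 1) G W (cells e q (LinCW.stairs (k - i) k) ∪ Out) := by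
    intro i
    induction i with
    | zero =>
      intro _
      convert hR using 1
      refine Set.union_eq_right.2 ?_
      rintro _ ⟨p, hp, rfl⟩
      have := valid_cell hq p.2
      simp only [Set.mem_ofPred_eq, LinCW.stairs] at hp
      unfold Valid at this
      generalize row k q p = a, col k q p = j at *
      omega
    | succ i ih =>
      intro hi
      rw [cells_congr hq (Y := LinCW.stairs (k - i) 0)]
      · exact hrow _ (ih (by omega))
      · intro a j hv
        unfold LinCW.stairs Valid at *
        omega
  simpa using hrow 0 (by simpa using hall k le_rfl)

/-- A path power without one vertex can be added to vertices of which only one has a neighbour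
that has not been added, if this neighbour is the last vertex of the path power. -/
theorem Reach.addPunctured (hk : 3 ≤ k) {W Out : Set V} (e : pathPower k (k ^ 2) ↪g G)
    (d last : Fin (k ^ 2)) (hlast : last.val + 1 = k ^ 2) (star : V)
    (hR : Reach (k + 1) G W Out) (hOut : ∀ p, e p ∉ Out) (hd : e d ∉ W)
    (hW : ∀ p, p ≠ d → e p ∈ W)
    (hE : ∀ p, ∀ u ∈ W, u ∉ Out → G.Adj (e p) u → u ∈ Set.range e)
    (hs : ∀ o ∈ Out, o ≠ star → ∀ u ∈ W, u ∉ Out → ¬ G.Adj o u)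
    (hstar : star ∈ Out → ∀ u ∈ W, u ∉ Out → G.Adj star u → u = e last) :
    Reach (k + 1) G W (e '' {p | p ≠ d} ∪ Out) := by
  have hk0 : 0 < k := by omega
  -- With this offset `d` begins a row, so the missing cell is `(a₀, 0)`.
  obtain ⟨q, hqd⟩ : ∃ q, q = d.val % k := ⟨_, rfl⟩
  have hq : q < k := hqd ▸ Nat.mod_lt _ hk0
  obtain ⟨a₀, ha₀⟩ : ∃ a₀, a₀ = row k q d := ⟨_, rfl⟩
  have hcell : row k q d = d.val / k + 1 ∧ col k q d = 0 := by
    refine row_col_unique hq hk0 ?_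
    have := Nat.div_add_mod d.val k
    rw [mul_add]
    omega
  have h₀ : 1 ≤ a₀ := by rw [ha₀, hcell.1]; exact Nat.le_add_left _ _
  have h₁ : a₀ ≤ k := ha₀ ▸ (valid_cell hq d.2).1
  have hdc : ∀ p : Fin (k ^ 2), row k q p = a₀ → col k q p = 0 → p = d := fun p h1 h2 =>
    Fin.ext (cell_injective hq (h1.trans ha₀) (h2.trans hcell.2.symm))
  have hdx : ∀ p : Fin (k ^ 2), e p ∈ W → ¬ (row k q p = a₀ ∧ col k q p = 0) :=
    fun p hp h => hd (hdc p h.1 h.2 ▸ hp)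
  have hdW : ∀ p : Fin (k ^ 2), e p ∈ W → e p ∉ Out → row k q p = a₀ → col k q p = 0 →
      a₀ = k ∧ q + 1 = k := fun p hp _ h1 h2 => (hdx p hp ⟨h1, h2⟩).elim
  have hWc : ∀ X : ℕ → ℕ → Prop, ¬ X a₀ 0 → cells e q X ⊆ W := by
    rintro X hX _ ⟨p, hp, rfl⟩
    exact hW p fun h => hX (by rw [h] at hp; simpa only [Set.mem_ofPred_eq, ← ha₀, hcell.2] using hp)
  obtain ⟨hlr, hlc⟩ := last_cell hq hlast
  have hdead : ∀ X : ℕ → ℕ → Prop, (X k (k - 1 - q) ∨ (a₀ = k ∧ q + 1 = k)) →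
      star ∈ Out → ∀ u ∈ W, u ∉ cells e q X → u ∉ Out → ¬ G.Adj star u := by
    intro X hX ho u hu huX huO hadj
    obtain rfl := hstar ho u hu huO hadj
    rcases hX with hX | ⟨h1, h2⟩
    · exact huX (mem_cells.2 (by rwa [hlr, hlc]))
    · exact hd (hdc last (by omega) (by omega) ▸ hu)
  have hs' : ∀ X : ℕ → ℕ → Prop, ∀ o ∈ Out, o ≠ star → ∀ u ∈ W, u ∉ cells e q X → u ∉ Out →
      ¬ G.Adj o u := fun X o ho ho' u hu _ huO => hs o ho ho' u hu huO
  have hA : Reach (k + 1) G W (cells e q (LinCW.stairs 0 0) ∪ Out) := by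
    refine Reach.stairs (a₀ := a₀) hq hR
      (fun p hp => hW p fun h => hp (by subst h; exact ⟨ha₀.symm, hcell.2⟩)) fun h m => ?_
    refine colorable_of_cells (a₀ := a₀) hq (stairsColor k q h m) 0 (k - 1) star
      (fun p hp => (hOut p hp).elim) hdW (fun p _ => hE p)
      (fun a j hv hX => (stairsColor_mem hv hX).2.1)
      (fun a j a' j' hv hv' hX hX' hc p _ _ hU hn => stairsColor_near hv hv' hX hX' hU hc hn) hk0
      (fun a j hv hX hc => by have := (stairsColor_mem hv hX).1; omega) (hs' _) ?_
    -- `star` needs a colour only until the last vertex is added. If `q + 1 = k`, that vertex lies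
    -- in column 0, and colour `k - 1` is unused in this phase. Otherwise it is the first cell of
    -- the triangle to be entered, and before that no cell is coloured.
    by_cases hq' : q + 1 = k
    · exact Or.inr ⟨by omega, by omega, fun a j hv hX hc => (stairsColor_mem hv hX).2.2 hq'
        (by omega)⟩
    · by_cases hX : LinCW.stairs h m k (k - 1 - q)
      · exact Or.inl (hdead _ (Or.inl hX))
      · refine Or.inr ⟨by omega, by omega, fun a j hv hX' _ => ?_⟩
        unfold LinCW.stairs Valid at *
        omega
  have hB : Reach (k + 1) G W (cells e q (leftUpper a₀ (k + 1)) ∪ Out) := by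
    refine Reach.cellChain hq (leftUpper a₀) (k + 1) ?_ (fun t _ => ?_) id (fun _ => 0)
      (fun t _ a j hv => ?_) (fun t _ => hWc _ ?_)
    · rwa [cells_congr hq (Y := LinCW.stairs 0 0)]
      intro a j hv
      unfold LinCW.stairs leftUpper at *
      omega
    · refine colorable_of_cells (a₀ := a₀) hq (fun a _ => a - 1) 0 (k - 1) star
        (fun p hp => (hOut p hp).elim) hdW (fun p _ => hE p)
        (fun a j hv hX => (rowColor_mem h₀ hv hX).2)
        (fun a j a' j' hv hv' hX hX' hc p _ _ hU hn => rowColor_near h₀ hv hv' hX hX' hU hc hn) hk0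
        (fun a j hv hX hc => by have := (rowColor_mem h₀ hv hX).1; omega) (hs' _) ?_
      by_cases hX : leftUpper a₀ t k (k - 1 - q) ∨ (a₀ = k ∧ q + 1 = k)
      · exact Or.inl (hdead _ hX)
      · refine Or.inr ⟨by omega, by omega, fun a j hv hX' _ => ?_⟩
        unfold leftUpper Valid at *
        omega
    · unfold leftUpper
      simp only [id]
      omega
    · unfold leftUpper
      omega
  have hC : Reach (k + 1) G W (cells e q (diagonal a₀ 0) ∪ Out) := by
    have := Reach.cellChain (W := W) (Out := Out) (e := e) hq (fun t => diagonal a₀ (k - t)) k ?_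
      (fun t _ => ?_) (fun t => k - (t + 1)) (fun t => k - (t + 1)) (fun t _ a j hv => ?_)
      (fun t _ => hWc _ ?_)
    · simpa using this
    · rwa [cells_congr hq (Y := leftUpper a₀ (k + 1))]
      intro a j hv
      unfold diagonal leftUpper Valid at *
      omega
    · refine colorable_of_cells (a₀ := a₀) hq (diagonalColor k (k - t)) 0 0 star
        (fun p hp => (hOut p hp).elim) hdW (fun p _ => hE p)
        (fun a j hv hX => diagonalColor_mem hv) ?_ hk0
        (fun a j hv hX hc p hpW hpO hU => diagonalColor_dead h₀ h₁ hv hX hU hc) (hs' _)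
        (Or.inl (hdead _ ?_))
      · intro a j a' j' hv hv' hX hX' hc p hpW hpO hU
        rw [near_iff_diagonalTrace h₀ h₁ hv hX hU, near_iff_diagonalTrace h₀ h₁ hv' hX' hU, hc]
        exact id
      · unfold diagonal
        omega
    · unfold diagonal Valid at *
      omega
    · unfold diagonal
      omega
  -- From here on the last vertex has been added or is the deleted one, so `star` is dead too.
  have hlast' : ∀ X : ℕ → ℕ → Prop, (∀ j ≤ k, (j = 0 → a₀ < k) → X k j) →
      (X k (k - 1 - q) ∨ (a₀ = k ∧ q + 1 = k)) := by
    intro X hX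
    by_cases h : a₀ = k ∧ q + 1 = k
    · exact Or.inr h
    · exact Or.inl (hX _ (by omega) (by omega))
  have hD : Reach (k + 1) G W (cells e q (leftLower a₀ (k + 1)) ∪ Out) := by
    refine Reach.cellChain hq (leftLower a₀) (k + 1) ?_ (fun t _ => ?_) id (fun _ => 0)
      (fun t _ a j hv => ?_) (fun t _ => hWc _ ?_)
    · rwa [cells_congr hq (Y := diagonal a₀ 0)]
      intro a j hv
      unfold diagonal leftLower at *
      omega
    · refine colorable_of_cells (a₀ := a₀) hq stripColor (k - 1) 0 star
        (fun p hp => (hOut p hp).elim) hdW (fun p _ => hE p)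
        (fun a j hv hX => stripColor_mem hv) ?_ (by omega)
        (fun a j hv hX hc p hpW hpO hU => leftLower_dead hk h₁ hv hX hU hc) (hs' _)
        (Or.inl (hdead _ (hlast' _ ?_)))
      · intro a j a' j' hv hv' hX hX' hc p hpW hpO hU
        rw [near_iff_leftLower hq h₁ hv hX hU, near_iff_leftLower hq h₁ hv' hX' hU, hc]
        exact id
      · unfold leftLower
        omega
    · unfold leftLower
      simp only [id]
      omega
    · unfold leftLower
      omega
  have hcol : ∀ m, m < k → Reach (k + 1) G W (cells e q (columns a₀ m 0) ∪ Out) := by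
    intro m hm
    induction hi : k - 1 - m generalizing m with
    | zero =>
      rwa [cells_congr hq (Y := leftLower a₀ (k + 1))]
      intro a j hv
      unfold columns leftLower Valid at *
      omega
    | succ i ih =>
      have ih := ih (m + 1) (by omega) (by omega)
      have := Reach.cellChain (W := W) (Out := Out) (e := e) hq (columns a₀ (m + 1)) k ih
        (fun t _ => ?_) id (fun _ => m + 1) (fun t _ a j hv => ?_) (fun t _ => hWc _ ?_)
      · rwa [cells_congr hq (Y := columns a₀ (m + 1) k)]
        intro a j hv
        unfold columns Valid at *
        omega
      · refine colorable_of_cells (a₀ := a₀) hq stripColor (k - 1) 0 star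
          (fun p hp => (hOut p hp).elim) hdW (fun p _ => hE p)
          (fun a j hv hX => stripColor_mem hv) ?_ (by omega)
          (fun a j hv hX hc p hpW hpO hU => columns_dead hk h₁ hv hU (hdx p hpW) hc) (hs' _)
          (Or.inl (hdead _ (hlast' _ ?_)))
        · intro a j a' j' hv hv' hX hX' hc p hpW hpO hU
          rw [near_iff_columns hq h₀ hv hX hU (hdx p hpW),
            near_iff_columns hq h₀ hv' hX' hU (hdx p hpW), hc]
          exact id
        · unfold columns
          omega
      · unfold columns
        simp only [id]
        omega
      · unfold columns
        omega
  have := hcol 0 hk0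
  convert this using 2
  ext v
  constructor
  · rintro ⟨p, hp, rfl⟩
    refine mem_cells.2 ?_
    have : ¬ (row k q p = a₀ ∧ col k q p = 0) := fun h => hp (hdc p h.1 h.2)
    rcases Nat.lt_or_ge (row k q p) (col k q p) with h | h
    · exact Or.inr (Or.inl ⟨Nat.zero_lt_of_lt h, h⟩)
    · exact Or.inl ⟨h, this⟩
  · rintro ⟨p, hp, rfl⟩
    refine ⟨p, ?_, rfl⟩
    rintro rfl
    rw [Set.mem_ofPred_eq, hcell.2, ← ha₀] at hp
    rcases hp with h | h | h
    · exact h.2 ⟨rfl, rfl⟩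
    · exact h.1.false
    · exact Nat.not_succ_le_zero _ h.2.1

end Punctured

/-! ### Filling a path power together with an attached path -/

section Tail

variable {V : Type*} {k : ℕ} {G : SimpleGraph V}

/-- A path power together with a path that is attached to its last vertex can be added to vertices
that have no neighbours that have not been added. -/
theorem Reach.addWithTail (hk : 3 ≤ k) {W Out : Set V} (e : pathPower k (k ^ 2) ↪g G)
    (last : Fin (k ^ 2)) (hlast : last.val + 1 = k ^ 2) (Y : ℕ → V) (r : ℕ)
    (hR : Reach (k + 1) G W Out) (hOut : ∀ p, e p ∉ Out) (hW : ∀ p, e p ∈ W)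
    (hE : ∀ p, p ≠ last → ∀ u ∈ W, u ∉ Out → G.Adj (e p) u → u ∈ Set.range e)
    (hs : ∀ o ∈ Out, ∀ u ∈ W, u ∉ Out → ¬ G.Adj o u)
    (hY0 : Y 0 = e last) (hYW : ∀ j ≤ r, Y j ∈ W)
    (hYe : ∀ j, 1 ≤ j → j ≤ r → Y j ∉ Set.range e)
    (hY : ∀ j < r, ∀ u ∈ W, u ∉ Out → G.Adj (Y j) u →
      (∃ i ≤ j + 1, u = Y i) ∨ (j = 0 ∧ u ∈ Set.range e)) :
    Reach (k + 1) G W (Set.range e ∪ (Out ∪ Y '' {j | j ≤ r})) := by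
  -- This offset puts the last vertex alone into row `k`, at `(k, 0)`. In the phases it plays the
  -- role of the missing cell, although it remains open.
  obtain ⟨q, hqk⟩ : ∃ q, q = k - 1 := ⟨_, rfl⟩
  have hq : q < k := by omega
  have hk0 : 0 < k := by omega
  obtain ⟨hlr, hlc⟩ := last_cell hq hlast
  replace hlc : col k q last = 0 := by omega
  have hdc : ∀ p : Fin (k ^ 2), row k q p = k → col k q p = 0 → p = last := fun p h1 h2 =>
    Fin.ext (cell_injective hq (h1.trans hlr.symm) (h2.trans hlc.symm))
  have hd : ∀ Out : Set V, ∀ p : Fin (k ^ 2), e p ∈ W → e p ∉ Out → row k q p = k →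
      col k q p = 0 → k = k ∧ q + 1 = k := fun _ _ _ _ _ _ => ⟨rfl, by omega⟩
  have hE' : ∀ X : ℕ → ℕ → Prop, ¬ X k 0 → ∀ p : Fin (k ^ 2), X (row k q p) (col k q p) →
      ∀ u ∈ W, u ∉ Out → G.Adj (e p) u → u ∈ Set.range e := fun X hX p hp =>
    hE p fun h => hX (by rwa [h, hlr, hlc] at hp)
  have hs' : ∀ X : ℕ → ℕ → Prop, ∀ o ∈ Out, o ≠ e last → ∀ u ∈ W, u ∉ cells e q X → u ∉ Out →
      ¬ G.Adj o u := fun X o ho ho' u hu _ huO => hs o ho u hu huO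
  have hstar : ∀ X : ℕ → ℕ → Prop, e last ∈ Out → ∀ u ∈ W, u ∉ cells e q X → u ∉ Out →
      ¬ G.Adj (e last) u := fun _ h => (hOut _ h).elim
  have hcW : ∀ X : ℕ → ℕ → Prop, cells e q X ⊆ W := by
    rintro X _ ⟨p, -, rfl⟩
    exact hW p
  have hA : Reach (k + 1) G W (cells e q (LinCW.stairs 0 0) ∪ Out) := by
    refine Reach.stairs (a₀ := k) hq hR (fun p _ => hW p) fun h m => ?_
    exact colorable_of_cells (a₀ := k) hq (stairsColor k q h m) 0 0 (e last)
      (fun p hp => (hOut p hp).elim) (hd _) (hE' _ (by unfold LinCW.stairs; omega))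
      (fun a j hv hX => (stairsColor_mem hv hX).2.1)
      (fun a j a' j' hv hv' hX hX' hc p _ _ hU hn => stairsColor_near hv hv' hX hX' hU hc hn) hk0
      (fun a j hv hX hc => by have := (stairsColor_mem hv hX).1; omega) (hs' _) (Or.inl (hstar _))
  have hC : Reach (k + 1) G W (cells e q (diagonal k 0) ∪ Out) := by
    have := Reach.cellChain (W := W) (Out := Out) (e := e) hq (fun t => diagonal k (k - t)) k ?_
      (fun t _ => ?_) (fun t => k - (t + 1)) (fun t => k - (t + 1)) (fun t _ a j hv => ?_)
      (fun t _ => hcW _)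
    · simpa using this
    · rwa [cells_congr hq (Y := LinCW.stairs 0 0)]
      intro a j hv
      unfold diagonal LinCW.stairs Valid at *
      omega
    · refine colorable_of_cells (a₀ := k) hq (diagonalColor k (k - t)) 0 0 (e last)
        (fun p hp => (hOut p hp).elim) (hd _) (hE' _ (by unfold diagonal; omega))
        (fun a j hv hX => diagonalColor_mem hv) ?_ hk0
        (fun a j hv hX hc p _ _ hU => diagonalColor_dead hk0 le_rfl hv hX hU hc) (hs' _)
        (Or.inl (hstar _))
      intro a j a' j' hv hv' hX hX' hc p _ _ hU
      rw [near_iff_diagonalTrace hk0 le_rfl hv hX hU,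
        near_iff_diagonalTrace hk0 le_rfl hv' hX' hU, hc]
      exact id
    · unfold diagonal Valid at *
      omega
  have hD : Reach (k + 1) G W (cells e q (leftLower k (k + 1)) ∪ Out) := by
    refine Reach.cellChain hq (leftLower k) (k + 1) ?_ (fun t _ => ?_) id (fun _ => 0)
      (fun t _ a j hv => ?_) (fun t _ => hcW _)
    · rwa [cells_congr hq (Y := diagonal k 0)]
      intro a j hv
      unfold diagonal leftLower at *
      omega
    · refine colorable_of_cells (a₀ := k) hq stripColor (k - 1) 0 (e last)
        (fun p hp => (hOut p hp).elim) (hd _) (hE' _ (by unfold leftLower; omega))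
        (fun a j hv hX => stripColor_mem hv) ?_ (by omega)
        (fun a j hv hX hc p _ _ hU => leftLower_dead hk le_rfl hv hX hU hc) (hs' _)
        (Or.inl (hstar _))
      intro a j a' j' hv hv' hX hX' hc p _ _ hU
      rw [near_iff_leftLower hq le_rfl hv hX hU, near_iff_leftLower hq le_rfl hv' hX' hU, hc]
      exact id
    · unfold leftLower
      simp only [id]
      omega
  have hL : ∀ t, Colorable k G W (cells e q (columns k (k - 1) t) ∪ Out) := by
    subst hqk
    intro t
    refine colorable_of_cells (a₀ := k) hq (lastColor k) (k - 1) 0 (e last)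
      (fun p hp => (hOut p hp).elim) (hd _) (hE' _ (by unfold columns; omega))
      (fun a j hv hX => ?_) ?_ (by omega)
      (fun a j hv hX hc p _ _ hU => ?_) (hs' _) (Or.inl (hstar _))
    · unfold lastColor stripColor Valid at *
      split_ifs <;> omega
    · intro a j a' j' hv hv' hX hX' hc p _ _ hU
      rw [near_iff_lastColor hk hv hX hU, near_iff_lastColor hk hv' hX' hU, hc]
      exact id
    · rw [near_iff_lastColor hk hv hX hU]
      omega
  have hF : Reach (k + 1) G W (cells e q (columns k (k - 1) k) ∪ Out) := by
    refine Reach.cellChain hq (columns k (k - 1)) k ?_ (fun t _ => hL t) id (fun _ => k - 1)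
      (fun t _ a j hv => ?_) (fun t _ => hcW _)
    · rwa [cells_congr hq (Y := leftLower k (k + 1))]
      intro a j hv
      unfold columns leftLower Valid at *
      omega
    · unfold columns
      simp only [id]
      omega
  -- Once the last vertex is in, row `k - 1` sees nothing open and gives up colour `k - 2`. The
  -- current end `Y i` of the path, the only outer vertex that may have open neighbours, uses this
  -- colour as `γ`.
  have hspare : ∀ m t i, m + 2 ≤ k → i ≤ r → Colorable k G W
      (cells e q (columns k m t) ∪ (Out ∪ Y '' {j | j < i + 1})) := by
    subst hqk
    intro m t i hm hi
    have hx : ∀ p : Fin (k ^ 2), e p ∉ Out ∪ Y '' {j | j < i + 1} →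
        ¬ (row k (k - 1) p = k ∧ col k (k - 1) p = 0) := fun p hp h =>
      hp (Or.inr ⟨0, Nat.succ_pos i, by rw [hY0, hdc p h.1 h.2]⟩)
    refine colorable_of_cells (a₀ := k) hq (spareColor k) (k - 1) (k - 2) (Y i)
      ?_ (hd _) (fun p hp u hu huO => hE' _ (by unfold columns; omega) p hp u hu
        fun h => huO (Or.inl h))
      (fun a j hv hX => (spareColor_mem hk hv).1) ?_ (by omega)
      (fun a j hv hX hc p _ hpO hU => ?_) ?_
      (Or.inr ⟨by omega, by omega, fun a j hv hX => (spareColor_mem hk hv).2⟩)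
    · rintro p (hp | ⟨j, hj, hp⟩)
      · exact (hOut p hp).elim
      · rcases Nat.eq_zero_or_pos j with rfl | hj0
        · have : p = last := e.injective (hp.symm.trans hY0)
          rw [this, hlr, hlc]
          unfold columns
          omega
        · have hj' : j < i + 1 := hj
          exact (hYe j hj0 (by omega) ⟨p, hp.symm⟩).elim
    · intro a j a' j' hv hv' hX hX' hc p _ hpO hU
      rw [near_iff_spareColor hk hm hv hX hU (hx p hpO),
        near_iff_spareColor hk hm hv' hX' hU (hx p hpO), hc]
      exact id
    · rw [near_iff_spareColor hk hm hv hX hU (hx p hpO)]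
      omega
    · rintro o (ho | ⟨j, hj, rfl⟩) hne u hu huX huO hadj
      · exact hs o ho u hu (fun h => huO (Or.inl h)) hadj
      · have hji : j ≠ i := fun h => hne (by rw [h])
        have hj' : j < i + 1 := hj
        rcases hY j (by omega) u hu (fun h => huO (Or.inl h)) hadj with ⟨i', hi', rfl⟩ | ⟨rfl, p, rfl⟩
        · exact huO (Or.inr ⟨i', Nat.lt_of_le_of_lt hi' (by omega), rfl⟩)
        · rw [hY0, adj_iff_near hq, hlr, hlc] at hadj
          refine huX (mem_cells.2 ?_)
          have hv := valid_cell hq p.2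
          have hxp := hx p huO
          unfold columns Valid Near at *
          omega
  -- Column `k - 1` being full is column `k - 2` not yet begun; the second form satisfies `m + 2 ≤
  -- k`, as `hspare` requires.
  have hcol0 : cells e q (columns k (k - 1) k) = cells e q (columns k (k - 2) 0) :=
    cells_congr hq fun a j hv => by
      unfold columns Valid at *
      omega
  have hT : Reach (k + 1) G W
      (cells e q (columns k (k - 1) k) ∪ (Out ∪ Y '' {j | j < r + 1})) := by
    refine Reach.chain (fun i => cells e q (columns k (k - 1) k) ∪ (Out ∪ Y '' {j | j < i}))
      (r + 1) ?_ (fun i hi => ?_) fun i hi => ⟨Y i, ?_, ?_, ?_⟩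
    · simpa using hF
    · rcases i with _ | i
      · simpa using hL k
      · simp only [hcol0]
        exact hspare _ _ _ (by omega) (by omega)
    · refine Set.union_subset_union_right _ (Set.union_subset_union_right _ (Set.image_mono ?_))
      exact fun j (hj : j < i) => Nat.lt_succ_of_lt hj
    · rintro v (hv | hv | ⟨j, hj, rfl⟩)
      · exact Or.inr (Or.inl hv)
      · exact Or.inr (Or.inr (Or.inl hv))
      · rcases Nat.lt_succ_iff_lt_or_eq.1 hj with hj | rfl
        · exact Or.inr (Or.inr (Or.inr ⟨j, hj, rfl⟩))
        · exact Or.inl rfl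
    · refine Set.union_subset (hcW _) (Set.union_subset hR.1 ?_)
      rintro _ ⟨j, hj, rfl⟩
      have hj' : j < i + 1 := hj
      exact hYW j (by omega)
  have hcol : ∀ m, m + 2 ≤ k → Reach (k + 1) G W
      (cells e q (columns k m 0) ∪ (Out ∪ Y '' {j | j < r + 1})) := by
    intro m hm
    induction hi : k - 2 - m generalizing m with
    | zero =>
      have : m = k - 2 := by omega
      rw [this, ← hcol0]
      exact hT
    | succ i ih =>
      have ih := ih (m + 1) (by omega) (by omega)
      have := Reach.cellChain (W := W) (e := e) hq (columns k (m + 1)) k ih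
        (fun t _ => hspare _ _ _ (by omega) le_rfl) id (fun _ => m + 1) (fun t _ a j hv => ?_)
        (fun t _ => hcW _)
      · rwa [cells_congr hq (Y := columns k (m + 1) k)]
        intro a j hv
        unfold columns Valid at *
        omega
      · unfold columns
        simp only [id]
        omega
  convert hcol 0 (by omega) using 1
  ext v
  constructor
  · rintro (⟨p, rfl⟩ | hv | ⟨j, hj, rfl⟩)
    · by_cases hp : row k q p = k ∧ col k q p = 0
      · exact Or.inr (Or.inr ⟨0, Nat.succ_pos r, by rw [hY0, hdc p hp.1 hp.2]⟩)
      · refine Or.inl (mem_cells.2 ?_)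
        rcases Nat.lt_or_ge (row k q p) (col k q p) with h | h
        · exact Or.inr (Or.inl ⟨Nat.zero_lt_of_lt h, h⟩)
        · exact Or.inl ⟨h, hp⟩
    · exact Or.inr (Or.inl hv)
    · exact Or.inr (Or.inr ⟨j, Nat.lt_succ_of_le hj, rfl⟩)
  · rintro (⟨p, -, rfl⟩ | hv | ⟨j, hj, rfl⟩)
    · exact Or.inl ⟨p, rfl⟩
    · exact Or.inr (Or.inl hv)
    · exact Or.inr (Or.inr ⟨j, Nat.le_of_lt_succ hj, rfl⟩)

end Tail

/-! ### Proper induced subgraphs of `MGraph` -/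

section UpperBound

variable {k l : ℕ}

theorem MGraph_adj_left {i j : Fin (k ^ 2)} :
    (MGraph k l).Adj (Sum.inl i) (Sum.inl j) ↔ (pathPower k (k ^ 2)).Adj i j := by
  simp [MGraph, linkRel]

theorem MGraph_adj_right {i j : Fin (k ^ 2)} :
    (MGraph k l).Adj (Sum.inr (Sum.inl i)) (Sum.inr (Sum.inl j)) ↔
      (pathPower k (k ^ 2)).Adj i j := by
  simp [MGraph, linkRel]

theorem MGraph_adj_left_right {i j : Fin (k ^ 2)} :
    (MGraph k l).Adj (Sum.inl i) (Sum.inr (Sum.inl j)) ↔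
      l = 0 ∧ i.val + 1 = k ^ 2 ∧ j.val + 1 = k ^ 2 := by
  simp [MGraph, linkRel]

theorem MGraph_adj_left_mid {i : Fin (k ^ 2)} {t : Fin l} :
    (MGraph k l).Adj (Sum.inl i) (Sum.inr (Sum.inr t)) ↔ i.val + 1 = k ^ 2 ∧ t.val = 0 := by
  simp [MGraph, linkRel]

theorem MGraph_adj_right_mid {i : Fin (k ^ 2)} {t : Fin l} :
    (MGraph k l).Adj (Sum.inr (Sum.inl i)) (Sum.inr (Sum.inr t)) ↔
      i.val + 1 = k ^ 2 ∧ t.val + 1 = l := by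
  simp [MGraph, linkRel]

theorem MGraph_adj_mid {s t : Fin l} :
    (MGraph k l).Adj (Sum.inr (Sum.inr s)) (Sum.inr (Sum.inr t)) ↔
      s.val + 1 = t.val ∨ t.val + 1 = s.val := by
  simp [MGraph, linkRel, pathPower, Fin.ext_iff]
  omega

theorem MGraph_adj_right_left {i j : Fin (k ^ 2)} :
    (MGraph k l).Adj (Sum.inr (Sum.inl j)) (Sum.inl i) ↔
      l = 0 ∧ i.val + 1 = k ^ 2 ∧ j.val + 1 = k ^ 2 := by
  rw [SimpleGraph.adj_comm, MGraph_adj_left_right]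

theorem MGraph_adj_mid_left {i : Fin (k ^ 2)} {t : Fin l} :
    (MGraph k l).Adj (Sum.inr (Sum.inr t)) (Sum.inl i) ↔ i.val + 1 = k ^ 2 ∧ t.val = 0 := by
  rw [SimpleGraph.adj_comm, MGraph_adj_left_mid]

theorem MGraph_adj_mid_right {i : Fin (k ^ 2)} {t : Fin l} :
    (MGraph k l).Adj (Sum.inr (Sum.inr t)) (Sum.inr (Sum.inl i)) ↔
      i.val + 1 = k ^ 2 ∧ t.val + 1 = l := by
  rw [SimpleGraph.adj_comm, MGraph_adj_right_mid]

/-- The two path powers in `MGraph k l`. -/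
def leftEmb (k l : ℕ) : pathPower k (k ^ 2) ↪g MGraph k l :=
  ⟨⟨Sum.inl, Sum.inl_injective⟩, MGraph_adj_left⟩

def rightEmb (k l : ℕ) : pathPower k (k ^ 2) ↪g MGraph k l :=
  ⟨⟨fun i => Sum.inr (Sum.inl i), Sum.inr_injective.comp Sum.inl_injective⟩, MGraph_adj_right⟩

theorem leftEmb_apply (i : Fin (k ^ 2)) : leftEmb k l i = Sum.inl i := rfl

theorem rightEmb_apply (i : Fin (k ^ 2)) : rightEmb k l i = Sum.inr (Sum.inl i) := rfl

/-- The path that is attached to the left path power, beginning with the vertex of attachment. -/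
def leftTail (k l : ℕ) (last : Fin (k ^ 2)) (j : ℕ) : Fin (k ^ 2) ⊕ (Fin (k ^ 2) ⊕ Fin l) :=
  if h : 1 ≤ j ∧ j ≤ l then Sum.inr (Sum.inr ⟨j - 1, by omega⟩) else Sum.inl last

/-- The path that is attached to the right path power, beginning with the vertex of attachment. -/
def rightTail (k l : ℕ) (last : Fin (k ^ 2)) (j : ℕ) : Fin (k ^ 2) ⊕ (Fin (k ^ 2) ⊕ Fin l) :=
  if h : 1 ≤ j ∧ j ≤ l then Sum.inr (Sum.inr ⟨l - j, by omega⟩) else Sum.inr (Sum.inl last)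

theorem leftTail_zero {last : Fin (k ^ 2)} : leftTail k l last 0 = Sum.inl last := rfl

theorem rightTail_zero {last : Fin (k ^ 2)} : rightTail k l last 0 = Sum.inr (Sum.inl last) := rfl

theorem leftTail_pos {last : Fin (k ^ 2)} {j : ℕ} (h1 : 1 ≤ j) (h2 : j ≤ l) :
    leftTail k l last j = Sum.inr (Sum.inr ⟨j - 1, by omega⟩) := dif_pos ⟨h1, h2⟩

theorem rightTail_pos {last : Fin (k ^ 2)} {j : ℕ} (h1 : 1 ≤ j) (h2 : j ≤ l) :
    rightTail k l last j = Sum.inr (Sum.inr ⟨l - j, by omega⟩) := dif_pos ⟨h1, h2⟩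

theorem leftTail_succ {last : Fin (k ^ 2)} (t : Fin l) :
    leftTail k l last (t.val + 1) = Sum.inr (Sum.inr t) := by
  rw [leftTail_pos (by omega) (by omega)]
  rfl

theorem rightTail_sub {last : Fin (k ^ 2)} (t : Fin l) :
    rightTail k l last (l - t.val) = Sum.inr (Sum.inr t) := by
  rw [rightTail_pos (by omega) (by omega)]
  congr 3
  omega

theorem reach_left (hk : 3 ≤ k) {W Out : Set (Fin (k ^ 2) ⊕ (Fin (k ^ 2) ⊕ Fin l))}
    (last : Fin (k ^ 2)) (hlast : last.val + 1 = k ^ 2) {r : ℕ} (hr : r ≤ l)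
    (hR : Reach (k + 1) (MGraph k l) W Out) (hOut : ∀ i, Sum.inl i ∉ Out)
    (hW : ∀ i, Sum.inl i ∈ W) (hW' : ∀ t : Fin l, t.val < r → Sum.inr (Sum.inr t) ∈ W)
    (hs : ∀ o ∈ Out, ∀ u ∈ W, u ∉ Out → ¬ (MGraph k l).Adj o u) :
    Reach (k + 1) (MGraph k l) W (Set.range (leftEmb k l) ∪
      (Out ∪ leftTail k l last '' {j | j ≤ r})) := by
  refine Reach.addWithTail hk (leftEmb k l) last hlast (leftTail k l last) r hR hOut hW ?_ hs rfl
    (fun j hj => ?_) (fun j h1 h2 => ?_) (fun j hj u hu _ hadj => ?_)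
  · rintro p hp (u | u | t) - - hadj
    · exact ⟨u, rfl⟩
    · rw [leftEmb_apply, MGraph_adj_left_right] at hadj
      exact (hp (Fin.ext (by omega))).elim
    · rw [leftEmb_apply, MGraph_adj_left_mid] at hadj
      exact (hp (Fin.ext (by omega))).elim
  · rcases Nat.eq_zero_or_pos j with rfl | h
    · exact hW last
    · rw [leftTail_pos h (by omega)]
      exact hW' _ (by simp only; omega)
  · rw [leftTail_pos h1 (by omega)]
    rintro ⟨p, hp⟩
    exact Sum.inl_ne_inr hp
  · rcases Nat.eq_zero_or_pos j with rfl | h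
    · rcases u with u | u | t
      · exact Or.inr ⟨rfl, u, rfl⟩
      · rw [leftTail_zero, MGraph_adj_left_right] at hadj
        omega
      · rw [leftTail_zero, MGraph_adj_left_mid] at hadj
        exact Or.inl ⟨t.val + 1, by omega, (leftTail_succ t).symm⟩
    · rw [leftTail_pos h (by omega)] at hadj
      rcases u with u | u | t
      · rw [MGraph_adj_mid_left] at hadj
        exact Or.inl ⟨0, by omega, by rw [leftTail_zero]; congr 1; exact Fin.ext (by omega)⟩
      · rw [MGraph_adj_mid_right] at hadj
        simp only at hadj
        omega
      · rw [MGraph_adj_mid] at hadj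
        simp only at hadj
        exact Or.inl ⟨t.val + 1, by omega, (leftTail_succ t).symm⟩

theorem reach_right (hk : 3 ≤ k) {W Out : Set (Fin (k ^ 2) ⊕ (Fin (k ^ 2) ⊕ Fin l))}
    (last : Fin (k ^ 2)) (hlast : last.val + 1 = k ^ 2) {r : ℕ} (hr : r ≤ l)
    (hR : Reach (k + 1) (MGraph k l) W Out) (hOut : ∀ i, Sum.inr (Sum.inl i) ∉ Out)
    (hW : ∀ i, Sum.inr (Sum.inl i) ∈ W)
    (hW' : ∀ t : Fin l, l ≤ t.val + r → Sum.inr (Sum.inr t) ∈ W)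
    (hs : ∀ o ∈ Out, ∀ u ∈ W, u ∉ Out → ¬ (MGraph k l).Adj o u) :
    Reach (k + 1) (MGraph k l) W (Set.range (rightEmb k l) ∪
      (Out ∪ rightTail k l last '' {j | j ≤ r})) := by
  refine Reach.addWithTail hk (rightEmb k l) last hlast (rightTail k l last) r hR hOut hW ?_ hs rfl
    (fun j hj => ?_) (fun j h1 h2 => ?_) (fun j hj u hu _ hadj => ?_)
  · rintro p hp (u | u | t) - - hadj
    · rw [rightEmb_apply, MGraph_adj_right_left] at hadj
      exact (hp (Fin.ext (by omega))).elim
    · exact ⟨u, rfl⟩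
    · rw [rightEmb_apply, MGraph_adj_right_mid] at hadj
      exact (hp (Fin.ext (by omega))).elim
  · rcases Nat.eq_zero_or_pos j with rfl | h
    · exact hW last
    · rw [rightTail_pos h (by omega)]
      exact hW' _ (by simp only; omega)
  · rw [rightTail_pos h1 (by omega)]
    rintro ⟨p, hp⟩
    exact Sum.inl_ne_inr (Sum.inr_injective hp)
  · rcases Nat.eq_zero_or_pos j with rfl | h
    · rcases u with u | u | t
      · rw [rightTail_zero, MGraph_adj_right_left] at hadj
        omega
      · exact Or.inr ⟨rfl, u, rfl⟩
      · rw [rightTail_zero, MGraph_adj_right_mid] at hadj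
        exact Or.inl ⟨l - t.val, by omega, (rightTail_sub t).symm⟩
    · rw [rightTail_pos h (by omega)] at hadj
      rcases u with u | u | t
      · rw [MGraph_adj_mid_left] at hadj
        simp only at hadj
        omega
      · rw [MGraph_adj_mid_right] at hadj
        exact Or.inl ⟨0, by omega, by rw [rightTail_zero]; congr 2; exact Fin.ext (by omega)⟩
      · rw [MGraph_adj_mid] at hadj
        simp only at hadj
        exact Or.inl ⟨l - t.val, by omega, (rightTail_sub t).symm⟩

theorem mem_leftTail {last : Fin (k ^ 2)} {r : ℕ} (hr : r ≤ l)
    {v : Fin (k ^ 2) ⊕ (Fin (k ^ 2) ⊕ Fin l)} :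
    v ∈ leftTail k l last '' {j | j ≤ r} ↔
      v = Sum.inl last ∨ ∃ t : Fin l, t.val < r ∧ v = Sum.inr (Sum.inr t) := by
  constructor
  · rintro ⟨j, hj, rfl⟩
    have hj' : j ≤ r := hj
    rcases Nat.eq_zero_or_pos j with rfl | h
    · exact Or.inl rfl
    · exact Or.inr ⟨⟨j - 1, by omega⟩, by simp only; omega, leftTail_pos h (by omega)⟩
  · rintro (rfl | ⟨t, ht, rfl⟩)
    · exact ⟨0, Nat.zero_le r, rfl⟩
    · exact ⟨t.val + 1, ht, leftTail_succ t⟩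

theorem mem_rightTail {last : Fin (k ^ 2)} {r : ℕ} (hr : r ≤ l)
    {v : Fin (k ^ 2) ⊕ (Fin (k ^ 2) ⊕ Fin l)} :
    v ∈ rightTail k l last '' {j | j ≤ r} ↔
      v = Sum.inr (Sum.inl last) ∨ ∃ t : Fin l, l ≤ t.val + r ∧ v = Sum.inr (Sum.inr t) := by
  constructor
  · rintro ⟨j, hj, rfl⟩
    have hj' : j ≤ r := hj
    rcases Nat.eq_zero_or_pos j with rfl | h
    · exact Or.inl rfl
    · exact Or.inr ⟨⟨l - j, by omega⟩, by simp only; omega, rightTail_pos h (by omega)⟩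
  · rintro (rfl | ⟨t, ht, rfl⟩)
    · exact ⟨0, Nat.zero_le r, rfl⟩
    · exact ⟨l - t.val, by simp only [Set.mem_ofPred_eq]; omega, rightTail_sub t⟩

/-- The right power is built with the whole path. Then only the end of this path has a neighbour
left, namely the last vertex of the left power, unless that is the deleted one; so the punctured
left power can follow. -/
theorem reach_compl_left (hk : 3 ≤ k) (d : Fin (k ^ 2)) :
    Reach (k + 1) (MGraph k l) {Sum.inl d}ᶜ {Sum.inl d}ᶜ := by
  have hk2 : 0 < k ^ 2 := by positivity
  obtain ⟨last, hlast⟩ : ∃ last : Fin (k ^ 2), last.val + 1 = k ^ 2 :=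
    ⟨⟨k ^ 2 - 1, by omega⟩, by simp only; omega⟩
  have h1 := reach_right (W := {Sum.inl d}ᶜ) hk last hlast (le_refl l)
    (Reach.empty _ _) (fun _ h => h) (fun i => by simp) (fun t _ => by simp) (fun _ h => h.elim)
  have hmem : ∀ v, v ∈ Set.range (rightEmb k l) ∪ (∅ ∪ rightTail k l last '' {j | j ≤ l}) ↔
      ∃ u, v = Sum.inr u := by
    intro v
    rw [Set.empty_union, Set.mem_union, mem_rightTail le_rfl]
    constructor
    · rintro (⟨i, rfl⟩ | rfl | ⟨t, -, rfl⟩)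
      · exact ⟨_, rfl⟩
      · exact ⟨_, rfl⟩
      · exact ⟨_, rfl⟩
    · rintro ⟨i | t, rfl⟩
      · exact Or.inl ⟨i, rfl⟩
      · exact Or.inr (Or.inr ⟨t, by omega, rfl⟩)
  generalize Set.range (rightEmb k l) ∪ (∅ ∪ rightTail k l last '' {j | j ≤ l}) = Out at *
  have hinl : ∀ i, Sum.inl i ∉ Out := fun i h => by simpa using (hmem _).1 h
  have h2 := Reach.addPunctured hk (leftEmb k l) d last hlast (rightTail k l last l) h1
    hinl (fun h => h rfl) (fun p hp h => hp (Sum.inl_injective h)) ?_ ?_ ?_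
  · convert h2 using 1
    ext v
    rw [Set.mem_union, hmem]
    rcases v with i | u
    · constructor
      · intro h
        exact Or.inl ⟨i, fun hi => h (by rw [hi]; rfl), rfl⟩
      · rintro (⟨p, hp, h⟩ | ⟨u, h⟩)
        · intro h'
          exact hp (Sum.inl_injective (h.trans h'))
        · exact (Sum.inl_ne_inr h).elim
    · simp
  · rintro p (u | u) - hu -
    · exact ⟨u, rfl⟩
    · exact (hu ((hmem _).2 ⟨u, rfl⟩)).elim
  · rintro o ho hne (u | u) - huO hadj
    · obtain ⟨i | t, rfl⟩ := (hmem _).1 ho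
      · rw [MGraph_adj_right_left] at hadj
        obtain ⟨rfl, h1, h2⟩ := hadj
        exact hne (by rw [rightTail_zero]; congr 2; exact Fin.ext (by omega))
      · rw [MGraph_adj_mid_left] at hadj
        refine hne ((rightTail_sub (last := last) t).symm.trans ?_)
        rw [hadj.2, Nat.sub_zero]
    · exact huO ((hmem _).2 ⟨u, rfl⟩)
  · rintro - (u | u) - huO hadj
    · rw [leftEmb_apply]
      congr 1
      rcases Nat.eq_zero_or_pos l with rfl | h
      · rw [rightTail_zero, MGraph_adj_right_left] at hadj
        exact Fin.ext (by omega)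
      · rw [rightTail_pos h le_rfl, MGraph_adj_mid_left] at hadj
        exact Fin.ext (by omega)
    · exact (huO ((hmem _).2 ⟨u, rfl⟩)).elim

theorem reach_compl_right (hk : 3 ≤ k) (d : Fin (k ^ 2)) :
    Reach (k + 1) (MGraph k l) {Sum.inr (Sum.inl d)}ᶜ {Sum.inr (Sum.inl d)}ᶜ := by
  have hk2 : 0 < k ^ 2 := by positivity
  obtain ⟨last, hlast⟩ : ∃ last : Fin (k ^ 2), last.val + 1 = k ^ 2 :=
    ⟨⟨k ^ 2 - 1, by omega⟩, by simp only; omega⟩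
  have h1 := reach_left (W := {Sum.inr (Sum.inl d)}ᶜ) hk last hlast (le_refl l)
    (Reach.empty _ _) (fun _ h => h) (fun i => by simp) (fun t _ => by simp) (fun _ h => h.elim)
  have hmem : ∀ v, v ∈ Set.range (leftEmb k l) ∪ (∅ ∪ leftTail k l last '' {j | j ≤ l}) ↔
      ¬ ∃ i, v = Sum.inr (Sum.inl i) := by
    intro v
    rw [Set.empty_union, Set.mem_union, mem_leftTail le_rfl]
    constructor
    · rintro (⟨i, rfl⟩ | rfl | ⟨t, -, rfl⟩)
      · simp [leftEmb_apply]
      · simp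
      · simp
    · rcases v with i | i | t
      · exact fun _ => Or.inl ⟨i, rfl⟩
      · simp
      · exact fun _ => Or.inr (Or.inr ⟨t, t.2, rfl⟩)
  generalize Set.range (leftEmb k l) ∪ (∅ ∪ leftTail k l last '' {j | j ≤ l}) = Out at *
  have hout : ∀ v, v ∉ Out → ∃ i, v = Sum.inr (Sum.inl i) := fun v hv => by
    rwa [hmem, not_not] at hv
  have hinl : ∀ i, Sum.inr (Sum.inl i) ∉ Out := fun i h => (hmem _).1 h ⟨i, rfl⟩
  have h2 := Reach.addPunctured hk (rightEmb k l) d last hlast (leftTail k l last l) h1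
    hinl (fun h => h rfl) (fun p hp h => hp (Sum.inl_injective (Sum.inr_injective h))) ?_ ?_ ?_
  · convert h2 using 1
    ext v
    rw [Set.mem_union, hmem]
    rcases v with i | i | u
    · simp
    · constructor
      · intro h
        exact Or.inl ⟨i, fun hi => h (by rw [hi]; rfl), rfl⟩
      · rintro (⟨p, hp, h⟩ | h)
        · rintro h'
          exact hp (Sum.inl_injective (Sum.inr_injective (h.trans h')))
        · exact (h ⟨i, rfl⟩).elim
    · simp
  · rintro p u - hu -
    obtain ⟨i, rfl⟩ := hout u hu
    exact ⟨i, rfl⟩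
  · rintro o ho hne u - huO hadj
    obtain ⟨i, rfl⟩ := hout u huO
    rcases o with p | p | t
    · rw [MGraph_adj_left_right] at hadj
      obtain ⟨rfl, h1, h2⟩ := hadj
      exact hne (by rw [leftTail_zero]; congr 1; exact Fin.ext (by omega))
    · exact hinl p ho
    · rw [MGraph_adj_mid_right] at hadj
      refine hne ((leftTail_succ (last := last) t).symm.trans ?_)
      rw [hadj.2]
  · rintro - u - huO hadj
    obtain ⟨i, rfl⟩ := hout u huO
    rw [rightEmb_apply]
    congr 2
    rcases Nat.eq_zero_or_pos l with rfl | h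
    · rw [leftTail_zero, MGraph_adj_left_right] at hadj
      exact Fin.ext (by omega)
    · rw [leftTail_pos h le_rfl, MGraph_adj_mid_right] at hadj
      exact Fin.ext (by omega)

/-- Without an inner vertex of the path the graph falls into two separate pieces, each a path power
with a part of the path. They are built one after the other. -/
theorem reach_compl_mid (hk : 3 ≤ k) (d : Fin l) :
    Reach (k + 1) (MGraph k l) {Sum.inr (Sum.inr d)}ᶜ {Sum.inr (Sum.inr d)}ᶜ := by
  have hk2 : 0 < k ^ 2 := by positivity
  obtain ⟨last, hlast⟩ : ∃ last : Fin (k ^ 2), last.val + 1 = k ^ 2 :=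
    ⟨⟨k ^ 2 - 1, by omega⟩, by simp only; omega⟩
  have h1 := reach_right (W := {Sum.inr (Sum.inr d)}ᶜ) (r := l - 1 - d) hk last hlast (by omega)
    (Reach.empty _ _) (fun _ h => h) (fun i => by simp)
    (fun t ht h => by
      have : t = d := by simpa using h
      omega) (fun _ h => h.elim)
  have hmem : ∀ v, v ∈ Set.range (rightEmb k l) ∪
      (∅ ∪ rightTail k l last '' {j | j ≤ l - 1 - d}) ↔
      (∃ i, v = Sum.inr (Sum.inl i)) ∨ ∃ t : Fin l, d < t ∧ v = Sum.inr (Sum.inr t) := by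
    intro v
    rw [Set.empty_union, Set.mem_union, mem_rightTail (by omega)]
    constructor
    · rintro (⟨i, rfl⟩ | rfl | ⟨t, ht, rfl⟩)
      · exact Or.inl ⟨i, rfl⟩
      · exact Or.inl ⟨last, rfl⟩
      · exact Or.inr ⟨t, by rw [Fin.lt_def]; omega, rfl⟩
    · rintro (⟨i, rfl⟩ | ⟨t, ht, rfl⟩)
      · exact Or.inl ⟨i, rfl⟩
      · rw [Fin.lt_def] at ht
        exact Or.inr (Or.inr ⟨t, by omega, rfl⟩)
  generalize Set.range (rightEmb k l) ∪
    (∅ ∪ rightTail k l last '' {j | j ≤ l - 1 - d}) = Out at *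
  have h2 := reach_left (r := d) hk last hlast d.2.le h1 (fun i h => by simp [hmem] at h)
    (fun i => by simp) (fun t ht h => by
      have : t = d := by simpa using h
      omega) ?_
  · convert h2 using 1
    ext v
    rw [Set.mem_union, Set.mem_union, hmem, mem_leftTail d.2.le]
    rcases v with i | i | t
    · exact ⟨fun _ => Or.inl ⟨i, rfl⟩, fun _ h => Sum.inl_ne_inr h⟩
    · simp
    · constructor
      · intro h
        have htd : t ≠ d := fun h' => h (by rw [h']; rfl)
        rcases lt_or_gt_of_ne htd with h' | h'
        · exact Or.inr (Or.inr (Or.inr ⟨t, h', rfl⟩))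
        · exact Or.inr (Or.inl (Or.inr ⟨t, h', rfl⟩))
      · rintro (⟨i, h⟩ | (⟨i, h⟩ | ⟨t', h', h⟩) | h | ⟨t', h', h⟩) htd
        · exact Sum.inl_ne_inr h
        · exact Sum.inl_ne_inr (Sum.inr_injective h).symm
        all_goals
          have e : t = d := Sum.inr_injective (Sum.inr_injective htd)
        · have e' : t = t' := Sum.inr_injective (Sum.inr_injective h)
          exact h'.ne (e.symm.trans e')
        · exact Sum.inl_ne_inr h.symm
        · have e' : t = t' := Sum.inr_injective (Sum.inr_injective h)
          have h'' : t' < d := h'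
          exact h''.ne (e'.symm.trans e)
  · intro o ho u hu huO hadj
    have hu' : u ≠ Sum.inr (Sum.inr d) := hu
    rw [hmem] at ho huO
    push Not at huO
    rcases u with i | i | t
    · rcases ho with ⟨p, rfl⟩ | ⟨t, ht, rfl⟩
      · rw [MGraph_adj_right_left] at hadj
        have := d.2
        omega
      · rw [MGraph_adj_mid_left] at hadj
        rw [Fin.lt_def] at ht
        omega
    · exact huO.1 i rfl
    · have htd : t.val ≠ d.val := fun h => hu' (by rw [Fin.ext h])
      have htd' : ¬ d.val < t.val := fun h => huO.2 t h rfl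
      have := d.2
      rcases ho with ⟨p, rfl⟩ | ⟨s, hs, rfl⟩
      · rw [MGraph_adj_right_mid] at hadj
        omega
      · rw [MGraph_adj_mid] at hadj
        rw [Fin.lt_def] at hs
        omega

theorem lcwd_induce_MGraph_le (hk : 3 ≤ k)
    {s : Set (Fin (k ^ 2) ⊕ (Fin (k ^ 2) ⊕ Fin l))} (hs : s ≠ Set.univ) :
    lcwd ((MGraph k l).induce s) ≤ ((k + 1 : ℕ) : ℕ∞) := by
  obtain ⟨d, hd⟩ := (Set.ne_univ_iff_exists_notMem s).1 hs
  have hsub : s ⊆ {d}ᶜ := fun v hv h => hd (by rwa [← Set.mem_singleton_iff.1 h])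
  refine lcwd_le (Reach.hasLinearExpr ?_ hsub)
  rcases d with d | d | d
  · exact reach_compl_left hk d
  · exact reach_compl_right hk d
  · exact reach_compl_mid hk d

end UpperBound

/-! ### Many traces in a path power -/

section Spread

variable {k n : ℕ} {T : ℕ → Prop}

/-- The positions `a` and `u` of a path power are equal or adjacent. -/
def Close (k a u : ℕ) : Prop := a ≤ u + k ∧ u ≤ a + k

/-- Some position outside `T` is a neighbour of just one of the positions `a` and `b`. -/
def Separated (k n : ℕ) (T : ℕ → Prop) (a b : ℕ) : Prop :=
  ∃ u < n, ¬ T u ∧ ¬ (Close k a u ↔ Close k b u)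

/-- The positions in `A ⊆ T` have pairwise different neighbourhoods outside `T`, none of which is
contained in the last position. -/
structure Spread (k n : ℕ) (T : ℕ → Prop) (A : Finset ℕ) : Prop where
  lt : ∀ a ∈ A, a < n
  mem : ∀ a ∈ A, T a
  alive : ∀ a ∈ A, ∃ u, u + 1 < n ∧ ¬ T u ∧ Close k a u
  separated : ∀ a ∈ A, ∀ b ∈ A, a < b → Separated k n T a b

theorem Spread.insert_last {A : Finset ℕ} (h : Spread k n T A) (hn : 0 < n) (hT : T (n - 1))
    (hu : ∃ u, u + 1 < n ∧ ¬ T u ∧ Close k (n - 1) u)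
    (hA : ∀ a ∈ A, a + 1 < n ∧ Separated k n T a (n - 1)) : Spread k n T (insert (n - 1) A) where
  lt a ha := by
    rcases Finset.mem_insert.1 ha with rfl | ha
    · omega
    · exact h.lt a ha
  mem a ha := by
    rcases Finset.mem_insert.1 ha with rfl | ha
    · exact hT
    · exact h.mem a ha
  alive a ha := by
    rcases Finset.mem_insert.1 ha with rfl | ha
    · exact hu
    · exact h.alive a ha
  separated a ha b hb hab := by
    rcases Finset.mem_insert.1 ha with rfl | ha <;> rcases Finset.mem_insert.1 hb with rfl | hb
    · omega
    · have := h.lt b hb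
      omega
    · exact (hA a ha).2
    · exact h.separated a ha b hb hab

/-- `r` is the element of `T` in its residue class that is next to the gap `[g, g + k)`. -/
def NextToGap (k n g : ℕ) (T : ℕ → Prop) (r : ℕ) : Prop :=
  T r ∧ r < n ∧ ((r < g ∧ ¬ T (r + k)) ∨ (g + k ≤ r ∧ ¬ T (r - k)))

/-- Walk towards the gap in steps of `k` while staying in `T`. A step cannot jump over a gap of
length `k`, so the walk stops. Unless it starts at the last position, it never visits it. -/
theorem exists_nextToGap {g : ℕ} (hk : 0 < k) (hg : g + k ≤ n)
    (hgap : ∀ p, g ≤ p → p < g + k → ¬ T p) {p : ℕ} (hp : p < n) (hT : T p) :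
    ∃ r, NextToGap k n g T r ∧ r % k = p % k ∧ (p + 1 < n → r + 1 < n) := by
  have hout : ∀ p, T p → p < g ∨ g + k ≤ p := fun p hT => by
    by_contra h
    exact hgap p (by omega) (by omega) hT
  rcases hout p hT with h | h
  · obtain ⟨m, hm⟩ : ∃ m, m = g - p := ⟨_, rfl⟩
    induction m using Nat.strong_induction_on generalizing p with
    | _ m ih =>
      by_cases hT' : T (p + k)
      · have := hout _ hT'
        obtain ⟨r, h1, h2, h3⟩ := ih (g - (p + k)) (by omega) (p := p + k) (by omega) hT' (by omega)
          rfl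
        exact ⟨r, h1, by rw [h2, Nat.add_mod_right], fun _ => h3 (by omega)⟩
      · exact ⟨p, ⟨hT, hp, Or.inl ⟨h, hT'⟩⟩, rfl, id⟩
  · induction p using Nat.strong_induction_on with
    | _ p ih =>
      by_cases hT' : T (p - k)
      · have := hout _ hT'
        obtain ⟨r, h1, h2, h3⟩ := ih (p - k) (by omega) (by omega) hT' (by omega)
        refine ⟨r, h1, ?_, fun _ => h3 (by omega)⟩
        rw [h2, ← Nat.add_mod_right, Nat.sub_add_cancel (by omega)]
      · exact ⟨p, ⟨hT, hp, Or.inr ⟨h, hT'⟩⟩, rfl, id⟩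

/-- On the left of the gap `b + k` is near `b` but not near `a`; on the right `a - k` is near `a`
but not near `b`. Pairs on different sides are left to `hsep`. -/
theorem NextToGap.separated {g : ℕ} (hk : 0 < k) (hg : g + k ≤ n)
    (hgap : ∀ p, g ≤ p → p < g + k → ¬ T p)
    (hsep : ∀ a b, T a → T b → a < g → g + k ≤ b → b < n → Separated k n T a b) {a b : ℕ}
    (ha : NextToGap k n g T a) (hab : a < b) (hb : NextToGap k n g T b ∨ b = n - 1 ∧ T b) :
    Separated k n T a b := by
  obtain ⟨h1, h2, ⟨h3, h4⟩ | ⟨h3, h4⟩⟩ := ha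
  · rcases hb with ⟨h5, h6, ⟨h7, h8⟩ | ⟨h7, h8⟩⟩ | ⟨rfl, h5⟩
    · refine ⟨b + k, by omega, h8, ?_⟩
      unfold Close
      omega
    · exact hsep a b h1 h5 h3 h7 h6
    · refine hsep a _ h1 h5 h3 ?_ (by omega)
      by_contra h
      exact hgap _ (by omega) (by omega) h5
  · refine ⟨a - k, by omega, h4, ?_⟩
    unfold Close
    omega

/-- One representative next to the gap is taken from every residue class in `Q`. The last position
can be adjoined if it need not serve as a representative. -/
theorem exists_spread_of_gap {g : ℕ} (hk : 0 < k) (hg : g + k ≤ n)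
    (hgap : ∀ p, g ≤ p → p < g + k → ¬ T p)
    (hsep : ∀ a b, T a → T b → a < g → g + k ≤ b → b < n → Separated k n T a b)
    (halive : ∀ a < n, T a → ∃ u, u + 1 < n ∧ ¬ T u ∧ Close k a u) (Q : Finset ℕ)
    (hQ : ∀ q ∈ Q, ∃ p < n, T p ∧ p % k = q) :
    ∃ A : Finset ℕ, A.card = Q.card ∧ Spread k n T A ∧
      (T (n - 1) → ((n - 1) % k ∈ Q → ∃ p, p + 1 < n ∧ T p ∧ p % k = (n - 1) % k) →
        n - 1 ∉ A ∧ Spread k n T (insert (n - 1) A)) := by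
  classical
  have hrep : ∀ q ∈ Q, ∃ r, NextToGap k n g T r ∧ r % k = q ∧
      ((∃ p, p + 1 < n ∧ T p ∧ p % k = q) → r + 1 < n) := by
    intro q hq
    by_cases h : ∃ p, p + 1 < n ∧ T p ∧ p % k = q
    · obtain ⟨p, h1, h2, h3⟩ := h
      obtain ⟨r, h4, h5, h6⟩ := exists_nextToGap hk hg hgap (p := p) (by omega) h2
      exact ⟨r, h4, h5.trans h3, fun _ => h6 h1⟩
    · obtain ⟨p, h1, h2, h3⟩ := hQ q hq
      obtain ⟨r, h4, h5, -⟩ := exists_nextToGap hk hg hgap h1 h2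
      exact ⟨r, h4, h5.trans h3, fun h' => (h h').elim⟩
  choose! f hf using hrep
  have hS : Spread k n T (Q.image f) := by
    refine ⟨fun a ha => ?_, fun a ha => ?_, fun a ha => ?_, fun a ha b hb hab => ?_⟩
    all_goals obtain ⟨q, hq, rfl⟩ := Finset.mem_image.1 ha
    · exact (hf q hq).1.2.1
    · exact (hf q hq).1.1
    · exact halive _ (hf q hq).1.2.1 (hf q hq).1.1
    · obtain ⟨q', hq', rfl⟩ := Finset.mem_image.1 hb
      exact (hf q hq).1.separated hk hg hgap hsep hab (Or.inl (hf q' hq').1)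
  refine ⟨Q.image f, ?_, hS, fun hT h => ?_⟩
  · refine Finset.card_image_of_injOn fun q hq q' hq' h => ?_
    rw [← (hf q hq).2.1, ← (hf q' hq').2.1, h]
  · have hlt : ∀ a ∈ Q.image f, a + 1 < n := by
      intro a ha
      obtain ⟨q, hq, rfl⟩ := Finset.mem_image.1 ha
      by_contra hlt
      have hlt' := (hf q hq).1.2.1
      have he : f q = n - 1 := by omega
      have hq' : q = (n - 1) % k := by rw [← (hf q hq).2.1, he]
      exact hlt ((hf q hq).2.2 (by rw [hq']; exact h (hq' ▸ hq)))
    refine ⟨fun h' => by have := hlt _ h'; omega,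
      hS.insert_last (by omega) hT (halive _ (by omega) hT) fun a ha => ⟨hlt a ha, ?_⟩⟩
    have := hlt a ha
    obtain ⟨q, hq, rfl⟩ := Finset.mem_image.1 ha
    exact (hf q hq).1.separated hk hg hgap hsep (by omega) (Or.inr ⟨rfl, hT⟩)

theorem exists_block {c p : ℕ} (hp : p < k * k) (hc : c ≤ p) :
    ∃ j < k, c + j * k ≤ p ∧ p < c + j * k + k := by
  have hk : 0 < k := Nat.pos_of_mul_pos_left (Nat.zero_lt_of_lt hp)
  have h1 := Nat.div_add_mod (p - c) k
  have h2 := Nat.mod_lt (p - c) hk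
  rw [Nat.mul_comm] at h1
  refine ⟨(p - c) / k, ?_, by omega, by omega⟩
  rw [Nat.div_lt_iff_lt_mul hk]
  omega

theorem succ_mul_eq (j k : ℕ) : (j + 1) * k = j * k + k := Nat.succ_mul j k

theorem mul_add_le {j k : ℕ} (hj : j < k) : j * k + k ≤ k * k := by
  rw [← Nat.succ_mul]
  exact Nat.mul_le_mul_right k hj

/-- If just one residue class does not meet `T`, then there are many neighbourhoods. -/
theorem exists_spread (hk : 3 ≤ k) {c : ℕ} (hc : c < k) (hC : ∀ j < k, ¬ T (c + j * k))
    (hQ : ∀ q < k, q ≠ c → ∃ p < k * k, T p ∧ p % k = q) :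
    ∃ A : Finset ℕ, A.card = k - 1 ∧ Spread k (k * k) T A ∧
      (T (k * k - 1) → (∃ p, p + 1 < k * k ∧ T p ∧ p % k = k - 1) →
        k * k - 1 ∉ A ∧ Spread k (k * k) T (insert (k * k - 1) A)) := by
  classical
  have hmod : (k * k - 1) % k = k - 1 := by
    obtain ⟨m, rfl⟩ : ∃ m, k = m + 1 := ⟨k - 1, by omega⟩
    have : (m + 1) * (m + 1) - 1 = m + (m + 1) * m := by rw [Nat.mul_succ]; omega
    rw [this, Nat.add_mul_mod_self_left, Nat.mod_eq_of_lt (by omega)]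
    omega
  have h3k : 3 * k ≤ k * k := Nat.mul_le_mul_right k hk
  have hcT : ∀ a, T a → ∀ j < k, a ≠ c + j * k := fun a ha j hj h => hC j hj (h ▸ ha)
  have halive : ∀ a < k * k, T a → ∃ u, u + 1 < k * k ∧ ¬ T u ∧ Close k a u := by
    intro a ha hT
    rcases lt_or_ge a c with h | h
    · refine ⟨c, by omega, by simpa using hC 0 (by omega), ?_⟩
      unfold Close
      omega
    · obtain ⟨j, hj, h1, h2⟩ := exists_block ha h
      have := hcT a hT j hj
      refine ⟨c + j * k, by omega, hC j hj, ?_⟩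
      unfold Close
      omega
  -- Either some block between consecutive elements of the class of `c` misses `T`, and the classes
  -- other than `c` give `k - 1` positions around this gap; or each of the `k - 1` blocks contains
  -- an element of `T`.
  by_cases hgap : ∃ i, i + 1 < k ∧ ∀ p, c + i * k ≤ p → p < c + i * k + k → ¬ T p
  · obtain ⟨i, hi, hgap⟩ := hgap
    have hi' := mul_add_le hi
    have hi2 := succ_mul_eq i k
    obtain ⟨A, hA, hS, hS'⟩ := exists_spread_of_gap (g := c + i * k) (by omega) (by omega) hgap
      (fun a b ha hb hag hbg hbn => by
        obtain ⟨j, hj, h1, h2⟩ := exists_block (c := c) hbn (by omega)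
        refine ⟨c + j * k, by omega, hC j hj, ?_⟩
        have hij : i + 1 ≤ j := by
          by_contra hij
          have := Nat.mul_le_mul_right k (show j ≤ i by omega)
          have := hcT b hb (i + 1) hi
          have := hC (i + 1) hi
          omega
        have := Nat.mul_le_mul_right k hij
        unfold Close
        omega) halive ((Finset.range k).erase c) (fun q hq => by
          rw [Finset.mem_erase, Finset.mem_range] at hq
          exact hQ q hq.2 hq.1)
    refine ⟨A, ?_, hS, fun hT h => hS' hT fun _ => by rwa [hmod]⟩
    rw [hA, Finset.card_erase_of_mem (Finset.mem_range.2 hc), Finset.card_range]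
  · push Not at hgap
    have hrep : ∀ i, i + 1 < k → ∃ p, c + i * k < p ∧ p < c + (i + 1) * k ∧ T p := by
      intro i hi
      obtain ⟨p, h1, h2, h3⟩ := hgap i hi
      have := hcT p h3 i (by omega)
      exact ⟨p, by omega, by rw [Nat.succ_mul]; omega, h3⟩
    choose! f hf1 hf2 hfT using hrep
    have hmono : ∀ i j, i < j → j + 1 < k → c + (i + 1) * k ≤ c + j * k := fun i j hij _ =>
      Nat.add_le_add_left (Nat.mul_le_mul_right k hij) c
    have hlt : ∀ i, i + 1 < k → f i + 1 < k * k := fun i hi => by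
      have h1 := hf2 i hi
      have h2 := mul_add_le hi
      omega
    have hS : Spread k (k * k) T ((Finset.range (k - 1)).image f) := by
      refine ⟨fun a ha => ?_, fun a ha => ?_, fun a ha => ?_, fun a ha b hb hab => ?_⟩
      all_goals
        obtain ⟨i, hi, rfl⟩ := Finset.mem_image.1 ha
        rw [Finset.mem_range] at hi
        have hil := hlt i (by omega)
      · omega
      · exact hfT i (by omega)
      · exact halive _ (by omega) (hfT i (by omega))
      · obtain ⟨j, hj, rfl⟩ := Finset.mem_image.1 hb
        rw [Finset.mem_range] at hj
        have hj1 := hf1 j (by omega)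
        have hj2 := hf2 j (by omega)
        have hi1 := hf1 i (by omega)
        have hi2 := hf2 i (by omega)
        have hij : i < j := by
          by_contra h
          rcases Nat.lt_or_eq_of_le (not_lt.1 h) with h | rfl
          · have := hmono j i h (by omega)
            omega
          · omega
        have := hmono i j hij (by omega)
        have := mul_add_le (show j + 1 < k by omega)
        have h5 := succ_mul_eq j k
        -- The end of the block of the larger position is near that position, and further than `k`
        -- from all earlier blocks.
        refine ⟨c + (j + 1) * k, by omega, hC _ (by omega), ?_⟩
        unfold Close
        omega
    have hinj : Set.InjOn f (Finset.range (k - 1)) := by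
      intro i hi j hj h
      rw [Finset.mem_coe, Finset.mem_range] at hi hj
      have hj1 := hf1 j (by omega)
      have hj2 := hf2 j (by omega)
      have hi1 := hf1 i (by omega)
      have hi2 := hf2 i (by omega)
      rcases lt_trichotomy i j with hij | hij | hij
      · have := hmono i j hij (by omega)
        omega
      · exact hij
      · have := hmono j i hij (by omega)
        omega
    refine ⟨_, by rw [Finset.card_image_of_injOn hinj, Finset.card_range], hS, fun hT _ => ?_⟩
    have hlt' : ∀ a ∈ (Finset.range (k - 1)).image f, a + 1 < k * k := fun a ha => by
      obtain ⟨i, hi, rfl⟩ := Finset.mem_image.1 ha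
      rw [Finset.mem_range] at hi
      exact hlt i (by omega)
    refine ⟨fun h => by have := hlt' _ h; omega,
      hS.insert_last (by omega) hT (halive _ (by omega) hT) fun a ha => ⟨hlt' a ha, ?_⟩⟩
    obtain ⟨i, hi, rfl⟩ := Finset.mem_image.1 ha
    rw [Finset.mem_range] at hi
    have hi1 := hf1 i (by omega)
    have hi2 := hf2 i (by omega)
    have h5 := succ_mul_eq i k
    have h6 := mul_add_le (show i + 1 < k by omega)
    -- Since the last position is in `T`, its class is not that of `c`. This leaves the room by
    -- which `c + i * k` is too far from the last position.
    have hck : c + 1 ≠ k := fun h => hcT _ hT (k - 1) (by omega) (by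
      have : (k - 1) * k + k = k * k := by rw [← Nat.succ_mul]; congr 1; omega
      omega)
    refine ⟨c + i * k, by omega, hC _ (by omega), ?_⟩
    unfold Close
    omega

/-- If only the last element of the last residue class is in `T`, and all other classes meet `T`,
then there are many neighbourhoods. -/
theorem exists_spread_of_last (hk : 3 ≤ k) (hC : ∀ j, j + 1 < k → ¬ T (j * k + k - 1))
    (hT : T (k * k - 1)) (hQ : ∀ q, q + 1 < k → ∃ p < k * k, T p ∧ p % k = q) :
    ∃ A : Finset ℕ, A.card = k ∧ Spread k (k * k) T A := by
  classical
  have h3k : 3 * k ≤ k * k := Nat.mul_le_mul_right k hk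
  have hcT : ∀ a, T a → ∀ j, j + 1 < k → a ≠ j * k + k - 1 := fun a ha j hj h => hC j hj (h ▸ ha)
  have halive : ∀ a < k * k, T a → ∃ u, u + 1 < k * k ∧ ¬ T u ∧ Close k a u := by
    intro a ha hT
    rcases lt_or_ge a k with h | h
    · refine ⟨k - 1, by omega, by simpa using hC 0 (by omega), ?_⟩
      unfold Close
      omega
    · obtain ⟨j, hj, h1, h2⟩ := exists_block (c := 0) ha (by omega)
      obtain ⟨j, rfl⟩ : ∃ i, j = i + 1 :=
        ⟨j - 1, by rcases j with _ | j <;> [(simp at h2; omega); rfl]⟩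
      have h5 := succ_mul_eq j k
      refine ⟨j * k + k - 1, by omega, hC j hj, ?_⟩
      unfold Close
      omega
  by_cases hgap : ∃ i, i + 1 < k ∧ ∀ p, i * k ≤ p → p < i * k + k → ¬ T p
  · obtain ⟨i, hi, hgap⟩ := hgap
    have hi' := mul_add_le hi
    have hi2 := succ_mul_eq i k
    obtain ⟨A, hA, -, hS⟩ := exists_spread_of_gap (g := i * k) (by omega) (by omega) hgap
      (fun a b ha hb hag hbg hbn => by
        obtain ⟨j, hj, h1, h2⟩ := exists_block (c := 0) hbn (by omega)
        have hij : i + 1 ≤ j := by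
          by_contra hij
          have := Nat.mul_le_mul_right k (show j ≤ i by omega)
          omega
        have h7 := Nat.mul_le_mul_right k hij
        obtain ⟨j, rfl⟩ : ∃ i, j = i + 1 := ⟨j - 1, by omega⟩
        have h5 := succ_mul_eq j k
        -- The position before the gap is in the last class, hence not in `T`. Without this, the
        -- separating position below would be at distance exactly `k` from `a`.
        have hai : a + 1 ≠ i * k := by
          rcases i with _ | i
          · omega
          · have := hcT a ha i (by omega)
            have := succ_mul_eq i k
            omega
        refine ⟨j * k + k - 1, by omega, hC j hj, ?_⟩
        unfold Close
        omega) halive (Finset.range (k - 1)) (fun q hq => by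
          rw [Finset.mem_range] at hq
          exact hQ q (by omega))
    have hmod : (k * k - 1) % k = k - 1 := by
      have : k * k - 1 = k - 1 + k * (k - 1) := by
        obtain ⟨m, rfl⟩ : ∃ m, k = m + 1 := ⟨k - 1, by omega⟩
        rw [Nat.mul_succ, Nat.add_sub_cancel]
        omega
      rw [this, Nat.add_mul_mod_self_left, Nat.mod_eq_of_lt (by omega)]
    obtain ⟨h1, h2⟩ := hS hT (fun h => by rw [hmod, Finset.mem_range] at h; omega)
    refine ⟨_, ?_, h2⟩
    rw [Finset.card_insert_of_notMem h1, hA, Finset.card_range]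
    omega
  · push Not at hgap
    choose! f hf1 hf2 hfT using hgap
    have hf2' : ∀ i, i + 1 < k → f i + 1 < i * k + k := fun i hi => by
      have := hf2 i hi
      have := hcT _ (hfT i hi) i hi
      omega
    have hmono : ∀ i j, i < j → j + 1 < k → i * k + k ≤ j * k := fun i j hij _ => by
      rw [← Nat.succ_mul]
      exact Nat.mul_le_mul_right k hij
    have hlt : ∀ i, i + 1 < k → f i + k + 1 < k * k := fun i hi => by
      have h1 := hf2' i hi
      have h2 := mul_add_le hi
      have := succ_mul_eq i k
      omega
    have hS : Spread k (k * k) T ((Finset.range (k - 1)).image f) := by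
      refine ⟨fun a ha => ?_, fun a ha => ?_, fun a ha => ?_, fun a ha b hb hab => ?_⟩
      all_goals
        obtain ⟨i, hi, rfl⟩ := Finset.mem_image.1 ha
        rw [Finset.mem_range] at hi
        have hil := hlt i (by omega)
      · omega
      · exact hfT i (by omega)
      · exact halive _ (by omega) (hfT i (by omega))
      · obtain ⟨j, hj, rfl⟩ := Finset.mem_image.1 hb
        rw [Finset.mem_range] at hj
        have hj1 := hf1 j (by omega)
        have hj2 := hf2' j (by omega)
        have hi1 := hf1 i (by omega)
        have hi2 := hf2' i (by omega)
        have hij : i < j := by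
          by_contra h
          rcases Nat.lt_or_eq_of_le (not_lt.1 h) with h | rfl
          · have := hmono j i h (by omega)
            omega
          · omega
        have := hmono i j hij (by omega)
        have := mul_add_le (show j + 1 < k by omega)
        have h5 := succ_mul_eq j k
        refine ⟨j * k + k - 1, by omega, hC _ (by omega), ?_⟩
        unfold Close
        omega
    have hinj : Set.InjOn f (Finset.range (k - 1)) := by
      intro i hi j hj h
      rw [Finset.mem_coe, Finset.mem_range] at hi hj
      have hj1 := hf1 j (by omega)
      have hj2 := hf2 j (by omega)
      have hi1 := hf1 i (by omega)
      have hi2 := hf2 i (by omega)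
      rcases lt_trichotomy i j with hij | hij | hij
      · have := hmono i j hij (by omega)
        omega
      · exact hij
      · have := hmono j i hij (by omega)
        omega
    have hlt' : ∀ a ∈ (Finset.range (k - 1)).image f, a + 1 < k * k := fun a ha => by
      obtain ⟨i, hi, rfl⟩ := Finset.mem_image.1 ha
      rw [Finset.mem_range] at hi
      have := hlt i (by omega)
      omega
    refine ⟨insert (k * k - 1) ((Finset.range (k - 1)).image f), ?_,
      hS.insert_last (by omega) hT (halive _ (by omega) hT) fun a ha => ⟨hlt' a ha, ?_⟩⟩
    · rw [Finset.card_insert_of_notMem (fun h => by have := hlt' _ h; omega),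
        Finset.card_image_of_injOn hinj, Finset.card_range]
      omega
    obtain ⟨i, hi, rfl⟩ := Finset.mem_image.1 ha
    rw [Finset.mem_range] at hi
    have hi1 := hf1 i (by omega)
    have hi2 := hf2' i (by omega)
    have h5 := succ_mul_eq i k
    have h6 := mul_add_le (show i + 1 < k by omega)
    rcases i with _ | i
    · refine ⟨k - 1, by omega, by simpa using hC 0 (by omega), ?_⟩
      unfold Close
      omega
    · have := succ_mul_eq i k
      refine ⟨i * k + k - 1, by omega, hC i (by omega), ?_⟩
      unfold Close
      omega

/-- A proper subset with at least two elements has two different outer neighbourhoods. -/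
theorem exists_separated (hk : 3 ≤ k) {a b u : ℕ} (ha : T a) (hb : T b) (hab : a < b)
    (hbn : b < k * k) (hu : ¬ T u) (hun : u < k * k) :
    ∃ y < k * k, ∃ z < k * k, T y ∧ T z ∧ Separated k (k * k) T y z := by
  classical
  have hkk : 3 * k ≤ k * k := Nat.mul_le_mul_right k hk
  have hkk' : 4 ≤ k → 4 * k ≤ k * k := fun h => Nat.mul_le_mul_right k h
  have hne : ((Finset.range (k * k)).filter T).Nonempty :=
    ⟨a, Finset.mem_filter.2 ⟨Finset.mem_range.2 (by omega), ha⟩⟩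
  obtain ⟨s, hs, hs'⟩ := Finset.exists_min_image _ id hne
  obtain ⟨t, ht, ht'⟩ := Finset.exists_max_image _ id hne
  simp only [Finset.mem_filter, Finset.mem_range, id] at hs hs' ht ht'
  have h1 := hs' a ⟨by omega, ha⟩
  have h2 := ht' b ⟨by omega, hb⟩
  have hlow : ∀ v < s, ¬ T v := fun v hv hT => by
    have := hs' v ⟨by omega, hT⟩
    omega
  have hhigh : ∀ v < k * k, t < v → ¬ T v := fun v hv hv' hT => by
    have := ht' v ⟨hv, hT⟩
    omega
  by_cases c1 : k ≤ s
  · refine ⟨s, hs.1, t, ht.1, hs.2, ht.2, s - k, by omega, hlow _ (by omega), ?_⟩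
    unfold Close
    omega
  by_cases c2 : t + k < k * k
  · refine ⟨s, hs.1, t, ht.1, hs.2, ht.2, t + k, by omega, hhigh _ (by omega) (by omega), ?_⟩
    unfold Close
    omega
  have hfar : s + k + 1 ≤ t := by
    rcases Nat.lt_or_ge k 4 with h | h
    · obtain rfl : k = 3 := by omega
      omega
    · have := hkk' h
      omega
  by_cases c3 : 0 < s
  · refine ⟨s, hs.1, t, ht.1, hs.2, ht.2, s - 1, by omega, hlow _ (by omega), ?_⟩
    unfold Close
    omega
  by_cases c4 : t + 1 < k * k
  · refine ⟨s, hs.1, t, ht.1, hs.2, ht.2, t + 1, by omega, hhigh _ (by omega) (by omega), ?_⟩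
    unfold Close
    omega
  -- Both end positions are now in `T`. As `T` is not everything, it is left at some `v + 1`; this
  -- position separates `v` from the far end.
  obtain ⟨v, hv1, hv2, hv3⟩ : ∃ v, v + 1 < k * k ∧ T v ∧ ¬ T (v + 1) := by
    by_contra! h
    have : ∀ v, v < k * k → T v := by
      intro v
      induction v with
      | zero => exact fun _ => (show s = 0 by omega) ▸ hs.2
      | succ v ih => exact fun hv => h v hv (ih (by omega))
    exact hu (this u hun)
  by_cases c5 : v + 1 ≤ k
  · refine ⟨v, by omega, t, ht.1, hv2, ht.2, v + 1, hv1, hv3, ?_⟩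
    have : k = 3 ∨ 4 ≤ k := by omega
    unfold Close
    rcases this with rfl | h
    · omega
    · have := hkk' h
      omega
  · refine ⟨s, hs.1, v, by omega, hs.2, hv2, v + 1, hv1, hv3, ?_⟩
    unfold Close
    omega

/-- There is a residue class that is reached last, at its element `x`. -/
theorem exists_last_class (hk : 0 < k) {f : ℕ → ℕ}
    (hf : ∀ p < k * k, ∀ q < k * k, f p = f q → p = q) :
    ∃ x < k * k, (∀ p < k * k, p % k = x % k → f x ≤ f p) ∧
      ∀ q < k, q ≠ x % k → ∃ p < k * k, p % k = q ∧ f p < f x := by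
  classical
  have hkk : k ≤ k * k := Nat.le_mul_self k
  have hmin : ∀ q < k, ∃ m < k * k, m % k = q ∧ ∀ p < k * k, p % k = q → f m ≤ f p := by
    intro q hq
    obtain ⟨m, hm, hm'⟩ := Finset.exists_min_image ((Finset.range (k * k)).filter (· % k = q)) f
      ⟨q, Finset.mem_filter.2 ⟨Finset.mem_range.2 (by omega), Nat.mod_eq_of_lt hq⟩⟩
    simp only [Finset.mem_filter, Finset.mem_range] at hm hm'
    exact ⟨m, hm.1, hm.2, fun p h1 h2 => hm' p ⟨h1, h2⟩⟩
  choose! m hm1 hm2 hm3 using hmin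
  -- `m q` is the first element of its class to be added; `c` is the class for which this happens
  -- last.
  obtain ⟨c, hc, hc'⟩ := Finset.exists_max_image (Finset.range k) (fun q => f (m q))
    ⟨0, Finset.mem_range.2 hk⟩
  simp only [Finset.mem_range] at hc hc'
  refine ⟨m c, hm1 c hc, fun p hp h => hm3 c hc p hp (h.trans (hm2 c hc)), fun q hq hqc =>
    ⟨m q, hm1 q hq, hm2 q hq, lt_of_le_of_ne (hc' q hq) fun h => hqc ?_⟩⟩
  rw [← hm2 q hq, hf _ (hm1 q hq) _ (hm1 c hc) h]

end Spread

/-! ### Too many traces in two linked path powers -/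

section LowerBound

variable {V : Type*} {G : SimpleGraph V} {k l : ℕ} {e e' z : ℕ → V} {τ : V → ℕ}

/-- `G` contains two induced `k`-path powers `e` and `e'`, whose last vertices are joined by the
path `z`, such that no other edges leave the two path powers. -/
structure Linked (G : SimpleGraph V) (k l : ℕ) (e e' z : ℕ → V) : Prop where
  inj : ∀ p < k * k, ∀ q < k * k, e p = e q → p = q
  inj' : ∀ p < k * k, ∀ q < k * k, e' p = e' q → p = q
  adj : ∀ p < k * k, ∀ q < k * k, G.Adj (e p) (e q) ↔ p ≠ q ∧ Close k p q
  adj' : ∀ p < k * k, ∀ q < k * k, G.Adj (e' p) (e' q) ↔ p ≠ q ∧ Close k p q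
  disjoint : ∀ p < k * k, ∀ q < k * k, e p ≠ e' q
  out : ∀ p < k * k, ∀ v, G.Adj (e p) v → (∃ q < k * k, v = e q) ∨ p + 1 = k * k ∧ v = z 1
  out' : ∀ p < k * k, ∀ v, G.Adj (e' p) v → (∃ q < k * k, v = e' q) ∨ p + 1 = k * k ∧ v = z l
  first : z 0 = e (k * k - 1)
  last : z (l + 1) = e' (k * k - 1)
  step : ∀ i ≤ l, G.Adj (z i) (z (i + 1))
  ne : ∀ i, 1 ≤ i → i ≤ l → ∀ p < k * k, z i ≠ e p
  ne' : ∀ i, 1 ≤ i → i ≤ l → ∀ p < k * k, z i ≠ e' p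

namespace Linked

theorem symm (h : Linked G k l e e' z) : Linked G k l e' e fun i => z (l + 1 - i) where
  inj := h.inj'
  inj' := h.inj
  adj := h.adj'
  adj' := h.adj
  disjoint p hp q hq he := h.disjoint q hq p hp he.symm
  out := h.out'
  out' p hp v hv := by
    rw [Nat.add_sub_cancel_left]
    exact h.out p hp v hv
  first := h.last
  last := by
    rw [Nat.sub_self]
    exact h.first
  step i hi := by
    have := (h.step (l - i) (Nat.sub_le l i)).symm
    rwa [show l - i + 1 = l + 1 - i by omega, show l - i = l + 1 - (i + 1) by omega] at this
  ne i h1 h2 p hp := h.ne' _ (by omega) (by omega) p hp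
  ne' i h1 h2 p hp := h.ne _ (by omega) (by omega) p hp

theorem link_ne (h : Linked G k l e e' z) {p : ℕ} (hp : p < k * k) :
    z l ≠ e' p := by
  rcases Nat.eq_zero_or_pos l with rfl | hl
  · rw [h.first]
    exact h.disjoint _ (by omega) _ hp
  · exact h.ne' l hl le_rfl p hp

theorem not_adj_of_ne (h : Linked G k l e e' z) {v : V} (h1 : v ≠ z l)
    (h2 : ∀ p < k * k, v ≠ e' p) {p : ℕ} (hp : p < k * k) : ¬ G.Adj v (e' p) := by
  intro hadj
  rcases h.out' p hp v hadj.symm with ⟨q, hq, rfl⟩ | ⟨-, rfl⟩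
  · exact h2 q hq rfl
  · exact h1 rfl

/-- A vertex that lends its label is more than `k` away but near all neighbours of `e' p`, which is
possible only from an end. At the last position the neighbour on the path rules this out. At
position 0 it must be `e' (k + 1)`, whose other neighbours up to `2 * k + 1` may not come later. -/
theorem eq_zero_of_shares (h : Linked G k l e e' z) (hk : 3 ≤ k) (hτ : Function.Injective τ)
    {p : ℕ} (hp : p < k * k) {y : V} (hy : Shares G τ (e' p) y) :
    p = 0 ∧ ∀ j, k < j → j ≤ 2 * k + 1 → τ (e' j) < τ (e' p) := by
  have hkk : 3 * k ≤ k * k := Nat.mul_le_mul_right k hk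
  obtain ⟨hlt, hnadj, hsub, hsup⟩ := hy
  have hclose : ∀ u < k * k, p ≠ u → Close k p u → G.Adj y (e' u) := fun u hu hne hc =>
    hsub _ ((h.adj' p hp u hu).2 ⟨hne, hc⟩)
  obtain ⟨q, hq, rfl⟩ : ∃ q < k * k, y = e' q := by
    obtain ⟨u, hu, hne, hc⟩ : ∃ u, u + 1 < k * k ∧ p ≠ u ∧ Close k p u := by
      by_cases h' : p + 2 < k * k
      · exact ⟨p + 1, by omega, by omega, by unfold Close; omega⟩
      · exact ⟨p - 1, by omega, by omega, by unfold Close; omega⟩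
    rcases h.out' u (by omega) _ (hclose u (by omega) hne hc).symm with hq | ⟨h1, -⟩
    · exact hq
    · omega
  have hqp : q ≠ p := fun hqp => by rw [hqp] at hlt; exact lt_irrefl _ hlt
  have hfar : ¬ Close k p q := fun hc => hnadj ((h.adj' p hp q hq).2 ⟨hqp.symm, hc⟩)
  have hcl : ∀ u < k * k, p ≠ u → Close k p u → Close k q u := fun u hu hne hc =>
    ((h.adj' q hq u hu).1 (hclose u hu hne hc)).2
  unfold Close at hfar hcl
  rcases lt_or_gt_of_ne hqp with hlt' | hlt'
  · exfalso
    have hp' : p + 1 = k * k := by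
      by_contra hne
      have := hcl (p + 1) (by omega) (by omega) (by omega)
      omega
    have hadj : G.Adj (e' p) (z l) := by
      have := h.step l le_rfl
      rw [h.last, show k * k - 1 = p by omega] at this
      exact this.symm
    rcases h.out' q hq _ (hsub _ hadj) with ⟨r, hr, hr'⟩ | ⟨h1, -⟩
    · exact h.link_ne hr hr'
    · omega
  · have hp0 : p = 0 := by
      by_contra hne
      have := hcl (p - 1) (by omega) (by omega) (by omega)
      omega
    have hq1 : q = k + 1 := by
      have := hcl (p + 1) (by omega) (by omega) (by omega)
      omega
    refine ⟨hp0, fun j hj1 hj2 => ?_⟩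
    rcases eq_or_ne j q with rfl | hjq
    · exact hlt
    by_contra hj
    have hne : τ (e' p) ≠ τ (e' j) := fun h' => by
      have := h.inj' p hp j (by omega) (hτ h')
      omega
    have hadj := hsup (e' j) (by omega)
      ((h.adj' q hq j (by omega)).2 ⟨hjq.symm, by unfold Close; omega⟩)
    rw [h.adj' p hp j (by omega)] at hadj
    unfold Close at hadj
    omega

/-- The traces from `A` contain a vertex of `e'` other than its last one, and those from `B` do not,
so the two families of traces can be counted together. -/
theorem card_add_card_le (h : Linked G k l e e' z)
    (hbound : ∀ x, (∀ y, ¬ Shares G τ x y) → ∀ A : Finset V, (∀ a ∈ A, τ a < τ x) →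
      (∀ a ∈ A, ∀ b ∈ A, a ≠ b → ∃ u, τ x ≤ τ u ∧ ¬ (G.Adj a u ↔ G.Adj b u)) →
      A.card + 1 ≤ k + 1) {x : V} (hx : ∀ y, ¬ Shares G τ x y) {A : Finset ℕ}
    (hA : Spread k (k * k) (fun p => τ (e' p) < τ x) A) {B : Finset V}
    (hB : ∀ b ∈ B, τ b < τ x)
    (hBA : ∀ b ∈ B, ∀ u, u + 1 < k * k → ¬ G.Adj b (e' u))
    (hsep : ∀ a ∈ B, ∀ b ∈ B, a ≠ b → ∃ u, τ x ≤ τ u ∧ ¬ (G.Adj a u ↔ G.Adj b u)) :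
    A.card + B.card ≤ k := by
  classical
  have hadj : ∀ a ∈ A, ∀ u < k * k, ¬ τ (e' u) < τ x → (G.Adj (e' a) (e' u) ↔ Close k a u) := by
    intro a ha u hu hux
    rw [h.adj' a (hA.lt a ha) u hu, and_iff_right]
    rintro rfl
    exact hux (hA.mem a ha)
  have halive : ∀ a ∈ A, ∃ u, u + 1 < k * k ∧ τ x ≤ τ (e' u) ∧ G.Adj (e' a) (e' u) := by
    intro a ha
    obtain ⟨u, h1, h2, h3⟩ := hA.alive a ha
    exact ⟨u, h1, not_lt.1 h2, (hadj a ha u (by omega) h2).2 h3⟩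
  have hAB : ∀ a ∈ A, ∀ b ∈ B, ∃ u, τ x ≤ τ u ∧ ¬ (G.Adj (e' a) u ↔ G.Adj b u) := by
    intro a ha b hb
    obtain ⟨u, h1, h2, h3⟩ := halive a ha
    exact ⟨_, h2, fun h' => hBA b hb u h1 (h'.1 h3)⟩
  have hAA : ∀ a ∈ A, ∀ b ∈ A, a < b → ∃ u, τ x ≤ τ u ∧ ¬ (G.Adj (e' a) u ↔ G.Adj (e' b) u) := by
    intro a ha b hb hab
    obtain ⟨u, h1, h2, h3⟩ := hA.separated a ha b hb hab
    exact ⟨e' u, not_lt.1 h2, by rwa [hadj a ha u h1 h2, hadj b hb u h1 h2]⟩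
  have hswap : ∀ {a b : V}, (∃ u, τ x ≤ τ u ∧ ¬ (G.Adj a u ↔ G.Adj b u)) →
      ∃ u, τ x ≤ τ u ∧ ¬ (G.Adj b u ↔ G.Adj a u) := fun ⟨u, h1, h2⟩ =>
    ⟨u, h1, fun h => h2 h.symm⟩
  have hdisj : Disjoint (A.image e') B := by
    rw [Finset.disjoint_left]
    rintro _ h1 h2
    obtain ⟨a, ha, rfl⟩ := Finset.mem_image.1 h1
    obtain ⟨u, -, hu⟩ := hAB a ha _ h2
    exact hu Iff.rfl
  have hcard := hbound x hx (A.image e' ∪ B) (fun a ha => ?_) (fun a ha b hb hab => ?_)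
  · rw [Finset.card_union_of_disjoint hdisj, Finset.card_image_of_injOn fun a ha b hb hab =>
      h.inj' a (hA.lt a ha) b (hA.lt b hb) hab] at hcard
    omega
  · rcases Finset.mem_union.1 ha with ha | ha
    · obtain ⟨a, ha', rfl⟩ := Finset.mem_image.1 ha
      exact hA.mem a ha'
    · exact hB a ha
  · rcases Finset.mem_union.1 ha with ha | ha <;> rcases Finset.mem_union.1 hb with hb | hb
    · obtain ⟨a, ha', rfl⟩ := Finset.mem_image.1 ha
      obtain ⟨b, hb', rfl⟩ := Finset.mem_image.1 hb
      rcases lt_trichotomy a b with hlt | rfl | hlt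
      · exact hAA a ha' b hb' hlt
      · exact (hab rfl).elim
      · exact hswap (hAA b hb' a ha' hlt)
    · obtain ⟨a, ha', rfl⟩ := Finset.mem_image.1 ha
      exact hAB a ha' b hb
    · obtain ⟨b, hb', rfl⟩ := Finset.mem_image.1 hb
      exact hswap (hAB b hb' a ha)
    · exact hsep a ha b hb hab

/-- The case that the last class to be reached in `e` is reached before that in `e'`. -/
theorem contradiction_of_lt (h : Linked G k l e e' z) (hk : 3 ≤ k) (hτ : Function.Injective τ)
    (hbound : ∀ x, (∀ y, ¬ Shares G τ x y) → ∀ A : Finset V, (∀ a ∈ A, τ a < τ x) →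
      (∀ a ∈ A, ∀ b ∈ A, a ≠ b → ∃ u, τ x ≤ τ u ∧ ¬ (G.Adj a u ↔ G.Adj b u)) →
      A.card + 1 ≤ k + 1) {x x' : ℕ} (hx : ∀ q < k, q ≠ x % k → ∃ p < k * k, p % k = q ∧
      τ (e p) < τ (e x)) (hx'lt : x' < k * k)
    (hx' : ∀ p < k * k, p % k = x' % k → τ (e' x') ≤ τ (e' p))
    (hx'' : ∀ q < k, q ≠ x' % k → ∃ p < k * k, p % k = q ∧ τ (e' p) < τ (e' x'))
    (hlt : τ (e x) < τ (e' x')) : False := by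
  classical
  have hkk : 3 * k ≤ k * k := Nat.mul_le_mul_right k hk
  have hc : x' % k < k := Nat.mod_lt _ (by omega)
  -- Sharing would require `x' = 0`, with `2 * k` added earlier; but `x'` is the first of its class.
  have hshare : ∀ y, ¬ Shares G τ (e' x') y := by
    intro y hy
    obtain ⟨rfl, h1⟩ := h.eq_zero_of_shares hk hτ hx'lt hy
    exact (h1 (2 * k) (by omega) (by omega)).not_ge (hx' (2 * k) (by omega) (by simp))
  obtain ⟨A, hAcard, hA, hA'⟩ := exists_spread (T := fun p => τ (e' p) < τ (e' x')) hk hc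
    (fun j hj => by
      have := mul_add_le hj
      exact not_lt.2 (hx' _ (by omega) (by
        rw [Nat.add_mul_mod_self_right, Nat.mod_mod])))
    (fun q hq hqc => by
      obtain ⟨p, h1, h2, h3⟩ := hx'' q hq hqc
      exact ⟨p, h1, h3, h2⟩)
  -- As `k ≥ 3`, at least two classes of `e` other than that of `x` were met before `x`. The smaller
  -- position `a` is not the last one, so `e a` has no neighbour outside `e`.
  obtain ⟨a, b, hab, hb, ha', hb'⟩ : ∃ a b, a < b ∧ b < k * k ∧ τ (e a) < τ (e' x') ∧
      τ (e b) < τ (e' x') := by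
    obtain ⟨q, q', h1, h2, h3, h4, h5⟩ : ∃ q q', q < k ∧ q' < k ∧ q ≠ q' ∧ q ≠ x % k ∧
        q' ≠ x % k := by
      by_cases h0 : x % k = 0
      · exact ⟨1, 2, by omega, by omega, by omega, by omega, by omega⟩
      · by_cases h1 : x % k = 1
        · exact ⟨0, 2, by omega, by omega, by omega, by omega, by omega⟩
        · exact ⟨0, 1, by omega, by omega, by omega, by omega, by omega⟩
    obtain ⟨a, ha1, ha2, ha3⟩ := hx q h1 h4
    obtain ⟨b, hb1, hb2, hb3⟩ := hx q' h2 h5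
    rcases lt_trichotomy a b with hab | rfl | hab
    · exact ⟨a, b, hab, hb1, ha3.trans hlt, hb3.trans hlt⟩
    · exact (h3 (ha2.symm.trans hb2)).elim
    · exact ⟨b, a, hab, ha1, hb3.trans hlt, ha3.trans hlt⟩
  have hea : ∀ v, G.Adj (e a) v → ∃ q < k * k, v = e q := by
    intro v hv
    rcases h.out a (by omega) v hv with h1 | ⟨h1, -⟩
    · exact h1
    · omega
  have heaz : e a ≠ z l := by
    intro he
    rcases Nat.eq_zero_or_pos l with rfl | hl
    · rw [h.first] at he
      have := h.inj a (by omega) _ (by omega) he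
      omega
    · exact h.ne l hl le_rfl a (by omega) he.symm
  have heaE : ∀ u < k * k, ¬ G.Adj (e a) (e' u) := fun u hu =>
    h.not_adj_of_ne heaz (fun p hp => h.disjoint a (by omega) p hp) hu
  by_cases hz : τ (z l) < τ (e' x')
  · by_cases hlast : τ (e' (k * k - 1)) < τ (e' x')
    · by_cases hcol : ∃ p, p + 1 < k * k ∧ τ (e' p) < τ (e' x') ∧ p % k = k - 1
      · obtain ⟨h1, h2⟩ := hA' hlast hcol
        have := h.card_add_card_le hbound hshare h2 (B := {e a}) (by simpa using ha')
          (by simpa using fun u hu => heaE u (by omega)) (by simp)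
        rw [Finset.card_insert_of_notMem h1, Finset.card_singleton, hAcard] at this
        omega
      · push Not at hcol
        have hck : x' % k ≠ k - 1 := by
          intro hck
          refine absurd (hx' (k * k - 1) (by omega) ?_) (not_le.2 hlast)
          obtain ⟨m, rfl⟩ : ∃ m, k = m + 1 := ⟨k - 1, by omega⟩
          have : (m + 1) * (m + 1) - 1 = m + (m + 1) * m := by rw [Nat.mul_succ]; omega
          rw [this, Nat.add_mul_mod_self_left, hck, Nat.mod_eq_of_lt (by omega)]
          omega
        have hmod : ∀ j, (j * k + k - 1) % k = k - 1 := by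
          intro j
          rw [show j * k + k - 1 = k - 1 + j * k by omega, Nat.add_mul_mod_self_right,
            Nat.mod_eq_of_lt (by omega)]
        have hC : ∀ j, j + 1 < k → τ (e' x') < τ (e' (j * k + k - 1)) := by
          intro j hj
          have h1 := mul_add_le hj
          have h2 := succ_mul_eq j k
          have h3 : ¬ τ (e' (j * k + k - 1)) < τ (e' x') := fun h' =>
            hcol _ (by omega) h' (hmod j)
          refine lt_of_le_of_ne (not_lt.1 h3) fun he => hck ?_
          rw [h.inj' x' hx'lt _ (by omega) (hτ he)]
          exact hmod j
        -- In the last class only the last vertex has been added. The count is therefore made at the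
        -- next vertex of `e'` after `x'`, when all classes have been met.
        obtain ⟨w, hw, hw'⟩ := Finset.exists_min_image
          ((Finset.range (k * k)).filter fun p => τ (e' x') < τ (e' p)) (fun p => τ (e' p))
          ⟨0 * k + k - 1, Finset.mem_filter.2 ⟨Finset.mem_range.2 (by omega), hC 0 (by omega)⟩⟩
        simp only [Finset.mem_filter, Finset.mem_range] at hw hw'
        have hC' : ∀ j, j + 1 < k → ¬ τ (e' (j * k + k - 1)) < τ (e' w) := by
          intro j hj
          have h1 := mul_add_le hj
          have h2 := succ_mul_eq j k
          exact not_lt.2 (hw' _ ⟨by omega, hC j hj⟩)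
        have hwshare : ∀ y, ¬ Shares G τ (e' w) y := by
          intro y hy
          obtain ⟨-, h1⟩ := h.eq_zero_of_shares hk hτ hw.1 hy
          exact hC' 1 (by omega) (h1 _ (by omega) (by omega))
        obtain ⟨A, hAcard, hA⟩ := exists_spread_of_last (T := fun p => τ (e' p) < τ (e' w)) hk
          hC' (hlast.trans hw.2) (fun q hq => by
            by_cases hqc : q = x' % k
            · exact ⟨x', hx'lt, hw.2, hqc.symm⟩
            · obtain ⟨p, h1, h2, h3⟩ := hx'' q (by omega) hqc
              exact ⟨p, h1, h3.trans hw.2, h2⟩)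
        have := h.card_add_card_le hbound hwshare hA (B := {e a})
          (by simpa using ha'.trans hw.2) (by simpa using fun u hu => heaE u (by omega)) (by simp)
        rw [Finset.card_singleton, hAcard] at this
        omega
    -- The trace of `z l` contains the last vertex of `e'`, that of `e a` does not, and neither
    -- contains another vertex of `e'`.
    · have hadj : G.Adj (z l) (e' (k * k - 1)) := h.last ▸ h.step l le_rfl
      have hzE : ∀ u, u + 1 < k * k → ¬ G.Adj (z l) (e' u) := by
        intro u hu hadj'
        rcases h.out' u (by omega) _ hadj'.symm with ⟨q, hq, hq'⟩ | ⟨h1, -⟩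
        · exact h.link_ne hq hq'
        · omega
      have := h.card_add_card_le hbound hshare hA (B := {e a, z l}) (by simpa using ⟨ha', hz⟩)
        (by
          simp only [Finset.mem_insert, Finset.mem_singleton]
          rintro b (rfl | rfl) u hu
          · exact heaE u (by omega)
          · exact hzE u hu)
        (by
          simp only [Finset.mem_insert, Finset.mem_singleton]
          rintro b (rfl | rfl) c (rfl | rfl) hbc
          · exact (hbc rfl).elim
          · exact ⟨_, not_lt.1 hlast, fun h' => heaE _ (by omega) (h'.2 hadj)⟩
          · exact ⟨_, not_lt.1 hlast, fun h' => heaE _ (by omega) (h'.1 hadj)⟩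
          · exact (hbc rfl).elim)
      rw [Finset.card_pair heaz, hAcard] at this
      omega
  -- With `z l` not yet added, no added vertex outside `e'` has a neighbour in `e'`. Two different
  -- traces there suffice: inside `e` if it is incomplete, otherwise those of `e a` and of the last
  -- path vertex before the first gap in the path.
  · have key : ∀ y y', τ y < τ (e' x') → τ y' < τ (e' x') → (∀ p < k * k, y ≠ e' p) →
        (∀ p < k * k, y' ≠ e' p) → (∃ u, τ (e' x') ≤ τ u ∧ ¬ (G.Adj y u ↔ G.Adj y' u)) →
        False := by
      intro y y' hy hy' hyE hyE' hsep
      have hyz : ∀ {y}, τ y < τ (e' x') → y ≠ z l := by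
        rintro y hy rfl
        exact hz hy
      have := h.card_add_card_le hbound hshare hA (B := {y, y'}) (by simpa using ⟨hy, hy'⟩)
        (by
          simp only [Finset.mem_insert, Finset.mem_singleton]
          rintro b (rfl | rfl) u hu
          · exact h.not_adj_of_ne (hyz hy) hyE (by omega)
          · exact h.not_adj_of_ne (hyz hy') hyE' (by omega))
        (by
          simp only [Finset.mem_insert, Finset.mem_singleton]
          rintro b (rfl | rfl) c (rfl | rfl) hbc
          · exact (hbc rfl).elim
          · exact hsep
          · obtain ⟨u, h1, h2⟩ := hsep
            exact ⟨u, h1, fun h => h2 h.symm⟩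
          · exact (hbc rfl).elim)
      rw [Finset.card_pair, hAcard] at this
      · omega
      · rintro rfl
        obtain ⟨u, -, h2⟩ := hsep
        exact h2 Iff.rfl
    by_cases hfull : ∀ u < k * k, τ (e u) < τ (e' x')
    · obtain ⟨i, hi, h1, h2⟩ : ∃ i < l, τ (z i) < τ (e' x') ∧ ¬ τ (z (i + 1)) < τ (e' x') := by
        by_contra! hi
        have : ∀ i ≤ l, τ (z i) < τ (e' x') := by
          intro i
          induction i with
          | zero =>
            intro _
            rw [h.first]
            exact hfull _ (by omega)
          | succ i ih => exact fun hil => hi i hil (ih (by omega))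
        exact hz (this l le_rfl)
      refine key (e a) (z i) ha' h1 (h.disjoint a (by omega)) ?_ ⟨_, not_lt.1 h2, fun h' => ?_⟩
      · rcases Nat.eq_zero_or_pos i with rfl | hi0
        · rw [h.first]
          exact h.disjoint _ (by omega)
        · exact h.ne' i hi0 (by omega)
      · obtain ⟨q, hq, hq'⟩ := hea _ (h'.2 (h.step i hi.le))
        exact h2 (hq' ▸ hfull q hq)
    · push Not at hfull
      obtain ⟨u, hu, hu'⟩ := hfull
      obtain ⟨y, hy, y', hy', h1, h2, v, hv, h3, h4⟩ := exists_separated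
        (T := fun p => τ (e p) < τ (e' x')) hk ha' hb' hab hb (not_lt.2 hu') hu
      refine key _ _ h1 h2 (h.disjoint y hy) (h.disjoint y' hy') ⟨e v, not_lt.1 h3, ?_⟩
      rw [h.adj y hy v hv, h.adj y' hy' v hv, and_iff_right, and_iff_right]
      · exact h4
      · rintro rfl
        exact h3 h2
      · rintro rfl
        exact h3 h1

theorem not_hasLinearExpr (h : Linked G k l e e' z) (hk : 3 ≤ k) {m : ℕ} (hm : m ≤ k + 1) :
    ¬ HasLinearExpr m G := by
  intro hG
  obtain ⟨τ, hτ, hbound⟩ := hG.exists_order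
  have hbound' : ∀ x, (∀ y, ¬ Shares G τ x y) → ∀ A : Finset V, (∀ a ∈ A, τ a < τ x) →
      (∀ a ∈ A, ∀ b ∈ A, a ≠ b → ∃ u, τ x ≤ τ u ∧ ¬ (G.Adj a u ↔ G.Adj b u)) →
      A.card + 1 ≤ k + 1 := fun x hx A hA hA' => (hbound x hx A hA hA').trans hm
  obtain ⟨x, hx1, hx2, hx3⟩ := exists_last_class (k := k) (f := fun p => τ (e p)) (by omega)
    fun p hp q hq hpq => h.inj p hp q hq (hτ hpq)
  obtain ⟨y, hy1, hy2, hy3⟩ := exists_last_class (k := k) (f := fun p => τ (e' p)) (by omega)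
    fun p hp q hq hpq => h.inj' p hp q hq (hτ hpq)
  rcases lt_trichotomy (τ (e x)) (τ (e' y)) with hlt | heq | hlt
  · exact h.contradiction_of_lt hk hτ hbound' hx3 hy1 hy2 hy3 hlt
  · exact h.disjoint x hx1 y hy1 (hτ heq)
  · exact h.symm.contradiction_of_lt hk hτ hbound' hy3 hx1 hx2 hx3 hlt

end Linked

variable (k l) in
theorem exists_linked (hk : 3 ≤ k) : ∃ e e' z, Linked (MGraph k l) k l e e' z := by
  have hk2 : k ^ 2 = k * k := sq k
  have hkk : 3 * k ≤ k * k := Nat.mul_le_mul_right k hk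
  let pos : ℕ → Fin (k ^ 2) := fun p => if h : p < k ^ 2 then ⟨p, h⟩ else ⟨0, by omega⟩
  have hpos : ∀ p < k * k, (pos p).val = p := fun p hp => by
    simp only [pos]
    rw [dif_pos (by omega)]
  have hval : ∀ i : Fin (k ^ 2), i = pos i.val := fun i => Fin.ext (hpos i.val (by omega)).symm
  have hinj : ∀ p < k * k, ∀ q < k * k, pos p = pos q → p = q := fun p hp q hq h => by
    rw [← hpos p hp, h, hpos q hq]
  have hadj : ∀ p < k * k, ∀ q < k * k,
      (pathPower k (k ^ 2)).Adj (pos p) (pos q) ↔ p ≠ q ∧ Close k p q := by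
    intro p hp q hq
    change pos p ≠ pos q ∧ (pos p).val ≤ (pos q).val + k ∧ (pos q).val ≤ (pos p).val + k ↔ _
    rw [hpos p hp, hpos q hq]
    exact and_congr_left' (not_congr ⟨hinj p hp q hq, fun h => by rw [h]⟩)
  let z : ℕ → Fin (k ^ 2) ⊕ (Fin (k ^ 2) ⊕ Fin l) := fun i =>
    if i ≤ l then leftTail k l (pos (k * k - 1)) i else Sum.inr (Sum.inl (pos (k * k - 1)))
  have hz : ∀ t : Fin l, z (t.val + 1) = Sum.inr (Sum.inr t) := fun t => by
    simp only [z]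
    rw [if_pos (by omega), leftTail_succ]
  have hz0 : z 0 = Sum.inl (pos (k * k - 1)) := rfl
  have hzl : z (l + 1) = Sum.inr (Sum.inl (pos (k * k - 1))) := if_neg (by omega)
  have hz' : ∀ i, 1 ≤ i → i ≤ l → ∃ t : Fin l, t.val + 1 = i ∧ z i = Sum.inr (Sum.inr t) :=
    fun i h1 h2 => ⟨⟨i - 1, by omega⟩, by simp only; omega, by
      rw [← hz]
      congr 1
      simp only
      omega⟩
  have hlast : ∀ i : Fin (k ^ 2), i.val + 1 = k ^ 2 → i = pos (k * k - 1) := fun i hi =>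
    Fin.ext (by rw [hpos _ (by omega)]; omega)
  refine ⟨fun p => Sum.inl (pos p), fun p => Sum.inr (Sum.inl (pos p)), z, ?_⟩
  refine ⟨fun p hp q hq h => hinj p hp q hq (Sum.inl_injective h),
    fun p hp q hq h => hinj p hp q hq (Sum.inl_injective (Sum.inr_injective h)),
    fun p hp q hq => MGraph_adj_left.trans (hadj p hp q hq),
    fun p hp q hq => MGraph_adj_right.trans (hadj p hp q hq),
    fun p _ q _ => Sum.inl_ne_inr, ?_, ?_, hz0, hzl, ?_, ?_, ?_⟩
  · rintro p hp (i | i | t) hadj'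
    · exact Or.inl ⟨i, by omega, by rw [← hval]⟩
    · rw [MGraph_adj_left_right, hpos p hp] at hadj'
      obtain ⟨rfl, h1, h2⟩ := hadj'
      exact Or.inr ⟨by omega, by rw [hzl, ← hlast i h2]⟩
    · rw [MGraph_adj_left_mid, hpos p hp] at hadj'
      exact Or.inr ⟨by omega, by rw [← hz, hadj'.2]⟩
  · rintro p hp (i | i | t) hadj'
    · rw [MGraph_adj_right_left, hpos p hp] at hadj'
      obtain ⟨rfl, h1, h2⟩ := hadj'
      exact Or.inr ⟨by omega, by rw [hz0, ← hlast i h1]⟩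
    · exact Or.inl ⟨i, by omega, by rw [← hval]⟩
    · rw [MGraph_adj_right_mid, hpos p hp] at hadj'
      exact Or.inr ⟨by omega, by rw [← hz, hadj'.2]⟩
  · intro i hi
    rcases Nat.eq_zero_or_pos i with rfl | h0
    · rw [hz0]
      rcases Nat.eq_zero_or_pos l with rfl | hl
      · rw [hzl, MGraph_adj_left_right, hpos _ (by omega)]
        omega
      · obtain ⟨t, ht, hzt⟩ := hz' 1 le_rfl hl
        rw [hzt, MGraph_adj_left_mid, hpos _ (by omega)]
        omega
    · obtain ⟨t, ht, hzt⟩ := hz' i h0 hi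
      rw [hzt]
      rcases Nat.lt_or_eq_of_le hi with hl | rfl
      · obtain ⟨s, hs, hzs⟩ := hz' (i + 1) (by omega) hl
        rw [hzs, MGraph_adj_mid]
        omega
      · rw [hzl, MGraph_adj_mid_right, hpos _ (by omega)]
        omega
  · intro i h1 h2 p hp
    obtain ⟨t, -, ht⟩ := hz' i h1 h2
    rw [ht]
    exact Sum.inr_ne_inl
  · intro i h1 h2 p hp h
    obtain ⟨t, -, ht⟩ := hz' i h1 h2
    rw [ht] at h
    exact Sum.inr_ne_inl (Sum.inr_injective h)

theorem lt_lcwd_MGraph (hk : 3 ≤ k) : ((k + 1 : ℕ) : ℕ∞) < lcwd (MGraph k l) := by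
  obtain ⟨e, e', z, h⟩ := exists_linked k l hk
  exact lt_lcwd fun m hm => h.not_hasLinearExpr hk hm

end LowerBound

/-! ### Checking given vertex orders -/

section Orders

variable {V : Type*} {G : SimpleGraph V} [DecidableRel G.Adj]

/-- The neighbourhoods in `R` of the vertices in `T`, without repetitions. -/
def traces (G : SimpleGraph V) [DecidableRel G.Adj] (T R : List V) : List (List Bool) :=
  (T.map fun y => R.map fun u => decide (G.Adj y u)).dedup

/-- When the vertices in `R` are added one by one to those in `T`, the vertices that were added
before always have at most `k` neighbourhoods among the others. -/
def FewTraces (G : SimpleGraph V) [DecidableRel G.Adj] (k : ℕ) : List V → List V → Prop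
  | _, [] => True
  | T, x :: R => (traces G T (x :: R)).length ≤ k ∧ FewTraces G k (x :: T) R

instance FewTraces.decidable (k : ℕ) : ∀ T R : List V, Decidable (FewTraces G k T R)
  | _, [] => inferInstanceAs (Decidable True)
  | T, x :: R =>
    have := FewTraces.decidable k (x :: T) R
    inferInstanceAs (Decidable ((traces G T (x :: R)).length ≤ k ∧ FewTraces G k (x :: T) R))

theorem colorable_of_traces {k : ℕ} {T R : List V} (h : (traces G T R).length ≤ k) :
    Colorable k G {v | v ∈ T ∨ v ∈ R} {v | v ∈ T} := by
  have hmem : ∀ y ∈ T, (R.map fun u => decide (G.Adj y u)) ∈ traces G T R := fun y hy =>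
    List.mem_dedup.2 (List.mem_map.2 ⟨y, hy, rfl⟩)
  refine ⟨fun y => (traces G T R).idxOf (R.map fun u => decide (G.Adj y u)),
    fun y hy => (List.idxOf_lt_length_of_mem (hmem y hy)).trans_le h, ?_⟩
  intro y hy y' hy' he u hu huT hadj
  have he' := (List.idxOf_inj (hmem y hy)).1 he
  have hR : u ∈ R := hu.resolve_left huT
  have := List.map_inj_left.1 he' u hR
  simpa [hadj] using this

theorem FewTraces.reach {k : ℕ} : ∀ {T R : List V}, FewTraces G k T R →
    Reach (k + 1) G {v | v ∈ T ∨ v ∈ R} {v | v ∈ T} →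
    Reach (k + 1) G {v | v ∈ T ∨ v ∈ R} {v | v ∈ T ∨ v ∈ R}
  | T, [], _, h => by simpa using h
  | T, x :: R, hF, h => by
    have h' := h.add (colorable_of_traces hF.1) (x := x) (Or.inr List.mem_cons_self)
    have hW : {v | v ∈ T ∨ v ∈ x :: R} = {v | v ∈ x :: T ∨ v ∈ R} := by
      ext v
      simp only [Set.mem_ofPred_eq, List.mem_cons]
      tauto
    have hT : insert x {v | v ∈ T} = {v | v ∈ x :: T} := by
      ext v
      simp
    rw [hW, hT] at h'
    rw [hW]
    exact FewTraces.reach hF.2 h'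

theorem lcwd_induce_le_of_orders {k : ℕ}
    (h : ∀ d : V, ∃ R : List V, FewTraces G k [] R ∧ ∀ v, v = d ∨ ∃ u ∈ R, u = v) {s : Set V}
    (hs : s ≠ Set.univ) : lcwd (G.induce s) ≤ ((k + 1 : ℕ) : ℕ∞) := by
  obtain ⟨d, hd⟩ := (Set.ne_univ_iff_exists_notMem s).1 hs
  obtain ⟨R, hR, hR'⟩ := h d
  refine lcwd_le (Reach.hasLinearExpr (hR.reach ?_) fun v hv => Or.inr ?_)
  swap
  · obtain ⟨u, hu, rfl⟩ := (hR' v).resolve_left fun h => hd (h ▸ hv)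
    exact hu
  convert Reach.empty G _ using 1
  simp

end Orders

/-! ### Pairs of gems -/

section Gems

instance : DecidableRel gem.Adj :=
  inferInstanceAs (DecidableRel (SimpleGraph.fromRel _).Adj)

instance : DecidableRel MMinusTwo.Adj
  | Sum.inl p, Sum.inl q => inferInstanceAs (Decidable (gem.Adj p q))
  | Sum.inr p, Sum.inr q => inferInstanceAs (Decidable (gem.Adj p q))
  | Sum.inl _, Sum.inr _ => isFalse (by simp [MMinusTwo])
  | Sum.inr _, Sum.inl _ => isFalse (by simp [MMinusTwo])

theorem MPlusTwo_adj {p q : Fin 5 ⊕ Fin 5} : MMinusTwo.Adj p q ∨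
    ((Sum.inl 3 = p ∧ Sum.inr 3 = q ∨ Sum.inl 3 = q ∧ Sum.inr 3 = p) ∧ p ≠ q) ↔
      MPlusTwo.Adj p q := by
  rw [MPlusTwo, SimpleGraph.sup_adj, SimpleGraph.edge_adj]
  simp only [eq_comm, and_comm]

instance : DecidableRel MPlusTwo.Adj := fun _ _ => decidable_of_iff _ MPlusTwo_adj

/-- An order of the vertices of two gems: first one gem, then four vertices of the other. -/
def gemOrder (p : Fin 5 → List (Fin 5)) : Fin 5 ⊕ Fin 5 → List (Fin 5 ⊕ Fin 5)
  | Sum.inl d => (List.finRange 5).map Sum.inr ++ (p d).map Sum.inl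
  | Sum.inr d => (List.finRange 5).map Sum.inl ++ (p d).map Sum.inr

theorem lcwd_induce_MPlusTwo_le {s : Set (Fin 5 ⊕ Fin 5)} (hs : s ≠ Set.univ) :
    lcwd (MPlusTwo.induce s) ≤ 3 :=
  -- Unless it is deleted, vertex 3 of the punctured gem comes first: its neighbour in the complete
  -- gem has a trace of its own until then.
  lcwd_induce_le_of_orders (k := 2) (fun d => ⟨gemOrder
    ![[3, 1, 2, 4], [3, 2, 0, 4], [3, 4, 0, 1], [0, 2, 1, 4], [3, 2, 0, 1]] d, by
      revert d
      decide +kernel⟩) hs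

theorem lcwd_induce_MMinusTwo_le {s : Set (Fin 5 ⊕ Fin 5)} (hs : s ≠ Set.univ) :
    lcwd (MMinusTwo.induce s) ≤ 3 :=
  lcwd_induce_le_of_orders (k := 2) (fun d => ⟨gemOrder
    ![[1, 3, 2, 4], [0, 4, 2, 3], [0, 1, 3, 4], [0, 2, 1, 4], [0, 1, 2, 3]] d, by
      revert d
      decide +kernel⟩) hs

/-- When the vertex `x` of a gem is added to `T`, it cannot have the label of another vertex, and
two vertices in `T` have different nonempty neighbourhoods outside `T`. -/
def GemStep (T : Finset (Fin 5)) (x : Fin 5) : Prop :=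
  (∃ a ∈ T, ∃ b ∈ T, (∃ u ∉ T, ¬ (gem.Adj a u ↔ gem.Adj b u)) ∧ (∃ u ∉ T, gem.Adj a u) ∧
    ∃ u ∉ T, gem.Adj b u) ∧
  ∀ q ∈ T, ¬ (¬ gem.Adj x q ∧ (∀ z, gem.Adj x z → gem.Adj q z) ∧
    ∀ z ∉ T, z ≠ x → gem.Adj q z → gem.Adj x z)

instance (T : Finset (Fin 5)) (x : Fin 5) : Decidable (GemStep T x) := by
  unfold GemStep
  infer_instance

/-- Whatever the order, the third or the fourth vertex of a gem is critical; this is checked over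
all orders. -/
theorem gemStep_of_ne : ∀ a b c d : Fin 5, a ≠ b → a ≠ c → b ≠ c → a ≠ d → b ≠ d → c ≠ d →
    GemStep {a, b} c ∨ GemStep {a, b, c} d := by
  decide +kernel

theorem exists_gemStep {f : Fin 5 → ℕ} (hf : Function.Injective f) :
    ∃ x, GemStep (Finset.univ.filter fun q => f q < f x) x := by
  classical
  have hmin : ∀ T : Finset (Fin 5), T.card < 5 → ∃ x ∉ T, ∀ q ∉ T, q ≠ x → f x < f q := by
    intro T hT
    have hne : Tᶜ.Nonempty := by
      rw [← Finset.card_pos, Finset.card_compl, Fintype.card_fin]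
      omega
    obtain ⟨x, hx, hx'⟩ := Finset.exists_min_image Tᶜ f hne
    simp only [Finset.mem_compl] at hx hx'
    exact ⟨x, hx, fun q hq hqx => lt_of_le_of_ne (hx' q hq) fun h => hqx (hf h).symm⟩
  obtain ⟨a, -, ha⟩ := hmin ∅ (by simp)
  obtain ⟨b, hb, hb'⟩ := hmin {a} (by simp)
  obtain ⟨c, hc, hc'⟩ := hmin {a, b} (Finset.card_le_two.trans_lt (by omega))
  obtain ⟨d, hd, hd'⟩ := hmin {a, b, c} (Finset.card_le_three.trans_lt (by omega))
  simp only [Finset.mem_singleton, Finset.mem_insert, not_or, Finset.notMem_empty,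
    not_false_eq_true, true_implies] at *
  have hab : f a < f b := ha b hb
  have hbc : f b < f c := hb' c hc.1 hc.2
  have hcd : f c < f d := hc' d ⟨hd.1, hd.2.1⟩ hd.2.2
  have hC : (Finset.univ.filter fun q => f q < f c) = {a, b} := by
    ext q
    simp only [Finset.mem_filter, Finset.mem_univ, true_and, Finset.mem_insert,
      Finset.mem_singleton]
    constructor
    · intro h
      by_contra hq
      rw [not_or] at hq
      rcases eq_or_ne q c with rfl | hqc
      · exact lt_irrefl _ h
      · exact lt_asymm h (hc' q hq hqc)
    · rintro (rfl | rfl) <;> omega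
  have hD : (Finset.univ.filter fun q => f q < f d) = {a, b, c} := by
    ext q
    simp only [Finset.mem_filter, Finset.mem_univ, true_and, Finset.mem_insert,
      Finset.mem_singleton]
    constructor
    · intro h
      by_contra hq
      rw [not_or, not_or] at hq
      rcases eq_or_ne q d with rfl | hqd
      · exact lt_irrefl _ h
      · exact lt_asymm h (hd' q hq hqd)
    · rintro (rfl | rfl | rfl) <;> omega
  rcases gemStep_of_ne a b c d (Ne.symm hb) (Ne.symm hc.1) (Ne.symm hc.2) (Ne.symm hd.1)
    (Ne.symm hd.2.1) (Ne.symm hd.2.2) with h | h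
  · exact ⟨c, hC ▸ h⟩
  · exact ⟨d, hD ▸ h⟩

variable {V : Type*} {G : SimpleGraph V} {e e' : Fin 5 → V}

/-- `G` contains two disjoint induced gems `e` and `e'`, and the only other edge that leaves one of
them may be that between the vertices `e 3` and `e' 3`. -/
structure TwoGems (G : SimpleGraph V) (e e' : Fin 5 → V) : Prop where
  inj : Function.Injective e
  inj' : Function.Injective e'
  adj : ∀ p q, G.Adj (e p) (e q) ↔ gem.Adj p q
  adj' : ∀ p q, G.Adj (e' p) (e' q) ↔ gem.Adj p q
  disjoint : ∀ p q, e p ≠ e' q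
  out : ∀ p v, G.Adj (e p) v → (∃ q, v = e q) ∨ p = 3 ∧ v = e' 3
  out' : ∀ p v, G.Adj (e' p) v → (∃ q, v = e' q) ∨ p = 3 ∧ v = e 3

/-- A neighbour other than 3 has all its neighbours in its own gem, which forces a vertex that lends
its label to lie there. -/
theorem exists_gem_adj : ∀ x, ∃ u, gem.Adj x u ∧ u ≠ 3 := by
  decide +kernel

namespace TwoGems

theorem symm (h : TwoGems G e e') : TwoGems G e' e :=
  ⟨h.inj', h.inj, h.adj', h.adj, fun p q he => h.disjoint q p he.symm, h.out', h.out⟩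

theorem not_shares (h : TwoGems G e e') {τ : V → ℕ} (hτ : Function.Injective τ) {x : Fin 5}
    (hx : GemStep (Finset.univ.filter fun q => τ (e' q) < τ (e' x)) x) (y : V) :
    ¬ Shares G τ (e' x) y := by
  rintro ⟨hlt, hnadj, hsub, hsup⟩
  obtain ⟨u, hu, hu'⟩ := exists_gem_adj x
  obtain ⟨q, rfl⟩ : ∃ q, y = e' q := by
    rcases h.out' u y (hsub _ ((h.adj' x u).2 hu)).symm with h1 | ⟨h1, -⟩
    · exact h1
    · exact (hu' h1).elim
  refine hx.2 q (Finset.mem_filter.2 ⟨Finset.mem_univ q, hlt⟩)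
    ⟨fun h1 => hnadj ((h.adj' x q).2 h1), fun z hz => ?_, fun z hz hzx hqz => ?_⟩
  · exact (h.adj' q z).1 (hsub _ ((h.adj' x z).2 hz))
  · rw [Finset.mem_filter, not_and] at hz
    have h1 := not_lt.1 (hz (Finset.mem_univ z))
    exact (h.adj' x z).1 (hsup _ (lt_of_le_of_ne h1 fun h2 => hzx (h.inj' (hτ h2)).symm)
      ((h.adj' q z).2 hqz))

/-- The case that the decisive step in `e` precedes that in `e'`. -/
theorem contradiction_of_lt (h : TwoGems G e e') {τ : V → ℕ} (hτ : Function.Injective τ)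
    (hbound : ∀ x, (∀ y, ¬ Shares G τ x y) → ∀ A : Finset V, (∀ a ∈ A, τ a < τ x) →
      (∀ a ∈ A, ∀ b ∈ A, a ≠ b → ∃ u, τ x ≤ τ u ∧ ¬ (G.Adj a u ↔ G.Adj b u)) →
      A.card + 1 ≤ 3) {x x' : Fin 5}
    (hx : GemStep (Finset.univ.filter fun q => τ (e q) < τ (e x)) x)
    (hx' : GemStep (Finset.univ.filter fun q => τ (e' q) < τ (e' x')) x')
    (hlt : τ (e x) < τ (e' x')) : False := by
  classical
  -- Two vertices of `e` precede `e x`. One of them is not the end of the possible link, so it has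
  -- no neighbour in `e'`.
  obtain ⟨y, hy, hy3⟩ : ∃ y, τ (e y) < τ (e' x') ∧ y ≠ 3 := by
    obtain ⟨⟨a, ha, b, hb, ⟨u, -, hu⟩, -⟩, -⟩ := hx
    rw [Finset.mem_filter] at ha hb
    by_cases ha3 : a = 3
    · refine ⟨b, hb.2.trans hlt, ?_⟩
      rintro rfl
      exact hu (by rw [ha3])
    · exact ⟨a, ha.2.trans hlt, ha3⟩
  have hyE : ∀ u, ¬ G.Adj (e y) (e' u) := by
    intro u hadj
    rcases h.out y _ hadj with ⟨q, hq⟩ | ⟨h1, -⟩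
    · exact h.disjoint q u hq.symm
    · exact hy3 h1
  have hns := h.not_shares hτ hx'
  obtain ⟨⟨a, ha, b, hb, ⟨u, hu, hu'⟩, ⟨v, hv, hv'⟩, w, hw, hw'⟩, -⟩ := hx'
  simp only [Finset.mem_filter, Finset.mem_univ, true_and, not_lt] at ha hb hu hv hw
  have s1 : ∃ u, τ (e' x') ≤ τ u ∧ ¬ (G.Adj (e' a) u ↔ G.Adj (e' b) u) :=
    ⟨e' u, hu, by rwa [h.adj', h.adj']⟩
  have s2 : ∃ u, τ (e' x') ≤ τ u ∧ ¬ (G.Adj (e' a) u ↔ G.Adj (e y) u) :=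
    ⟨e' v, hv, fun h' => hyE v (h'.1 ((h.adj' a v).2 hv'))⟩
  have s3 : ∃ u, τ (e' x') ≤ τ u ∧ ¬ (G.Adj (e' b) u ↔ G.Adj (e y) u) :=
    ⟨e' w, hw, fun h' => hyE w (h'.1 ((h.adj' b w).2 hw'))⟩
  have hswap : ∀ {a b : V}, (∃ u, τ (e' x') ≤ τ u ∧ ¬ (G.Adj a u ↔ G.Adj b u)) →
      ∃ u, τ (e' x') ≤ τ u ∧ ¬ (G.Adj b u ↔ G.Adj a u) := fun ⟨u, h1, h2⟩ =>
    ⟨u, h1, fun h => h2 h.symm⟩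
  have hab : e' a ≠ e' b := fun hab => by
    obtain ⟨u, -, hu⟩ := s1
    exact hu (by rw [hab])
  have := hbound _ hns {e' a, e' b, e y} (by simpa using ⟨ha, hb, hy⟩) (by
    simp only [Finset.mem_insert, Finset.mem_singleton]
    rintro c (rfl | rfl | rfl) d (rfl | rfl | rfl) hcd
    · exact (hcd rfl).elim
    · exact s1
    · exact s2
    · exact hswap s1
    · exact (hcd rfl).elim
    · exact s3
    · exact hswap s2
    · exact hswap s3
    · exact (hcd rfl).elim)
  rw [Finset.card_eq_three.2 ⟨_, _, _, hab, (h.disjoint y a).symm, (h.disjoint y b).symm, rfl⟩]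
    at this
  omega

theorem three_lt_lcwd (h : TwoGems G e e') : 3 < lcwd G := by
  refine lt_lcwd (k := 3) fun m hm hG => ?_
  obtain ⟨τ, hτ, hbound⟩ := hG.exists_order
  have hbound' : ∀ x, (∀ y, ¬ Shares G τ x y) → ∀ A : Finset V, (∀ a ∈ A, τ a < τ x) →
      (∀ a ∈ A, ∀ b ∈ A, a ≠ b → ∃ u, τ x ≤ τ u ∧ ¬ (G.Adj a u ↔ G.Adj b u)) →
      A.card + 1 ≤ 3 := fun x hx A hA hA' => (hbound x hx A hA hA').trans hm
  obtain ⟨x, hx⟩ := exists_gemStep (f := fun q => τ (e q)) (hτ.comp h.inj)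
  obtain ⟨x', hx'⟩ := exists_gemStep (f := fun q => τ (e' q)) (hτ.comp h.inj')
  rcases lt_trichotomy (τ (e x)) (τ (e' x')) with hlt | heq | hlt
  · exact h.contradiction_of_lt hτ hbound' hx hx' hlt
  · exact h.disjoint x x' (hτ heq)
  · exact h.symm.contradiction_of_lt hτ hbound' hx' hx hlt

end TwoGems

theorem twoGems_MPlusTwo : TwoGems MPlusTwo Sum.inl Sum.inr :=
  ⟨Sum.inl_injective, Sum.inr_injective, by decide +kernel, by decide +kernel,
    fun _ _ => Sum.inl_ne_inr, by decide +kernel, by decide +kernel⟩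

theorem twoGems_MMinusTwo : TwoGems MMinusTwo Sum.inl Sum.inr :=
  ⟨Sum.inl_injective, Sum.inr_injective, by decide +kernel, by decide +kernel,
    fun _ _ => Sum.inl_ne_inr, by decide +kernel, by decide +kernel⟩

end Gems

end LinCW

theorem mainTheorem3 :
    (∀ s : Set (Fin 5 ⊕ Fin 5), s ≠ Set.univ → LinCW.lcwd (LinCW.MPlusTwo.induce s) ≤ 3) ∧
    (∀ s : Set (Fin 5 ⊕ Fin 5), s ≠ Set.univ → LinCW.lcwd (LinCW.MMinusTwo.induce s) ≤ 3) ∧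
    (∀ k l : ℕ, 3 ≤ k → ∀ s : Set (Fin (k ^ 2) ⊕ (Fin (k ^ 2) ⊕ Fin l)), s ≠ Set.univ →
      LinCW.lcwd ((LinCW.MGraph k l).induce s) ≤ ((k + 1 : ℕ) : ℕ∞)) ∧
    3 < LinCW.lcwd LinCW.MPlusTwo ∧
    3 < LinCW.lcwd LinCW.MMinusTwo ∧
    (∀ k l : ℕ, 3 ≤ k → ((k + 1 : ℕ) : ℕ∞) < LinCW.lcwd (LinCW.MGraph k l)) :=
  ⟨fun _ => LinCW.lcwd_induce_MPlusTwo_le, fun _ => LinCW.lcwd_induce_MMinusTwo_le,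
    fun _ _ hk _ => LinCW.lcwd_induce_MGraph_le hk, LinCW.twoGems_MPlusTwo.three_lt_lcwd,
    LinCW.twoGems_MMinusTwo.three_lt_lcwd, fun _ _ => LinCW.lt_lcwd_MGraph⟩
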